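/- **Setting.** Let $\mathfrak g$ be a complex simple Lie algebra (equivalently, an irreducible reduced crystallographic root system) with simple roots $\alpha_i$, fundamental weights $\omega_i$ ($i\in I$) and Cartan matrix $C_{ij}=(\alpha_i^\vee,\alpha_j)$. Let $r_i$ be the relatively prime positive integers with $r_iC_{ij}=r_jC_{ji}$, and $r^\vee=\max_i r_i$. Let $\rho,\rho^\vee$ be the vectors with $r^\vee(\rho,\alpha_i)=r_i$ and $(\rho^\vee,\alpha_i)=1$. Let $h$ and $h^\vee$ be the Coxeter and dual Coxeter numbers, and let $i\mapsto i^*$ be defined by $w_0\alpha_i=-\alpha_{i^*}$, with $w_0$ the longest Weyl group element. Let $q=e^{\hbar}$, $t=q^\beta$ with $\hbar,\beta\in\mathbb C$ be generic, i.e. $q^mt^n\ne1$ for $(m,n)\in\mathbb Z^2\setminus\{0\}$; for complex exponents $q^xt^y:=e^{\hbar(x+\beta y)}$. Put $[n]_q=\frac{q^n-q^{-n}}{q-q^{-1}}$, $I_{ij}=2\delta_{ij}-C_{ij}$, $$C_{ij}(q,t)=(q^{r_i}t^{-1}+q^{-r_i}t)\,\delta_{ij}-[I_{ij}]_q\ \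 (\text{with } [I_{ii}]_q=0),\qquad B_{ij}(q,t)=[r_i]_q\,C_{ij}(q,t).$$ The extended deformed Heisenberg algebra is generated by $a_i[m]$ ($i\in I$, $m\in\mathbb Z$), by the exponentials $q^{2\sum_i u_iy_i[0]}$ ($u\in\mathbb Z^I$) and $e^{\sum_j v_jQ_j}$ ($v\in\mathbb C^I$), additive in the exponent, with $$[a_i[m],a_j[n]]=\tfrac1m(q^m-q^{-m})(t^m-t^{-m})B_{ij}(q^m,t^m)\,\delta_{m+n,0}\quad(\text{zero for } m=0),$$ $$[a_i[m],e^{Q_j}]=\beta\, r_iC_{ij}\,\delta_{m,0}\,e^{Q_j},\qquad [y_i[0],e^{Q_j}]=\beta\, r_i\,\delta_{ij}\,e^{Q_j},\qquad [y_i[0],a_j[m]]=0,$$ the relations for $y_i[0]$ being imposed in exponentiated form. The $y_i[m]$ are defined by $a_i[m]=\sum_jC_{ji}(q^m,t^m)\,y_j[m]$. The Fock module $F(0)$ is generated by a vector $|0\rangle$ with $a_i[m]|0\rangle=0$ ($m\ge0$) and $q^{2y_i[0]}|0\rangle=|0\rangle$; the vectors $e^{\sum_j v_jQ_j}|0\rangle$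 are the vacua of the other Fock modules. Put $$Y_i(z)=t^{2(\rho^\vee,\omega_i)}q^{-2r^\vee(\rho,\omega_i)+2y_i[0]}:\exp\Big(\sum_{m\ne0}y_i[m]z^{-m}\Big):,$$ $$A_i(z)=\;:Y_i(zq^{-r_i}t)\,Y_i(zq^{r_i}t^{-1})\prod_{k\ne i}\prod_{s=0}^{I_{ki}-1}Y_k(zq^{I_{ki}-1-2s})^{-1}:,\qquad Y_i^{(-)}(z)=\;:Y_i(z)\,A_i(zq^{-r_i}t)^{-1}:.$$ The screening currents on $F(0)$ are $$S_j^+(z)=e^{-Q_j/r_j}:\exp\sum_{m\ne0}\frac{a_j[m]}{q^{mr_j}-q^{-mr_j}}z^{-m}:,\qquad S_j^-(z)=e^{Q_j/\beta}:\exp\Big(-\sum_{m\ne0}\frac{a_j[m]}{t^m-t^{-m}}z^{-m}\Big):,$$ and the screening operators $S_j^\pm$ are their coefficients of $z^{-1}$, as maps from $F(0)$ to another Fock module. **The generators.** For $j\in I$ let $$s_j(x)=\frac{(q^{r_j}-q^{-r_j}x)(t^{-1}-tx)}{(1-x)(q^{r_j}t^{-1}-q^{-r_j}tx)}.$$ An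 $sl_2$ block in direction $j$ is a sum $$\sum_{M\subseteq S}\ \prod_{u\in M,\ v\in S\setminus M}s_j(u/v)\;:N(z)\prod_{v\in S\setminus M}Y_j(zv)\prod_{u\in M}Y_j^{(-)}(zu):,$$ where $S$ is a finite set of parameters $q^at^b$ ($a,b\in\mathbb Z$), no two of which have ratio $q^{2r_j}t^{-2}$, and $N(z)$ is a monomial in the $Y_k(zq^at^b)^{\pm1}$ with $k\ne j$. A field $T_i(z)$ is called a generator of the deformed $W$-algebra associated with the node $i$ if 1. all its modes commute on $F(0)$ with all screening operators $S_j^\pm$; 2. it is a finite linear combination of monomials of the form $:Y_i(z)\prod A_j(zq^at^b)^{-1}:$, in which $Y_i(z)$ has coefficient $1$; 3. it is obtained from $Y_i(z)$ by pasting $sl_2$ directions: for each $j\in I$ it is a linear combination of $sl_2$ blocks in direction $j$, and each monomial $\ne Y_i(z)$ that occurs in it is obtained from another one that occurs by replacing, for some $j$, a factor $Y_j(zq^at^b)$, occurring to a positive power, by $Y_j^{(-)}(zq^at^b)$. **The anti-involution.** For $a,b\in\mathbb C$ let $\omega_{a,b}$ be the $\mathbb C$-linear anti-involution of the extended deformed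 Heisenberg algebra with $$\omega_{a,b}(a_i[0])=-a_i[0]+2r^\vee(\rho,\alpha_i)-2\beta(\rho^\vee,\alpha_i),\qquad \omega_{a,b}(a_i[m])=-(q^at^b)^m\,a_i[-m]\ \ (m\ne0),\qquad \omega_{a,b}(Q_i)=Q_i,$$ so that $\omega_{a,b}(q^{2y_i[0]})=q^{4r^\vee(\rho,\omega_i)-4\beta(\rho^\vee,\omega_i)}\,q^{-2y_i[0]}$. It acts on fields mode by mode: $\omega_{a,b}\big(\sum_mF[m]z^{-m}\big)=\sum_m\omega_{a,b}(F[m])z^{-m}$. The normalized $\omega$ is $\omega_{a,b}$ with $a=-r^\vee h^\vee$ and $b=h$. **Lemma 4.1.** Let $i\in I$ and let $T_i(z)$, $T_{i^*}(z)$ be generators of the deformed $W$-algebra associated with the nodes $i$ and $i^*$. Then for all $a,b\in\mathbb C$ $$\omega_{a,b}(T_i(z))=T_{i^*}\big(q^{a+r^\vee h^\vee}t^{b-h}/z\big).$$ In particular, the normalized $\omega$ satisfies $\omega(T_i(z))=T_{i^*}(1/z)$. -/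

import Mathlib

open scoped BigOperators Matrix

noncomputable section

namespace DeformedW

/-- The data entering the deformed Heisenberg algebra: a Cartan matrix `C`, with the convention
`C i j = (α_i^∨, α_j)`, the symmetrizing integers `r i`, and complex numbers `hbar`, `beta`.
The deformation parameters are `q = exp hbar` and `t = q ^ beta = exp (hbar * beta)`. -/
structure Params (I : Type*) where
  C : Matrix I I ℤ
  r : I → ℕ
  hbar : ℂ
  beta : ℂ

variable {I : Type*}

namespace Params

/-- `q ^ x * t ^ y` for complex exponents `x`, `y`. -/
def qt (p : Params I) (x y : ℂ) : ℂ := Complex.exp (p.hbar * (x + p.beta * y))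

theorem qt_neg (p : Params I) (x y : ℂ) : p.qt (-x) (-y) = (p.qt x y)⁻¹ := by
  rw [qt, qt, ← Complex.exp_neg]
  congr 1
  ring

/-- `q` and `t` are generic: multiplicatively independent. -/
def Generic (p : Params I) : Prop := ∀ m n : ℤ, p.qt m n = 1 → m = 0 ∧ n = 0

/-- The `r i` are the relatively prime positive integers for which `diag(r) * C` is symmetric. -/
def IsSymmetrizer [Fintype I] (p : Params I) : Prop :=
  (∀ i, 0 < p.r i) ∧ (∀ i j, (p.r i : ℤ) * p.C i j = (p.r j : ℤ) * p.C j i) ∧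
    Finset.univ.gcd p.r = 1

/-- The dual tier number `r^∨`: the largest of the relatively prime integers `r i`. -/
def rcheck [Fintype I] (p : Params I) : ℕ := Finset.univ.sup p.r

/-- Off-diagonal entries of the incidence matrix `2 - C`, as natural numbers. -/
def inc (p : Params I) (i j : I) : ℕ := (-p.C i j).toNat

end Params

/-- The `q`-integer `[n]_x = (x^n - x^{-n}) / (x - x^{-1}) = x^{n-1} + x^{n-3} + ⋯ + x^{1-n}`. -/
def qInt (x : ℂ) (n : ℕ) : ℂ := ∑ k ∈ Finset.range n, x ^ ((n : ℤ) - 1 - 2 * k)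

theorem qInt_inv (x : ℂ) (n : ℕ) : qInt x⁻¹ n = qInt x n := by
  unfold qInt
  rw [← Finset.sum_range_reflect]
  refine Finset.sum_congr rfl fun k hk => ?_
  have hk' : k < n := Finset.mem_range.mp hk
  rw [inv_zpow', Nat.sub_sub, Nat.cast_sub (by omega)]
  congr 1
  push_cast
  ring

variable [DecidableEq I]

namespace Params

/-- The deformed Cartan matrix `C(x, y)`:
`C_ij(x, y) = (x^{r_i} y^{-1} + x^{-r_i} y) δ_ij - [I_ij]_x`. -/
def Cdef (p : Params I) (x y : ℂ) : Matrix I I ℂ := Matrix.of fun i j =>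
  if i = j then x ^ (p.r i : ℤ) * y⁻¹ + x ^ (-(p.r i : ℤ)) * y else -qInt x (p.inc i j)

theorem Cdef_inv (p : Params I) (x y : ℂ) : p.Cdef x⁻¹ y⁻¹ = p.Cdef x y := by
  ext i j
  by_cases h : i = j
  · subst h
    simp [Cdef, add_comm]
  · simp [Cdef, h, qInt_inv]

variable [Fintype I]

/-- `B(x, y) = D(x, y) C(x, y)` with `D_ij(x, y) = [r_i]_x δ_ij`. -/
def Bdef (p : Params I) (x y : ℂ) : Matrix I I ℂ :=
  Matrix.diagonal (fun i => qInt x (p.r i)) * p.Cdef x y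

theorem Bdef_inv (p : Params I) (x y : ℂ) : p.Bdef x⁻¹ y⁻¹ = p.Bdef x y := by
  simp [Bdef, Cdef_inv, qInt_inv]

/-- The structure constants
`[a_i[m], a_j[-m]] = (1/m) (q^m - q^{-m}) (t^m - t^{-m}) B_ij(q^m, t^m)`; zero for `m = 0`. -/
def comm (p : Params I) (i j : I) (m : ℤ) : ℂ :=
  (m : ℂ)⁻¹ * (p.qt m 0 - p.qt (-m) 0) * (p.qt 0 m - p.qt 0 (-m)) *
    p.Bdef (p.qt m 0) (p.qt 0 m) i j

theorem comm_neg (p : Params I) (i j : I) (m : ℤ) : p.comm i j (-m) = -p.comm i j m := by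
  have h1 : p.qt (-(m : ℂ)) 0 = (p.qt m 0)⁻¹ := by simpa using p.qt_neg m 0
  have h2 : p.qt 0 (-(m : ℂ)) = (p.qt 0 m)⁻¹ := by simpa using p.qt_neg 0 m
  simp only [comm, Int.cast_neg, neg_neg, h1, h2, Bdef_inv, inv_neg]
  ring

/-- `(ρ^∨, ω_i)`, computed from `ω_i = ∑_k (C⁻¹)_ki α_k` and `(ρ^∨, α_k) = 1`. -/
def rhoCheckOmega (p : Params I) (i : I) : ℂ := ∑ k, ((p.C.map (Int.cast : ℤ → ℚ))⁻¹ k i : ℚ)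

/-- `r^∨ (ρ, ω_i)`, computed from `ω_i = ∑_k (C⁻¹)_ki α_k` and `r^∨ (ρ, α_k) = r_k`. -/
def rhoOmega (p : Params I) (i : I) : ℂ :=
  ∑ k, (p.r k : ℂ) * ((p.C.map (Int.cast : ℤ → ℚ))⁻¹ k i : ℚ)

end Params

variable [Fintype I]

/-- Generators of the extended deformed Heisenberg algebra: the modes `a i m = a_i[m]`, the
exponentials of zero modes `K u = q^{2 ∑_i u_i y_i[0]}`, and the shift operators
`X v = e^{∑_j v_j Q_j}`. -/
inductive Gen (I : Type*)
  | a (i : I) (m : ℤ)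
  | K (u : I → ℤ)
  | X (v : I → ℂ)

/-- Defining relations of the extended deformed Heisenberg algebra. -/
inductive HeisRel (p : Params I) : FreeAlgebra ℂ (Gen I) → FreeAlgebra ℂ (Gen I) → Prop
  | heis (i j : I) (m n : ℤ) : HeisRel p
      (FreeAlgebra.ι ℂ (Gen.a i m) * FreeAlgebra.ι ℂ (Gen.a j n))
      (FreeAlgebra.ι ℂ (Gen.a j n) * FreeAlgebra.ι ℂ (Gen.a i m) +
        algebraMap ℂ _ (if m + n = 0 then p.comm i j m else 0))
  | K_zero : HeisRel p (FreeAlgebra.ι ℂ (Gen.K 0)) 1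
  | K_add (u v : I → ℤ) : HeisRel p (FreeAlgebra.ι ℂ (Gen.K (u + v)))
      (FreeAlgebra.ι ℂ (Gen.K u) * FreeAlgebra.ι ℂ (Gen.K v))
  | K_a (u : I → ℤ) (i : I) (m : ℤ) : HeisRel p
      (FreeAlgebra.ι ℂ (Gen.K u) * FreeAlgebra.ι ℂ (Gen.a i m))
      (FreeAlgebra.ι ℂ (Gen.a i m) * FreeAlgebra.ι ℂ (Gen.K u))
  | X_zero : HeisRel p (FreeAlgebra.ι ℂ (Gen.X 0)) 1
  | X_add (u v : I → ℂ) : HeisRel p (FreeAlgebra.ι ℂ (Gen.X (u + v)))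
      (FreeAlgebra.ι ℂ (Gen.X u) * FreeAlgebra.ι ℂ (Gen.X v))
  /- `[a_i[m], e^{Q_j}] = B_ij β δ_{m,0} e^{Q_j}` with `B_ij = r_i C_ij`. -/
  | a_X (i : I) (m : ℤ) (v : I → ℂ) : HeisRel p
      (FreeAlgebra.ι ℂ (Gen.a i m) * FreeAlgebra.ι ℂ (Gen.X v))
      (FreeAlgebra.ι ℂ (Gen.X v) * FreeAlgebra.ι ℂ (Gen.a i m) +
        (if m = 0 then p.beta * ∑ j, ((p.r i : ℂ) * (p.C i j : ℂ)) * v j else 0) •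
          FreeAlgebra.ι ℂ (Gen.X v))
  /- The exponentiated form of `[y_i[0], e^{Q_j}] = r_i β δ_ij e^{Q_j}`. -/
  | K_X (u : I → ℤ) (v : I → ℂ) : HeisRel p
      (FreeAlgebra.ι ℂ (Gen.K u) * FreeAlgebra.ι ℂ (Gen.X v))
      (p.qt (2 * p.beta * ∑ i, (u i : ℂ) * (p.r i : ℂ) * v i) 0 •
        (FreeAlgebra.ι ℂ (Gen.X v) * FreeAlgebra.ι ℂ (Gen.K u)))

/-- The extended deformed Heisenberg algebra. -/
def Heis (p : Params I) : Type _ := RingQuot (HeisRel p)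

namespace Heis

instance (p : Params I) : Ring (Heis p) := inferInstanceAs (Ring (RingQuot (HeisRel p)))

instance (p : Params I) : Algebra ℂ (Heis p) :=
  inferInstanceAs (Algebra ℂ (RingQuot (HeisRel p)))

/-- The quotient map from the free algebra. -/
def mk (p : Params I) : FreeAlgebra ℂ (Gen I) →ₐ[ℂ] Heis p := RingQuot.mkAlgHom ℂ (HeisRel p)

theorem mk_rel (p : Params I) {s s' : FreeAlgebra ℂ (Gen I)} (h : HeisRel p s s') :
    mk p s = mk p s' := RingQuot.mkAlgHom_rel ℂ h

/-- The universal property of the extended deformed Heisenberg algebra. -/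
def lift (p : Params I) {A : Type*} [Ring A] [Algebra ℂ A] (f : FreeAlgebra ℂ (Gen I) →ₐ[ℂ] A)
    (hf : ∀ s s', HeisRel p s s' → f s = f s') : Heis p →ₐ[ℂ] A :=
  RingQuot.liftAlgHom ℂ ⟨f, fun s s' h => hf s s' h⟩

theorem lift_mk (p : Params I) {A : Type*} [Ring A] [Algebra ℂ A]
    (f : FreeAlgebra ℂ (Gen I) →ₐ[ℂ] A) (hf : ∀ s s', HeisRel p s s' → f s = f s')
    (x : FreeAlgebra ℂ (Gen I)) : lift p f hf (mk p x) = f x :=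
  RingQuot.liftAlgHom_mkAlgHom_apply ℂ f (fun s s' h => hf s s' h) x

variable (p : Params I)

/-- The class of a generator. -/
def gen (g : Gen I) : Heis p := mk p (FreeAlgebra.ι ℂ g)

/-- The root type modes `a_i[m]`. -/
def a (i : I) (m : ℤ) : Heis p := gen p (Gen.a i m)

/-- `q^{2 ∑_i u_i y_i[0]}`. -/
def K (u : I → ℤ) : Heis p := gen p (Gen.K u)

/-- `e^{∑_j v_j Q_j}`. -/
def X (v : I → ℂ) : Heis p := gen p (Gen.X v)

/-- The weight type modes `y_i[m]`, solving `a_i[m] = ∑_j C_ji(q^m, t^m) y_j[m]`. -/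
def y (i : I) (m : ℤ) : Heis p :=
  ∑ j, ((p.Cdef (p.qt m 0) (p.qt 0 m))⁻¹ j i) • a p j m

theorem a_mul_a (i j : I) (m n : ℤ) :
    a p i m * a p j n =
      a p j n * a p i m + algebraMap ℂ _ (if m + n = 0 then p.comm i j m else 0) := by
  simpa [a, gen] using mk_rel p (HeisRel.heis (p := p) i j m n)

theorem K_zero : K p 0 = 1 := by
  simpa [K, gen] using mk_rel p (HeisRel.K_zero (p := p))

theorem K_add (u v : I → ℤ) : K p (u + v) = K p u * K p v := by
  simpa [K, gen] using mk_rel p (HeisRel.K_add (p := p) u v)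

theorem K_mul_a (u : I → ℤ) (i : I) (m : ℤ) : K p u * a p i m = a p i m * K p u := by
  simpa [K, a, gen] using mk_rel p (HeisRel.K_a (p := p) u i m)

theorem X_zero : X p 0 = 1 := by
  simpa [X, gen] using mk_rel p (HeisRel.X_zero (p := p))

theorem X_add (u v : I → ℂ) : X p (u + v) = X p u * X p v := by
  simpa [X, gen] using mk_rel p (HeisRel.X_add (p := p) u v)

theorem a_mul_X (i : I) (m : ℤ) (v : I → ℂ) :
    a p i m * X p v = X p v * a p i m +
      (if m = 0 then p.beta * ∑ j, ((p.r i : ℂ) * (p.C i j : ℂ)) * v j else 0) • X p v := by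
  have h := mk_rel p (HeisRel.a_X (p := p) i m v)
  rw [map_add, map_mul, map_mul, map_smul] at h
  exact h

theorem K_mul_X (u : I → ℤ) (v : I → ℂ) :
    K p u * X p v =
      p.qt (2 * p.beta * ∑ i, (u i : ℂ) * (p.r i : ℂ) * v i) 0 • (X p v * K p u) := by
  have h := mk_rel p (HeisRel.K_X (p := p) u v)
  rw [map_smul, map_mul, map_mul] at h
  exact h

/-- Images of the generators under `ω_{x,y}`:
`a_i[0] ↦ -a_i[0] + 2 r^∨ (ρ, α_i) - 2 β (ρ^∨, α_i) = -a_i[0] + 2 r_i - 2 β`,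
`a_i[m] ↦ -(q^x t^y)^m a_i[-m]` for `m ≠ 0`, `Q_i ↦ Q_i`, and correspondingly
`q^{2 y_i[0]} ↦ q^{4 r^∨ (ρ, ω_i) - 4 β (ρ^∨, ω_i)} q^{-2 y_i[0]}`. -/
def omegaGen (x y : ℂ) : Gen I → (Heis p)ᵐᵒᵖ
  | Gen.a i m => MulOpposite.op (if m = 0 then
      -a p i 0 + algebraMap ℂ _ (2 * (p.r i : ℂ) - 2 * p.beta) else
      -((p.qt x y ^ m) • a p i (-m)))
  | Gen.K u => MulOpposite.op
      (p.qt (4 * ∑ i, (u i : ℂ) * p.rhoOmega i) (-4 * ∑ i, (u i : ℂ) * p.rhoCheckOmega i) •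
        K p (-u))
  | Gen.X v => MulOpposite.op (X p v)

/-- The anti-homomorphism `ω_{x,y}`, as an algebra homomorphism into the opposite algebra. -/
def omegaOp (x y : ℂ) : Heis p →ₐ[ℂ] (Heis p)ᵐᵒᵖ :=
  lift p (FreeAlgebra.lift ℂ (omegaGen p x y)) (by
    intro s s' h
    cases h with
    | heis i j m n =>
      simp only [map_mul, map_add, FreeAlgebra.lift_ι_apply, AlgHom.commutes]
      apply MulOpposite.unop_injective
      simp only [omegaGen, MulOpposite.unop_mul, MulOpposite.unop_op, MulOpposite.unop_add,
        MulOpposite.algebraMap_apply]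
      by_cases hm : m = 0 <;> by_cases hn : n = 0
      · subst hm hn
        have h := a_mul_a p j i 0 0
        have h0 : ∀ i j, p.comm i j 0 = 0 := fun i j => by simp [Params.comm]
        simp only [h0, add_zero, if_true, map_zero] at h ⊢
        have e1 := Algebra.commutes (R := ℂ) (2 * (p.r i : ℂ) - 2 * p.beta) (a p j 0)
        have e2 := Algebra.commutes (R := ℂ) (2 * (p.r j : ℂ) - 2 * p.beta) (a p i 0)
        have e3 := Algebra.commutes (R := ℂ) (2 * (p.r i : ℂ) - 2 * p.beta)
          (algebraMap ℂ (Heis p) (2 * (p.r j : ℂ) - 2 * p.beta))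
        simp only [mul_add, add_mul, neg_mul, mul_neg, h, e1, e2, e3]
        abel
      · subst hm
        have h := a_mul_a p j i (-n) 0
        have e1 := Algebra.commutes (R := ℂ) (2 * (p.r i : ℂ) - 2 * p.beta) (a p j (-n))
        simp only [hn, add_zero, zero_add, neg_eq_zero, if_true, if_false, map_zero] at h ⊢
        simp only [mul_add, add_mul, neg_mul, mul_neg, neg_neg, smul_mul_assoc, mul_smul_comm,
          h, e1, smul_add, smul_neg, neg_add]
      · subst hn
        have h := a_mul_a p i j (-m) 0
        have e1 := Algebra.commutes (R := ℂ) (2 * (p.r j : ℂ) - 2 * p.beta) (a p i (-m))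
        simp only [hm, add_zero, neg_eq_zero, if_true, if_false, map_zero] at h ⊢
        simp only [mul_add, add_mul, neg_mul, mul_neg, neg_neg, smul_mul_assoc, mul_smul_comm,
          h, e1, smul_add, smul_neg, neg_add]
      · have h := a_mul_a p i j (-m) (-n)
        have hz : p.qt x y ≠ 0 := Complex.exp_ne_zero _
        simp only [hm, hn, if_false, neg_mul_neg, smul_mul_assoc, mul_smul_comm, h, smul_add,
          smul_smul]
        by_cases hmn : m + n = 0
        · have hmn' : -m + -n = 0 := by omega
          have hc : p.qt x y ^ n * p.qt x y ^ m = 1 := by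
            rw [← zpow_add₀ hz, add_comm, hmn, zpow_zero]
          have hc' : p.qt x y ^ m * p.qt x y ^ n = 1 := by rw [mul_comm, hc]
          simp only [hmn, hmn', if_true, hc, hc', one_smul, Params.comm_neg, map_neg]
          abel
        · have hmn' : ¬ (-m + -n = 0) := by omega
          simp only [hmn, hmn', if_false, map_zero, smul_zero, add_zero, mul_comm]
    | K_zero =>
      simp only [map_one, FreeAlgebra.lift_ι_apply]
      apply MulOpposite.unop_injective
      simp [omegaGen, K_zero, Params.qt]
    | K_add u v =>
      simp only [map_mul, FreeAlgebra.lift_ι_apply]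
      apply MulOpposite.unop_injective
      simp only [omegaGen, MulOpposite.unop_mul, MulOpposite.unop_op, neg_add_rev, K_add,
        smul_mul_smul_comm]
      congr 1
      simp only [Params.qt, ← Complex.exp_add]
      congr 1
      simp only [Pi.add_apply, Int.cast_add, add_mul, Finset.sum_add_distrib]
      ring
    | K_a u i m =>
      simp only [map_mul, FreeAlgebra.lift_ι_apply]
      apply MulOpposite.unop_injective
      simp only [omegaGen, MulOpposite.unop_mul, MulOpposite.unop_op]
      split_ifs
      · simp only [mul_smul_comm, smul_mul_assoc, mul_add, add_mul, neg_mul, mul_neg, K_mul_a,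
          Algebra.commutes, smul_add, smul_neg]
      · simp only [mul_smul_comm, smul_mul_assoc, neg_mul, mul_neg, K_mul_a, smul_neg]
        rw [smul_comm]
    | X_zero =>
      simp only [map_one, FreeAlgebra.lift_ι_apply]
      apply MulOpposite.unop_injective
      simp [omegaGen, X_zero]
    | X_add u v =>
      simp only [map_mul, FreeAlgebra.lift_ι_apply]
      apply MulOpposite.unop_injective
      simp only [omegaGen, MulOpposite.unop_mul, MulOpposite.unop_op, ← X_add, add_comm]
    | a_X i m v =>
      simp only [map_mul, map_add, map_smul, FreeAlgebra.lift_ι_apply]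
      apply MulOpposite.unop_injective
      simp only [omegaGen, MulOpposite.unop_mul, MulOpposite.unop_op, MulOpposite.unop_add,
        MulOpposite.unop_smul]
      by_cases hm : m = 0
      · have h := a_mul_X p i 0 v
        simp only [hm, if_true] at h ⊢
        simp only [mul_add, add_mul, neg_mul, mul_neg, h, Algebra.commutes]
        abel
      · have h := a_mul_X p i (-m) v
        simp only [hm, neg_eq_zero, if_false, zero_smul, add_zero] at h ⊢
        simp only [neg_mul, mul_neg, smul_mul_assoc, mul_smul_comm, h]
    | K_X u v =>
      simp only [map_mul, map_smul, FreeAlgebra.lift_ι_apply]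
      apply MulOpposite.unop_injective
      simp only [omegaGen, MulOpposite.unop_mul, MulOpposite.unop_op, MulOpposite.unop_smul]
      have h := K_mul_X p (-u) v
      simp only [mul_smul_comm, smul_mul_assoc, h, smul_smul]
      congr 1
      simp only [Params.qt, ← Complex.exp_add, Pi.neg_apply, Int.cast_neg, neg_mul,
        Finset.sum_neg_distrib]
      congr 1
      ring)

theorem omegaOp_gen (x y : ℂ) (g : Gen I) : omegaOp p x y (gen p g) = omegaGen p x y g := by
  rw [omegaOp, gen, lift_mk, FreeAlgebra.lift_ι_apply]

/-- The anti-involution `ω_{x,y}` of the extended deformed Heisenberg algebra. -/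
def omega (x y : ℂ) (u : Heis p) : Heis p := (omegaOp p x y u).unop

theorem omega_mul (x y : ℂ) (u v : Heis p) :
    omega p x y (u * v) = omega p x y v * omega p x y u := by
  simp [omega]

theorem omega_omega (x y : ℂ) (u : Heis p) : omega p x y (omega p x y u) = u := by
  obtain ⟨w, rfl⟩ := RingQuot.mkAlgHom_surjective ℂ (HeisRel p) u
  change omega p x y (omega p x y (mk p w)) = mk p w
  have hz : p.qt x y ≠ 0 := Complex.exp_ne_zero _
  induction w using FreeAlgebra.induction with
  | grade0 c => simp [omega]
  | grade1 g =>
    change omega p x y (omegaOp p x y (gen p g)).unop = gen p g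
    rw [omegaOp_gen]
    cases g with
    | a i m =>
      change omega p x y (omegaGen p x y (Gen.a i m)).unop = a p i m
      by_cases hm : m = 0
      · subst hm
        have h : omegaOp p x y (a p i 0) = omegaGen p x y (Gen.a i 0) := omegaOp_gen p x y _
        simp only [omegaGen, if_true, MulOpposite.unop_op] at h ⊢
        simp only [omega, map_add, map_neg, AlgHom.commutes, h, MulOpposite.unop_add,
          MulOpposite.unop_neg, MulOpposite.unop_op, MulOpposite.algebraMap_apply]
        abel
      · have h : omegaOp p x y (a p i (-m)) = omegaGen p x y (Gen.a i (-m)) :=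
          omegaOp_gen p x y _
        simp only [omegaGen, hm, neg_eq_zero, if_false, MulOpposite.unop_op, neg_neg] at h ⊢
        simp only [omega, map_neg, map_smul, h, MulOpposite.unop_neg, MulOpposite.unop_smul,
          MulOpposite.unop_op, smul_neg, smul_smul, neg_neg]
        rw [zpow_neg, mul_inv_cancel₀ (zpow_ne_zero _ hz), one_smul]
    | K u =>
      change omega p x y (omegaGen p x y (Gen.K u)).unop = K p u
      have h : omegaOp p x y (K p (-u)) = omegaGen p x y (Gen.K (-u)) := omegaOp_gen p x y _
      simp only [omegaGen, MulOpposite.unop_op, neg_neg] at h ⊢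
      simp only [omega, map_smul, h, MulOpposite.unop_smul, MulOpposite.unop_op, smul_smul]
      have h1 : p.qt (4 * ∑ i, (u i : ℂ) * p.rhoOmega i)
          (-4 * ∑ i, (u i : ℂ) * p.rhoCheckOmega i) *
          p.qt (4 * ∑ i, ((-u) i : ℂ) * p.rhoOmega i)
            (-4 * ∑ i, ((-u) i : ℂ) * p.rhoCheckOmega i) = 1 := by
        simp only [Params.qt, ← Complex.exp_add, Pi.neg_apply, Int.cast_neg, neg_mul,
          Finset.sum_neg_distrib]
        rw [← Complex.exp_zero]
        congr 1
        ring
      rw [h1, one_smul]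
    | X v => exact congrArg MulOpposite.unop (omegaOp_gen p x y (Gen.X v))
  | mul u v hu hv => simp only [map_mul, omega_mul, hu, hv]
  | add u v hu hv =>
    simp only [omega, map_add, MulOpposite.unop_add] at hu hv ⊢
    rw [hu, hv]

end Heis

/-! ### Fields -/

/-- A formal infinite sum of elements of the Heisenberg algebra. The entry at `(k, l)` is the
(normally ordered) part of creation degree `k` and annihilation degree `l`, that is, the part
built from creation modes `a_i[-m]` with total `∑ m = k`, followed by zero modes, followed by
annihilation modes `a_i[m]` with total `∑ m = l` (`m > 0` throughout). -/
abbrev FormalSum (p : Params I) : Type _ := ℕ × ℕ → Heis p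

/-- A field `F(z) = ∑_{m ∈ ℤ} F[m] z^{-m}`, given by its Fourier modes `F[m]`. -/
abbrev QField (p : Params I) : Type _ := ℤ → FormalSum p

/-- The anti-involution on formal sums, termwise; it exchanges creation and annihilation. -/
def omegaSum (p : Params I) (x y : ℂ) (S : FormalSum p) : FormalSum p :=
  fun kl => Heis.omega p x y (S (kl.2, kl.1))

/-- `ω_{x,y}(F(z)) = ∑_m ω_{x,y}(F[m]) z^{-m}`. -/
def omegaField (p : Params I) (x y : ℂ) (F : QField p) : QField p :=
  fun m => omegaSum p x y (F m)

/-- The field `F(c / z)`: the coefficient of `z^{-m}` in `∑_n F[n] (c / z)^{-n}`. -/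
def invert (p : Params I) (c : ℂ) (F : QField p) : QField p :=
  fun m => (c ^ m) • F (-m)

/-- The part of degree `k` of `exp (∑_{m > 0} f_m)`, where `f_m` has degree `m`. -/
def expPart {A : Type*} [Ring A] [Algebra ℂ A] (f : ℕ → A) (k : ℕ) : A :=
  ∑ n ∈ Finset.range (k + 1), ((n.factorial : ℂ)⁻¹) •
    PowerSeries.coeff k ((PowerSeries.mk fun m => if m = 0 then 0 else f m) ^ n)

/-- The normally ordered exponential `Z : exp (∑_{m ≠ 0} f_m z^{-m}) :`, where `f_m` is a
combination of the modes `a_i[m]` and `Z` is a zero mode factor. -/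
def normalExp (p : Params I) (Z : Heis p) (f : ℤ → Heis p) : QField p :=
  fun m kl => if (kl.2 : ℤ) - kl.1 = m then
    expPart (fun n => f (-(n : ℤ))) kl.1 * Z * expPart (fun n => f n) kl.2 else 0

/-- The exponents of a monomial in the fields `Y_j(z q^a t^b)`: the exponent of
`Y_j(z q^a t^b)` is the value at `(j, a, b)`. -/
abbrev YMonomial (I : Type*) : Type _ := (I × ℤ × ℤ) →₀ ℤ

/-- The normally ordered product `: ∏ Y_j(z q^a t^b)^{e (j, a, b)} :`, where
`Y_i(z) = t^{2 (ρ^∨, ω_i)} q^{-2 r^∨ (ρ, ω_i) + 2 y_i[0]} : exp (∑_{m ≠ 0} y_i[m] z^{-m}) :`. -/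
def vertex (p : Params I) (e : YMonomial I) : QField p :=
  normalExp p
    (p.qt (e.sum fun s n => (n : ℂ) * (-2 * p.rhoOmega s.1))
        (e.sum fun s n => (n : ℂ) * (2 * p.rhoCheckOmega s.1)) •
      Heis.K p (e.sum fun s n => Pi.single s.1 n))
    (fun m => e.sum fun s n => ((n : ℂ) * p.qt s.2.1 s.2.2 ^ (-m)) • Heis.y p s.1 m)

/-- A finite linear combination of normally ordered monomials. -/
def fieldOf (p : Params I) (c : YMonomial I →₀ ℂ) : QField p :=
  c.sum fun e x => x • vertex p e

/-- `Y_j(z q^a t^b)`. -/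
def yMon (j : I) (a b : ℤ) : YMonomial I := Finsupp.single (j, a, b) 1

/-- `A_j(z q^a t^b)` as a monomial in the `Y`s. Since `a_j[m] = ∑_k C_kj(q^m, t^m) y_k[m]`,
`A_j(z) = : Y_j(z q^{-r_j} t) Y_j(z q^{r_j} t^{-1})
  ∏_{k ≠ j} ∏_{s = 0}^{I_kj - 1} Y_k(z q^{I_kj - 1 - 2 s})^{-1} :`. -/
def aMon (p : Params I) (j : I) (a b : ℤ) : YMonomial I :=
  yMon j (a - p.r j) (b + 1) + yMon j (a + p.r j) (b - 1) -
    ∑ k ∈ Finset.univ.erase j, ∑ s ∈ Finset.range (p.inc k j),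
      yMon k (a + ((p.inc k j : ℤ) - 1 - 2 * s)) b

/-! ### Fock modules and screening operators -/

/-- The left ideal of the extended Heisenberg algebra annihilating the vacuum `|0⟩`. -/
def vacuumIdeal (p : Params I) : Submodule (Heis p) (Heis p) :=
  Submodule.span (Heis p)
    ({u | ∃ i, ∃ m : ℤ, 0 ≤ m ∧ u = Heis.a p i m} ∪ {u | ∃ v, u = Heis.K p v - 1})

/-- The sum of all Fock modules: the module generated by `|0⟩`, with `a_i[m] |0⟩ = 0` for
`m ≥ 0` and `q^{2 y_i[0]} |0⟩ = |0⟩`. The vectors `e^{∑ v_j Q_j} |0⟩` are the vacua of the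
other Fock modules. -/
abbrev Fock (p : Params I) : Type _ := Heis p ⧸ vacuumIdeal p

/-- The vacuum `|0⟩`. -/
def vacuum (p : Params I) : Fock p := (vacuumIdeal p).mkQ 1

/-- The Fock module `F(0)`, generated from `|0⟩` by the modes `a_i[m]` (and the `q^{2 y_i[0]}`). -/
def fockZero (p : Params I) : Set (Fock p) :=
  {w | ∃ h ∈ Algebra.adjoin ℂ ({u | ∃ i m, u = Heis.a p i m} ∪ {u | ∃ v, u = Heis.K p v}),
    w = h • vacuum p}

/-- The action of a formal sum on Fock modules; on a given vector of a Fock module only finitely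
many terms of a mode of a field are nonzero. -/
def act (p : Params I) (S : FormalSum p) (w : Fock p) : Fock p := ∑ᶠ kl, S kl • w

/-- The screening current `S_j^+(z)` on `F(0)`, where `z^{-s_j^+[0]} = 1`. -/
def screenPlus (p : Params I) (j : I) : QField p :=
  normalExp p (Heis.X p (Pi.single j (-1 / (p.r j : ℂ))))
    (fun m => (p.qt ((m : ℂ) * (p.r j : ℂ)) 0 - p.qt (-((m : ℂ) * (p.r j : ℂ))) 0)⁻¹ • Heis.a p j m)

/-- The screening current `S_j^-(z)` on `F(0)`, where `z^{s_j^-[0]} = 1`. -/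
def screenMinus (p : Params I) (j : I) : QField p :=
  normalExp p (Heis.X p (Pi.single j (1 / p.beta)))
    (fun m => -((p.qt 0 m - p.qt 0 (-m))⁻¹ • Heis.a p j m))

/-- All modes of the field `F` commute with the screening operators `S_j^± = S_j^±[1]`, which map
`F(0)` to another Fock module. -/
def CommutesWithScreenings (p : Params I) (F : QField p) : Prop :=
  ∀ j, ∀ m : ℤ, ∀ w ∈ fockZero p,
    act p (F m) (act p (screenPlus p j 1) w) = act p (screenPlus p j 1) (act p (F m) w) ∧
    act p (F m) (act p (screenMinus p j 1) w) = act p (screenMinus p j 1) (act p (F m) w)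

/-! ### The generators of the deformed W-algebra -/

/-- `s(x) = (Q - Q⁻¹ x) (t⁻¹ - t x) / ((1 - x) (Q t⁻¹ - Q⁻¹ t x))` with `Q = q^{r_j}`. This is
`η^{(++)} / η^{(-+)}` at `ξ`, where `x = ξ²`. -/
def sCoef (p : Params I) (j : I) (x : ℂ) : ℂ :=
  ((p.qt (p.r j) 0 - p.qt (-(p.r j : ℂ)) 0 * x) * (p.qt 0 (-1) - p.qt 0 1 * x)) /
    ((1 - x) * (p.qt (p.r j) (-1) - p.qt (-(p.r j : ℂ)) 1 * x))

/-- The coefficient `γ` in the `sl_2` direction `j` for the parameters `z q^a t^b`,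
`(a, b) ∈ S`, with minus signs exactly at `M ⊆ S`:
`γ = ∏_{u ∈ M, v ∈ S \ M} s(z_u / z_v)`. -/
def gammaCoef (p : Params I) (j : I) (S M : Finset (ℤ × ℤ)) : ℂ :=
  ∏ u ∈ M, ∏ v ∈ S \ M, sCoef p j (p.qt (u.1 - v.1) (u.2 - v.2))

/-- The completion of `: N(z) ∏_{(a, b) ∈ S} Y_j(z q^a t^b) :` in the `sl_2` direction `j`: the
sum over all ways of replacing some of the factors `Y_j(u)` by
`Y_j^{(-)}(u) = : Y_j(u) A_j(u q^{-r_j} t)⁻¹ :`, with the coefficients `γ`. -/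
def sl2Block (p : Params I) (j : I) (N : YMonomial I) (S : Finset (ℤ × ℤ)) :
    YMonomial I →₀ ℂ :=
  ∑ M ∈ S.powerset, Finsupp.single
    (N + ∑ u ∈ S, yMon j u.1 u.2 - ∑ u ∈ M, aMon p j (u.1 - p.r j) (u.2 + 1))
    (gammaCoef p j S M)

/-- The parameters `S` are such that all coefficients `γ` are regular: they are distinct (as `S`
is a finite set) and no two of them have ratio `q^{2 r_j} t^{-2}`. -/
def RegularParams (p : Params I) (j : I) (S : Finset (ℤ × ℤ)) : Prop :=
  ∀ u ∈ S, ∀ v ∈ S, (u.1 - v.1, u.2 - v.2) ≠ (2 * (p.r j : ℤ), (-2 : ℤ))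

/-- The blocks in the `sl_2` direction `j`; the factor `N` contains no `Y_j`. -/
def sl2Blocks (p : Params I) (j : I) : Set (YMonomial I →₀ ℂ) :=
  {d | ∃ (N : YMonomial I) (S : Finset (ℤ × ℤ)),
    (∀ a b, N (j, a, b) = 0) ∧ RegularParams p j S ∧ d = sl2Block p j N S}

/-- The finite combination `c` of monomials is obtained from `Y_i(z)` by pasting `sl_2`
directions: in each direction `j` it is a linear combination of `sl_2` blocks, and each monomial
other than `Y_i(z)` is obtained from a higher one that occurs by replacing, in some direction
`j`, a factor `Y_j(z q^a t^b)` by `Y_j^{(-)}(z q^a t^b)`. -/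
def IsPasted (p : Params I) (i : I) (c : YMonomial I →₀ ℂ) : Prop :=
  (∀ j, c ∈ Submodule.span ℂ (sl2Blocks p j)) ∧
  ∀ e ∈ c.support, e ≠ yMon i 0 0 → ∃ e' ∈ c.support, ∃ j a b,
    0 < e' (j, a, b) ∧ e = e' - aMon p j (a - p.r j) (b + 1)

/-- `T` is the generator `T_i(z)` of the deformed W-algebra: it commutes with the screening
operators and it is a finite sum `∑ c_e e` of monomials of the form
`: Y_i(z) ∏ A_j(z q^a t^b)⁻¹ :`, in which `Y_i(z)` has coefficient one, obtained by pasting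
`sl_2` directions. -/
def IsGenerator (p : Params I) (i : I) (T : QField p) : Prop :=
  CommutesWithScreenings p T ∧
  ∃ c : YMonomial I →₀ ℂ, T = fieldOf p c ∧
    c (yMon i 0 0) = 1 ∧
    (∀ e ∈ c.support, ∃ s : Multiset (I × ℤ × ℤ),
      e = yMon i 0 0 - (s.map fun x => aMon p x.1 x.2.1 x.2.2).sum) ∧
    IsPasted p i c

end DeformedW

end

/-! On a normally ordered monomial the anti-involution inverts every factor and reflects its
parameter: for any integers `H`, `h`, the factor `Y_j(z q^a t^b)` becomes `Y_j(w q^{-a-H}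
t^{-b+h})^{-1}` with `w = q^{x+H} t^{y-h} / z` (`omegaField_vertex`). With `H = r^∨ h^∨` and `h` the
Coxeter number, what remains is combinatorial: this flip of monomials must carry the coefficients of
`T_i` to those of `T_{i*}` (`IsPasted.mapDomain_flipMon`).

The flip maps `sl_2` blocks to `sl_2` blocks, exchanging the two states of each factor, so both
sides are combinations of blocks in every direction. Such a combination vanishes as soon as it has
no dominant monomial: grade monomials by `levelSum`, for which every `A_j` is positive; a monomial
of maximal level is the top of its block in every direction, hence dominant. It therefore suffices
to compare coefficients at dominant monomials. By pasting, `T_{i*}` has only `Y_{i*}(z)`. For the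
flip of `T_i` they come from the antidominant monomials of `T_i`, so the heart of the matter is that
the only one is `Y_{i*}(z q^{-H} t^h)^{-1}`, with coefficient one (`IsPasted.eq_of_isAntidom`).

To see this, start from an antidominant monomial `e` that occurs and repeatedly pass from the bottom
of a block to its top. The coefficient is unchanged, since `γ = 1` at both ends. In Laurent
polynomial coordinates this raising is a deformed simple reflection, and it satisfies the rank two
braid relations; the resulting polygons show that every monomial reached is dominant or antidominant
in each direction, so the process ends at a dominant monomial, which can only be `Y_i(z)`. Hence the
coefficient of `e` is one, and some Weyl group element maps the weight of `e` to `ω_i`; being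
antidominant, that weight is `-ω_{i*}`.

The parameter of `e` is found by weighting each factor with its exponent of `q` or `t`. Along the
process these weighted sums accumulate to `∑_{β>0} c_β (λ, β^∨) β`, where `λ` is the weight of `e`.
This operator commutes with the Weyl group, so it is a scalar by irreducibility. Evaluated at the
highest root, the scalar is `h` for `c = 1` and `r^∨ h^∨` for the invariant function `c` extending
the `r_j`. -/

set_option linter.unusedSectionVars false

noncomputable section

/-! ### Words in the simple reflections of a root system -/

namespace RootPairing.Base

variable {ι R M N : Type*} [Field R] [AddCommGroup M] [Module R M] [AddCommGroup N] [Module R N]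
  {P : RootPairing ι R M N} (b : P.Base)

/-- The product of simple reflections along a word, acting on the weight space. -/
def wordRefl (L : List b.support) : M ≃ₗ[R] M := (L.map fun j => P.reflection j).prod

/-- The product of simple reflections along a word, acting on the roots. -/
def wordPerm (L : List b.support) : Equiv.Perm ι :=
  (L.map fun j : b.support => (P.reflectionPerm j : Equiv.Perm ι)).prod

@[simp] theorem wordRefl_nil (x : M) : b.wordRefl [] x = x := rfl

@[simp] theorem wordPerm_nil (i : ι) : b.wordPerm [] i = i := rfl

@[simp] theorem wordRefl_cons (j : b.support) (L : List b.support) (x : M) :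
    b.wordRefl (j :: L) x = P.reflection j (b.wordRefl L x) := by
  simp [wordRefl]

@[simp] theorem wordPerm_cons (j : b.support) (L : List b.support) (i : ι) :
    b.wordPerm (j :: L) i = P.reflectionPerm j (b.wordPerm L i) := by
  simp [wordPerm]

theorem wordRefl_append (L L' : List b.support) (x : M) :
    b.wordRefl (L ++ L') x = b.wordRefl L (b.wordRefl L' x) := by
  simp [wordRefl]

theorem root_wordPerm (L : List b.support) (i : ι) :
    P.root (b.wordPerm L i) = b.wordRefl L (P.root i) := by
  induction L with
  | nil => simp
  | cons j L ih => simp [root_reflectionPerm, ih]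

omit b in
theorem coroot'_reflectionPerm_reflection (j i : ι) (x : M) :
    P.coroot' (P.reflectionPerm j i) (P.reflection j x) = P.coroot' i x := by
  simp only [coroot', coroot_reflectionPerm, LinearMap.flip_apply, reflection_apply,
    coreflection_apply, map_sub, map_smul, LinearMap.sub_apply, LinearMap.smul_apply, root',
    smul_eq_mul, root_coroot_two, root_coroot_eq_pairing]
  ring

theorem coroot'_wordPerm_wordRefl (L : List b.support) (i : ι) (x : M) :
    P.coroot' (b.wordPerm L i) (b.wordRefl L x) = P.coroot' i x := by
  induction L with
  | nil => simp
  | cons j L ih => rw [wordPerm_cons, wordRefl_cons, coroot'_reflectionPerm_reflection, ih]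

theorem wordRefl_reflection (L : List b.support) (i : ι) (x : M) :
    b.wordRefl L (P.reflection i x) = P.reflection (b.wordPerm L i) (b.wordRefl L x) := by
  rw [reflection_apply, reflection_apply, map_sub, map_smul, root_wordPerm,
    coroot'_wordPerm_wordRefl]

variable [Finite ι] [CharZero R] [P.IsCrystallographic] [P.IsReduced]

/-- The index `P.reflectionPerm i i` is that of the negative of the root `i`; it serves throughout
as negation on indices. -/
theorem not_isPos_reflectionPerm_self (i : ι) :
    ¬ b.IsPos (P.reflectionPerm i i) ↔ b.IsPos i := by
  have h := IsPos.neg_iff_not b i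
  change b.IsPos (P.reflectionPerm i i) ↔ _ at h
  rw [h, not_not]

theorem reflectionPerm_ne_self_of_isPos {i j : ι} (hi : b.IsPos i) (hj : j ∈ b.support) :
    P.reflectionPerm j i ≠ j := fun h => by
  have h' : i = P.reflectionPerm j j := (P.reflectionPerm_self j i).symm.trans (by rw [h])
  exact (b.not_isPos_reflectionPerm_self j).2 (isPos_of_mem_support hj) (h' ▸ hi)

theorem eq_of_isPos_of_not_isPos_reflectionPerm {i j : ι} (hi : b.IsPos i) (hj : j ∈ b.support)
    (h : ¬ b.IsPos (P.reflectionPerm j i)) : i = j := by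
  by_contra hne
  exact h (hi.reflectionPerm hj hne)

theorem reflectionPerm_reflectionPerm_self (j i : ι) :
    P.reflectionPerm j (P.reflectionPerm i i) =
      P.reflectionPerm (P.reflectionPerm j i) (P.reflectionPerm j i) := by
  apply P.root.injective
  rw [root_reflectionPerm, root_reflectionPerm, root_reflectionPerm, reflection_apply_self, map_neg,
    ← root_reflectionPerm, reflection_apply_self]

/-- A positive root is reached from a simple one by simple reflections, and these act compatibly on
coroots; on either side a simple reflection changes the sign of only one positive element. -/
theorem isPos_flip {i : ι} (hi : b.IsPos i) : b.flip.IsPos i := by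
  have key : b.IsPos i → b.flip.IsPos i := by
    -- The chain of reflections may pass through negative roots, hence positivity as a premise of
    -- the predicate.
    refine IsPos.induction_on_reflect (p := fun k => b.IsPos k → b.flip.IsPos k) hi
      (fun k hk _ => isPos_of_mem_support (b := b.flip) hk) ?_
    intro k j hk hj hpos
    by_cases hkpos : b.IsPos k
    · have hkj : k ≠ j := by
        rintro rfl
        exact (b.not_isPos_reflectionPerm_self k).2 hkpos hpos
      exact (hk hkpos).reflectionPerm (b := b.flip) hj hkj
    · have h1 : b.IsPos (P.reflectionPerm k k) := by
        by_contra h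
        exact hkpos ((b.not_isPos_reflectionPerm_self k).1 h)
      have h2 : P.reflectionPerm k k = j := by
        apply b.eq_of_isPos_of_not_isPos_reflectionPerm h1 hj
        rw [reflectionPerm_reflectionPerm_self, not_isPos_reflectionPerm_self]
        exact hpos
      have h3 : P.reflectionPerm j k = j := by
        apply P.root.injective
        have := congrArg P.root h2
        rw [root_reflectionPerm, reflection_apply_self] at this
        rw [root_reflectionPerm, ← this]
        have hk' : P.root k = - P.root j := by rw [← this, neg_neg]
        rw [hk', map_neg, reflection_apply_self, ← this]
      rw [h3]
      exact isPos_of_mem_support (b := b.flip) hj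
  exact key hi

/-- A weight is dominant (and integral) when it takes natural values on simple coroots. -/
def IsDominant (x : M) : Prop := ∀ j ∈ b.support, ∃ n : ℕ, P.coroot' j x = n

/-- The coroot of a positive root is a natural combination of simple coroots; `isPos_flip` excludes
the opposite sign. -/
theorem IsDominant.of_isPos {b : P.Base} {x : M} (hx : b.IsDominant x) {i : ι} (hi : b.IsPos i) :
    ∃ n : ℕ, P.coroot' i x = n := by
  obtain ⟨f, hf, hf'⟩ := b.flip.exists_root_eq_sum_nat_or_neg i
  have hpos : P.coroot i = ∑ j ∈ b.support, f j • P.coroot j := by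
    refine hf'.resolve_right fun h => ?_
    have h2 := height_eq_sum (b := b.flip) (i := i) (f := fun j => -(f j : ℤ)) (by simpa using h)
    have h3 := b.isPos_flip hi
    rw [isPos_iff, h2] at h3
    simp only [Finset.sum_neg_distrib] at h3
    have : (0 : ℤ) ≤ ∑ j ∈ b.flip.support, (f j : ℤ) := Finset.sum_nonneg fun _ _ => by positivity
    omega
  choose! n hn using hx
  refine ⟨∑ j ∈ b.support, f j * n j, ?_⟩
  have : P.coroot' i x = ∑ j ∈ b.support, (f j : R) * P.coroot' j x := by
    simp only [coroot', hpos, map_sum, map_nsmul, LinearMap.sum_apply, LinearMap.smul_apply,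
      nsmul_eq_mul]
  rw [this, Nat.cast_sum]
  exact Finset.sum_congr rfl fun j hj => by rw [hn j hj, Nat.cast_mul]

theorem coroot'_reflectionPerm_self (i : ι) (x : M) :
    P.coroot' (P.reflectionPerm i i) x = - P.coroot' i x := by
  simp [coroot', coroot_reflectionPerm]

theorem isPos_reflectionPerm_self_of_not {i : ι} (hi : ¬ b.IsPos i) :
    b.IsPos (P.reflectionPerm i i) := by
  by_contra h
  exact hi ((b.not_isPos_reflectionPerm_self i).1 h)

/-- The exchange condition. -/
theorem exists_word_of_not_isPos (L : List b.support) (a : b.support)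
    (h : ¬ b.IsPos (b.wordPerm L a)) :
    ∃ L' : List b.support, L'.length + 1 = L.length ∧
      ∀ x, b.wordRefl L' x = b.wordRefl L (P.reflection a x) := by
  induction L with
  | nil => exact absurd (isPos_of_mem_support a.2) h
  | cons j L ih =>
    by_cases hL : b.IsPos (b.wordPerm L a)
    · rw [wordPerm_cons] at h
      -- Only `α_j` is made negative by `s_j`, so `w α_a = α_j` for the word `w` of `L`. Then `s_j w
      -- s_a = w`, and the letter `j` can be deleted.
      have hj := b.eq_of_isPos_of_not_isPos_reflectionPerm hL j.2 h
      refine ⟨L, rfl, fun x => ?_⟩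
      rw [wordRefl_cons, wordRefl_reflection, hj]
      simp
    · obtain ⟨L', hlen, hL'⟩ := ih hL
      exact ⟨j :: L', by simp [hlen], fun x => by rw [wordRefl_cons, wordRefl_cons, hL']⟩

/-- Two dominant weights in the same orbit of the Weyl group are equal. -/
theorem IsDominant.wordRefl_eq {b : P.Base} {x : M} (hx : b.IsDominant x) (L : List b.support)
    (hL : b.IsDominant (b.wordRefl L x)) : b.wordRefl L x = x := by
  induction hn : L.length using Nat.strong_induction_on generalizing L with
  | _ n ih =>
  rcases List.eq_nil_or_concat L with rfl | ⟨L₀, a, rfl⟩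
  · rfl
  rw [List.concat_eq_append] at hL hn ⊢
  rw [wordRefl_append] at hL ⊢
  simp only [wordRefl_cons, wordRefl_nil] at hL ⊢
  -- If `w₀ α_a` is positive, dominance of `w₀ s_a x` gives `(s_a x, α_a^∨) ≥ 0`, that is `(x,
  -- α_a^∨) ≤ 0`. So `s_a` fixes `x` and the last letter is superfluous. Otherwise the exchange
  -- condition shortens the word.
  by_cases h0 : b.IsPos (b.wordPerm L₀ a)
  · obtain ⟨m, hm⟩ := hL.of_isPos h0
    rw [coroot'_wordPerm_wordRefl] at hm
    obtain ⟨k, hk⟩ := hx a a.2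
    have hneg : P.coroot' a (P.reflection a x) = - P.coroot' a x := by
      simp [reflection_apply]
      ring
    rw [hneg, hk, neg_eq_iff_add_eq_zero, ← Nat.cast_add, Nat.cast_eq_zero] at hm
    have hk0 : k = 0 := by omega
    have hfix : P.reflection a x = x := by
      rw [reflection_apply, hk, hk0]
      simp
    rw [hfix] at hL ⊢
    exact ih L₀.length (by simp at hn; omega) L₀ hL rfl
  · obtain ⟨L', hlen, hL'⟩ := b.exists_word_of_not_isPos L₀ a h0
    rw [← hL'] at hL ⊢
    exact ih L'.length (by simp at hn; omega) L' hL rfl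

/-- Every Weyl group element is a word in the simple reflections. -/
theorem exists_word (g : P.weylGroup) : ∃ L : List b.support, ∀ x : M, g • x = b.wordRefl L x := by
  have hrefl : ∀ i : ι, ∃ L : List b.support, ∀ x : M, P.reflection i x = b.wordRefl L x := by
    intro i
    refine b.induction_reflect i (p := fun i => ∃ L : List b.support, ∀ x : M,
      P.reflection i x = b.wordRefl L x) ?_ ?_ ?_
    · rintro i ⟨L, hL⟩
      refine ⟨L, fun x => ?_⟩
      rw [← hL, reflection_reflectionPerm]
      simp
    · exact fun i hi => ⟨[⟨i, hi⟩], fun x => by simp⟩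
    · rintro i j ⟨L, hL⟩ hj
      refine ⟨⟨j, hj⟩ :: (L ++ [⟨j, hj⟩]), fun x => ?_⟩
      rw [reflection_reflectionPerm, wordRefl_cons, wordRefl_append, ← hL]
      simp
  obtain ⟨g, hg⟩ := g
  induction hg using weylGroup.induction with
  | mem i =>
    obtain ⟨L, hL⟩ := hrefl i
    exact ⟨L, fun x => by rw [← hL]; rfl⟩
  | one => exact ⟨[], fun x => by simp⟩
  | mul g₁ g₂ hg₁ hg₂ h₁ h₂ =>
    obtain ⟨L₁, hL₁⟩ := h₁
    obtain ⟨L₂, hL₂⟩ := h₂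
    refine ⟨L₁ ++ L₂, fun x => ?_⟩
    rw [wordRefl_append, ← hL₂, ← hL₁, ← mul_smul]
    rfl

end RootPairing.Base

/-! ### Sums over the positive roots and Weyl group invariant operators -/

namespace RootPairing.Base

variable {ι R M N : Type*} [Field R] [AddCommGroup M] [Module R M] [AddCommGroup N] [Module R N]
  {P : RootPairing ι R M N} (b : P.Base) [Finite ι] [CharZero R] [P.IsCrystallographic]
  [P.IsReduced]

/-- The positive roots. -/
def posRoots : Finset ι := (Set.toFinite {i | b.IsPos i}).toFinset

@[simp] theorem mem_posRoots {i : ι} : i ∈ b.posRoots ↔ b.IsPos i := by simp [posRoots]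

/-- The reflection `s_j` permutes the positive roots other than `α_j`. -/
theorem sum_erase_reflectionPerm [DecidableEq ι] {A : Type*} [AddCommMonoid A] {j : ι}
    (hj : j ∈ b.support) (f : ι → A) :
    ∑ i ∈ b.posRoots.erase j, f (P.reflectionPerm j i) = ∑ i ∈ b.posRoots.erase j, f i := by
  have hmem : ∀ i ∈ b.posRoots.erase j, P.reflectionPerm j i ∈ b.posRoots.erase j := by
    intro i hi
    rw [Finset.mem_erase, mem_posRoots] at hi ⊢
    exact ⟨b.reflectionPerm_ne_self_of_isPos hi.2 hj, hi.2.reflectionPerm hj hi.1⟩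
  exact Finset.sum_nbij' (fun i => P.reflectionPerm j i) (fun i => P.reflectionPerm j i) hmem hmem
    (fun i _ => by simp) (fun i _ => by simp) (fun i _ => rfl)

theorem sum_posRoots_reflectionPerm {A : Type*} [AddCommMonoid A] {j : ι}
    (hj : j ∈ b.support) (f : ι → A) (hf : f (P.reflectionPerm j j) = f j) :
    ∑ i ∈ b.posRoots, f (P.reflectionPerm j i) = ∑ i ∈ b.posRoots, f i := by
  classical
  have hjm : j ∈ b.posRoots := b.mem_posRoots.2 (isPos_of_mem_support hj)
  rw [← Finset.add_sum_erase _ _ hjm, ← Finset.add_sum_erase _ f hjm, hf,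
    b.sum_erase_reflectionPerm hj]

/-- This is `(α_j, 2ρ^∨) = 2`: reindexing by `s_j` negates the sum over the positive roots other
than `α_j`, so only `β = α_j` contributes. -/
theorem sum_posRoots_pairing_left {j : ι} (hj : j ∈ b.support) :
    ∑ i ∈ b.posRoots, P.pairing j i = 2 := by
  classical
  have hjm : j ∈ b.posRoots := b.mem_posRoots.2 (isPos_of_mem_support hj)
  have h := b.sum_erase_reflectionPerm hj (fun i => P.pairing j i)
  simp only [pairing_reflectionPerm, pairing_reflectionPerm_self_left, Finset.sum_neg_distrib] at h
  rw [← Finset.add_sum_erase _ _ hjm, pairing_same, self_eq_neg.1 h.symm, add_zero]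

theorem sum_posRoots_pairing_right {j : ι} (hj : j ∈ b.support) :
    ∑ i ∈ b.posRoots, P.pairing i j = 2 := by
  classical
  have hjm : j ∈ b.posRoots := b.mem_posRoots.2 (isPos_of_mem_support hj)
  have h := b.sum_erase_reflectionPerm hj (fun i => P.pairing i j)
  simp only [← pairing_reflectionPerm, pairing_reflectionPerm_self_right,
    Finset.sum_neg_distrib] at h
  rw [← Finset.add_sum_erase _ _ hjm, pairing_same, self_eq_neg.1 h.symm, add_zero]

theorem sum_posRoots_pairing_eq_height (k : ι) :
    ∑ i ∈ b.posRoots, P.pairing k i = 2 * (b.height k : R) := by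
  obtain ⟨f, -, -, hf⟩ := b.exists_root_eq_sum_int k
  rw [height_eq_sum hf]
  have : ∀ i, P.pairing k i = ∑ j ∈ b.support, (f j : R) * P.pairing j i := by
    intro i
    rw [← root_coroot_eq_pairing, hf]
    simp [map_sum]
  simp only [this]
  rw [Finset.sum_comm]
  simp only [← Finset.mul_sum]
  rw [Finset.sum_congr rfl fun j hj => by rw [b.sum_posRoots_pairing_left hj]]
  rw [← Finset.sum_mul]
  push_cast
  ring

theorem sum_posRoots_pairing_eq_height_flip (k : ι) :
    ∑ i ∈ b.posRoots, P.pairing i k = 2 * (b.flip.height k : R) := by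
  obtain ⟨f, -, -, hf⟩ := b.flip.exists_root_eq_sum_int k
  rw [height_eq_sum hf]
  have : ∀ i, P.pairing i k = ∑ j ∈ b.support, (f j : R) * P.pairing i j := by
    intro i
    have hf' : P.coroot k = ∑ j ∈ b.support, f j • P.coroot j := hf
    rw [← root_coroot_eq_pairing, hf']
    simp [map_sum]
  simp only [this]
  rw [Finset.sum_comm]
  simp only [← Finset.mul_sum]
  rw [Finset.sum_congr rfl fun j hj => by rw [b.sum_posRoots_pairing_right hj]]
  rw [← Finset.sum_mul]
  push_cast
  simp
  ring

/-- The operator `x ↦ ∑ c_β (x, β^∨) β`, summed over the positive roots `β`. -/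
def posSum (c : ι → R) : M →ₗ[R] M :=
  ∑ i ∈ b.posRoots, c i • (P.coroot' i).smulRight (P.root i)

theorem posSum_apply (c : ι → R) (x : M) :
    b.posSum c x = ∑ i ∈ b.posRoots, (c i * P.coroot' i x) • P.root i := by
  simp [posSum, mul_smul]

/-- The summand is even in `β`, so it does not matter that `s_j` sends `α_j` to a negative root: the
sum may be reindexed by `s_j`. -/
theorem posSum_reflection {c : ι → R} (hc : ∀ i j, c (P.reflectionPerm j i) = c i) {j : ι}
    (hj : j ∈ b.support) (x : M) :
    b.posSum c (P.reflection j x) = P.reflection j (b.posSum c x) := by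
  rw [posSum_apply, posSum_apply, map_sum]
  rw [← b.sum_posRoots_reflectionPerm hj
    (fun i => (c i * P.coroot' i (P.reflection j x)) • P.root i)]
  · refine Finset.sum_congr rfl fun i _ => ?_
    rw [coroot'_reflectionPerm_reflection, hc, map_smul, root_reflectionPerm]
  · rw [hc, coroot'_reflectionPerm_self, root_reflectionPerm, reflection_apply_self]
    simp

/-- Schur's lemma without an algebraically closed field: an eigenvector is at hand. The operator
commutes with `s_j`, so it preserves the `-1` eigenspace of `s_j`, the line through `α_j`. The
eigenspace of the resulting `κ` is nonzero and invariant, hence everything. -/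
theorem exists_posSum_eq_smul [P.IsRootSystem] [P.IsIrreducible] {c : ι → R}
    (hc : ∀ i j, c (P.reflectionPerm j i) = c i) :
    ∃ κ : R, ∀ x, b.posSum c x = κ • x := by
  have : Nontrivial M := IsIrreducible.nontrivial (P := P)
  have hne : Nonempty ι := by
    by_contra h
    rw [not_nonempty_iff] at h
    have h1 : Submodule.span R (Set.range P.root) = ⊤ := IsRootSystem.span_root_eq_top
    rw [Set.range_eq_empty, Submodule.span_empty] at h1
    exact bot_ne_top h1
  obtain ⟨j, hj⟩ := b.support_nonempty
  have h1 : P.reflection j (b.posSum c (P.root j)) = - b.posSum c (P.root j) := by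
    rw [← b.posSum_reflection hc hj, reflection_apply_self, map_neg]
  set v := b.posSum c (P.root j) with hv
  set κ : R := P.coroot' j v / 2 with hκ
  have h2 : v = κ • P.root j := by
    rw [reflection_apply] at h1
    have h3 : (2 : R) • v = P.coroot' j v • P.root j := by
      rw [two_smul]
      have := sub_eq_iff_eq_add.1 h1
      rw [neg_add_eq_sub] at this
      rw [eq_sub_iff_add_eq] at this
      exact this
    rw [hκ, div_eq_inv_mul, mul_smul, ← h3, smul_smul, inv_mul_cancel₀ two_ne_zero, one_smul]
  refine ⟨κ, fun x => ?_⟩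
  have htop : LinearMap.ker (b.posSum c - κ • LinearMap.id) = ⊤ := by
    refine IsIrreducible.eq_top_of_invtSubmodule_reflection (P := P) _ ?_ ?_
    · rw [← b.forall_mem_support_invtSubmodule_iff]
      intro i hi
      rw [Module.End.mem_invtSubmodule]
      intro y hy
      rw [LinearMap.mem_ker, LinearMap.sub_apply, sub_eq_zero] at hy
      rw [Submodule.mem_comap, LinearMap.mem_ker, LinearMap.sub_apply, sub_eq_zero]
      simp only [LinearMap.smul_apply, LinearMap.id_apply, LinearEquiv.coe_coe] at hy ⊢
      rw [b.posSum_reflection hc hi, hy, map_smul]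
    · rw [Submodule.ne_bot_iff]
      refine ⟨P.root j, ?_, P.ne_zero j⟩
      rw [LinearMap.mem_ker, LinearMap.sub_apply, sub_eq_zero]
      exact h2
  have hx : x ∈ LinearMap.ker (b.posSum c - κ • LinearMap.id) := htop ▸ Submodule.mem_top
  rw [LinearMap.mem_ker, LinearMap.sub_apply, sub_eq_zero] at hx
  exact hx

/-! ### The highest root and the values of the scalars -/

section Highest

variable {θ : ι} (hθ : ∀ k, b.height k ≤ b.height θ)
include hθ

theorem isPos_of_forall_height_le : b.IsPos θ := by
  by_contra h
  have h1 := b.isPos_reflectionPerm_self_of_not h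
  have h2 := hθ (P.reflectionPerm θ θ)
  rw [isPos_iff] at h h1
  omega

/-- If the pairing is negative, `k + θ` is a root higher than `θ`. If it is at least `2`, then `k -
θ` is a root, so the heights of `k` and `θ` differ, and `-s_θ k` has height at least `2 ht θ - ht k
> ht θ`. -/
theorem pairingIn_highest {k : ι} (hk : b.IsPos k) (hne : k ≠ θ) :
    P.pairingIn ℤ k θ = 0 ∨ P.pairingIn ℤ k θ = 1 := by
  have hpos := b.isPos_of_forall_height_le hθ
  have hneg : P.root k ≠ - P.root θ := fun h => by
    have h1 : k = P.reflectionPerm θ θ := P.root.injective (by simp [h, root_reflectionPerm])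
    exact (b.not_isPos_reflectionPerm_self θ).2 hpos (h1 ▸ hk)
  have h0 : 0 ≤ P.pairingIn ℤ k θ := by
    by_contra! h
    obtain ⟨l, hl⟩ := P.root_add_root_mem_of_pairingIn_neg h hneg
    have h1 := b.height_add hl
    have h2 := hθ l
    rw [isPos_iff] at hk
    omega
  have h2 : P.pairingIn ℤ k θ < 2 := by
    by_contra! h
    obtain ⟨l, hl⟩ := P.root_sub_root_mem_of_pairingIn_pos (lt_of_lt_of_le two_pos h) hne
    have h1 := b.height_sub hl
    have h3 : P.root (P.reflectionPerm θ k) =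
        P.root k + (- P.pairingIn ℤ k θ) • P.root θ := by
      rw [root_reflectionPerm, reflection_apply_root' ℤ, neg_smul, sub_eq_add_neg]
    have h4 := b.height_add_zsmul h3
    have h5 := b.height_reflectionPerm_self (P.reflectionPerm θ k)
    have h6 : b.height (P.reflectionPerm (P.reflectionPerm θ k) (P.reflectionPerm θ k)) =
      - b.height (P.reflectionPerm θ k) := h5
    have h7 := hθ (P.reflectionPerm (P.reflectionPerm θ k) (P.reflectionPerm θ k))
    have h8 := b.height_ne_zero l
    have h9 := hθ k
    rw [isPos_iff] at hk hpos
    rw [h6, h4, smul_eq_mul] at h7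
    have : 2 * b.height θ ≤ P.pairingIn ℤ k θ * b.height θ :=
      mul_le_mul_of_nonneg_right h hpos.le
    have h10 : b.height k - b.height θ ≠ 0 := h1 ▸ h8
    nlinarith [lt_of_le_of_ne h9 (fun h => h10 (by rw [h, sub_self]))]
  omega

theorem pairing_mul_pairing_highest {k : ι} (hk : b.IsPos k) (hne : k ≠ θ) :
    P.pairing θ k * P.pairing k θ = P.pairing θ k := by
  rcases b.pairingIn_highest hθ hk hne with h | h
  · have h1 : P.pairing k θ = 0 := by rw [← P.algebraMap_pairingIn ℤ, h, map_zero]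
    have h2 : P.pairing θ k = 0 := P.pairing_eq_zero_iff.1 h1
    rw [h1, h2, mul_zero]
  · rw [← P.algebraMap_pairingIn ℤ k θ, h, map_one, mul_one]

theorem pairing_mul_self_highest {k : ι} (hk : b.IsPos k) (hne : k ≠ θ) :
    P.pairing k θ * P.pairing k θ = P.pairing k θ := by
  rcases b.pairingIn_highest hθ hk hne with h | h <;>
  simp [← P.algebraMap_pairingIn ℤ k θ, h]

/-- Apply the operator to `θ` and pair with `θ^∨`: this gives `2κ = ∑ (θ, β^∨)(β, θ^∨)`. For `β ≠ θ`
the second factor is `0` or `1` and can be dropped, leaving `4 + (2 ht θ - 2)`. -/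
theorem posSum_one [P.IsRootSystem] [P.IsIrreducible] (x : M) :
    b.posSum (fun _ => 1) x = ((1 + b.height θ : ℤ) : R) • x := by
  classical
  obtain ⟨κ, hκ⟩ := b.exists_posSum_eq_smul (c := fun _ => (1 : R)) (fun _ _ => rfl)
  have hm : θ ∈ b.posRoots := b.mem_posRoots.2 (b.isPos_of_forall_height_le hθ)
  have h1 : P.coroot' θ (b.posSum (fun _ => 1) (P.root θ)) = κ * 2 := by
    rw [hκ, map_smul]
    simp
  have h2 := b.sum_posRoots_pairing_eq_height θ
  rw [← Finset.add_sum_erase _ _ hm, pairing_same] at h2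
  have h3 : ∀ k ∈ b.posRoots.erase θ,
      P.coroot' θ ((1 * P.coroot' k (P.root θ)) • P.root k) = P.pairing θ k := by
    intro k hk
    rw [Finset.mem_erase, mem_posRoots] at hk
    rw [map_smul, one_mul, root_coroot'_eq_pairing, root_coroot'_eq_pairing, smul_eq_mul,
      b.pairing_mul_pairing_highest hθ hk.2 hk.1]
  rw [posSum_apply, map_sum, ← Finset.add_sum_erase _ _ hm, Finset.sum_congr rfl h3] at h1
  rw [hκ]
  congr 1
  simp only [map_smul, root_coroot'_eq_pairing, pairing_same, smul_eq_mul] at h1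
  have : (2 : R) * κ = 2 * (1 + b.height θ) := by linear_combination -h1 + h2
  have := mul_left_cancel₀ two_ne_zero this
  push_cast
  exact this

/-- The computation is that for `c = 1`, after `c_β (θ, β^∨) = c_θ (β, θ^∨)` has turned the sum over
coroots into one over roots; the height of the coroot `θ^∨` then replaces that of `θ`. -/
theorem posSum_of_symm [P.IsRootSystem] [P.IsIrreducible] {c : ι → R}
    (hc : ∀ i j, c (P.reflectionPerm j i) = c i)
    (hc' : ∀ i j, c i * P.pairing j i = c j * P.pairing i j) (x : M) :
    b.posSum c x = (c θ * ((1 + b.flip.height θ : ℤ) : R)) • x := by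
  classical
  obtain ⟨κ, hκ⟩ := b.exists_posSum_eq_smul hc
  have hm : θ ∈ b.posRoots := b.mem_posRoots.2 (b.isPos_of_forall_height_le hθ)
  have h1 : P.coroot' θ (b.posSum c (P.root θ)) = κ * 2 := by
    rw [hκ, map_smul]
    simp
  have h2 := b.sum_posRoots_pairing_eq_height_flip θ
  rw [← Finset.add_sum_erase _ _ hm, pairing_same] at h2
  have h3 : ∀ k ∈ b.posRoots.erase θ,
      P.coroot' θ ((c k * P.coroot' k (P.root θ)) • P.root k) = c θ * P.pairing k θ := by
    intro k hk
    rw [Finset.mem_erase, mem_posRoots] at hk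
    rw [map_smul, root_coroot'_eq_pairing, root_coroot'_eq_pairing, smul_eq_mul, hc', mul_assoc,
      b.pairing_mul_self_highest hθ hk.2 hk.1]
  rw [posSum_apply, map_sum, ← Finset.add_sum_erase _ _ hm, Finset.sum_congr rfl h3,
    ← Finset.mul_sum] at h1
  rw [hκ]
  congr 1
  simp only [map_smul, root_coroot'_eq_pairing, pairing_same, smul_eq_mul] at h1
  have : (2 : R) * κ = 2 * (c θ * (1 + b.flip.height θ)) := by
    linear_combination -h1 + c θ * h2
  have := mul_left_cancel₀ two_ne_zero this
  push_cast
  exact this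

end Highest

end RootPairing.Base

/-! ### Sums over the inversions of a word -/

namespace RootPairing.Base

variable {ι R M N : Type*} [Field R] [AddCommGroup M] [Module R M] [AddCommGroup N] [Module R N]
  {P : RootPairing ι R M N} (b : P.Base) [Finite ι] [CharZero R] [P.IsCrystallographic]
  [P.IsReduced]

/-- Only the inversions of `w` contribute to `∑ c_β (x, β^∨) β` when `-x` and `w x` are
dominant. -/
theorem sum_inversions_eq_posSum (c : ι → R) (L : List b.support) {x : M}
    (hx : b.IsDominant (-x)) (hL : b.IsDominant (b.wordRefl L x)) [DecidablePred b.IsPos] :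
    ∑ i ∈ b.posRoots with ¬ b.IsPos (b.wordPerm L i), (c i * P.coroot' i x) • P.root i =
      b.posSum c x := by
  rw [posSum_apply, Finset.sum_filter]
  refine Finset.sum_congr rfl fun i hi => ?_
  split_ifs with h
  · rw [mem_posRoots] at hi
    -- Here `β` and `w β` are both positive, so `(x, β^∨)` is at most zero by antidominance of `x`
    -- and at least zero as `(w x, (w β)^∨)`; the term vanishes.
    obtain ⟨m, hm⟩ := hx.of_isPos hi
    obtain ⟨n, hn⟩ := hL.of_isPos h
    rw [coroot'_wordPerm_wordRefl] at hn
    rw [map_neg, hn, neg_eq_iff_add_eq_zero, ← Nat.cast_add, Nat.cast_eq_zero] at hm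
    have hn0 : n = 0 := by omega
    rw [hn, hn0]
    simp
  · rfl

/-- If `-x` is dominant and `(w x, α_j^∨)` is negative, then `w⁻¹ α_j` is positive. -/
theorem isPos_wordPerm_symm (L : List b.support) {x : M} (hx : b.IsDominant (-x)) (j : b.support)
    {n : ℕ} (hn : 0 < n) (hj : P.coroot' j (b.wordRefl L x) = -(n : R)) :
    b.IsPos ((b.wordPerm L).symm j) := by
  by_contra h
  have h1 := b.isPos_reflectionPerm_self_of_not h
  obtain ⟨m, hm⟩ := hx.of_isPos h1
  rw [coroot'_reflectionPerm_self, map_neg, neg_neg, ← b.coroot'_wordPerm_wordRefl L,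
    Equiv.apply_symm_apply, hj, neg_eq_iff_add_eq_zero, ← Nat.cast_add, Nat.cast_eq_zero] at hm
  omega

/-- How the sum over the inversions changes when a word is extended on the left. -/
theorem sum_inversions_cons {c : ι → R} (hc : ∀ i j, c (P.reflectionPerm j i) = c i)
    (L : List b.support) (x : M) (j : b.support) [DecidablePred b.IsPos]
    (hpos : b.IsPos ((b.wordPerm L).symm j)) :
    b.wordRefl (j :: L) (∑ i ∈ b.posRoots with ¬ b.IsPos (b.wordPerm (j :: L) i),
        (c i * P.coroot' i x) • P.root i) =
      P.reflection j (b.wordRefl L (∑ i ∈ b.posRoots with ¬ b.IsPos (b.wordPerm L i),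
        (c i * P.coroot' i x) • P.root i)) - (c j * P.coroot' j (b.wordRefl L x)) • P.root j := by
  classical
  set k := (b.wordPerm L).symm j with hk
  have hkj : b.wordPerm L k = j := by simp [hk]
  have hcw : ∀ (L : List b.support) (i : ι), c (b.wordPerm L i) = c i := by
    intro L i
    induction L with
    | nil => rfl
    | cons a L ih => rw [wordPerm_cons, hc, ih]
  -- Passing from `w` to `s_j w` adds exactly the inversion `k = w⁻¹ α_j`. No inversion is lost:
  -- that would need `w β = -α_j`, hence `β = -k`, which is not positive.
  have hset : (b.posRoots.filter fun i => ¬ b.IsPos (b.wordPerm (j :: L) i)) =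
      insert k (b.posRoots.filter fun i => ¬ b.IsPos (b.wordPerm L i)) := by
    ext i
    simp only [Finset.mem_filter, mem_posRoots, wordPerm_cons, Finset.mem_insert]
    constructor
    · rintro ⟨h1, h2⟩
      by_cases h3 : b.IsPos (b.wordPerm L i)
      · left
        rw [hk, Equiv.eq_symm_apply]
        exact b.eq_of_isPos_of_not_isPos_reflectionPerm h3 j.2 h2
      · exact Or.inr ⟨h1, h3⟩
    · rintro (rfl | ⟨h1, h2⟩)
      · refine ⟨hpos, ?_⟩
        rw [hkj, not_isPos_reflectionPerm_self]
        exact isPos_of_mem_support j.2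
      · refine ⟨h1, fun h3 => ?_⟩
        have h4 := b.isPos_reflectionPerm_self_of_not h2
        have h5 : P.reflectionPerm (b.wordPerm L i) (b.wordPerm L i) = j := by
          apply b.eq_of_isPos_of_not_isPos_reflectionPerm h4 j.2
          rw [reflectionPerm_reflectionPerm_self, not_isPos_reflectionPerm_self]
          exact h3
        have h6 : i = P.reflectionPerm k k := by
          apply P.root.injective
          apply (b.wordRefl L).injective
          rw [← root_wordPerm, root_reflectionPerm, reflection_apply_self, map_neg,
            ← root_wordPerm, hkj, ← h5, root_reflectionPerm, reflection_apply_self, neg_neg]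
        exact (b.not_isPos_reflectionPerm_self k).2 hpos (h6 ▸ h1)
  have hnot : k ∉ b.posRoots.filter fun i => ¬ b.IsPos (b.wordPerm L i) := by
    simp only [Finset.mem_filter, not_and, not_not]
    intro _
    rw [hkj]
    exact isPos_of_mem_support j.2
  rw [hset, Finset.sum_insert hnot, wordRefl_cons, map_add, map_add, map_smul, map_smul,
    ← root_wordPerm, hkj, reflection_apply_self, add_comm, smul_neg, ← sub_eq_add_neg]
  rw [← hcw L k, hkj, ← b.coroot'_wordPerm_wordRefl L k x, hkj]

/-! ### The symmetrizing integers as squared root lengths -/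

section Symmetrizer

variable [P.IsRootSystem] [P.IsIrreducible] (r : b.support → ℕ) (hpos : ∀ j, 0 < r j)
  (hr : ∀ j k : b.support, (r j : ℤ) * P.pairingIn ℤ k j = (r k : ℤ) * P.pairingIn ℤ j k)
include hpos hr

/-- The symmetrizing integers extend to all roots, as multiples of the squared lengths. -/
theorem exists_form_eq_symmetrizer :
    ∃ (B : P.InvariantForm), ∀ j : b.support, B.form (P.root j) (P.root j) = (r j : R) := by
  have : Fintype ι := Fintype.ofFinite ι
  have hne : Nonempty b.support := by
    by_contra h
    have : Nontrivial M := IsIrreducible.nontrivial (P := P)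
    have h1 := b.span_root_support
    rw [not_nonempty_iff] at h
    have h2 : b.support = ∅ := Finset.isEmpty_coe_sort.1 h
    rw [h2] at h1
    have h3 : Submodule.span R (Set.range P.root) = ⊤ := IsRootSystem.span_root_eq_top
    simp only [Finset.coe_empty, Set.image_empty, Submodule.span_empty] at h1
    rw [RootPairing.rootSpan, h3] at h1
    exact bot_ne_top h1
  obtain ⟨j₀⟩ := hne
  let B := P.toInvariantForm
  -- Normalized to be right at one simple root; connectedness of the Dynkin diagram carries the
  -- equality to the others, since adjacent roots have squared lengths in the ratio prescribed by
  -- `hr`.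
  set κ : R := r j₀ / B.form (P.root j₀) (P.root j₀) with hκ
  have hκ0 : κ ≠ 0 := div_ne_zero (Nat.cast_ne_zero.2 (hpos j₀).ne') (B.ne_zero j₀)
  let B' : P.InvariantForm :=
    { form := κ • B.form
      symm := ⟨fun x y => by
        have := B.symm.eq x y
        simp only [RingHom.id_apply] at this
        simp [this]⟩
      ne_zero := fun i => mul_ne_zero hκ0 (B.ne_zero i)
      isOrthogonal_reflection := fun i x y => by
        have := B.isOrthogonal_reflection i x y
        simp only [LinearMap.smul_apply]
        rw [this] }
  refine ⟨B', fun j => ?_⟩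
  refine b.induction_on_cartanMatrix
    (p := fun j => B'.form (P.root j) (P.root j) = (r j : R)) (i := j₀) (j := j) ?_ ?_
  · change κ * B.form (P.root j₀) (P.root j₀) = _
    rw [hκ, div_mul_cancel₀ _ (B.ne_zero j₀)]
  · intro i j hi hij
    have h1 := B'.two_mul_apply_root_root i j
    have h2 := B'.two_mul_apply_root_root j i
    have hs : B'.form (P.root i) (P.root j) = B'.form (P.root j) (P.root i) := by
      simpa using (B'.symm.eq (P.root i) (P.root j))
    rw [hs, h2, hi] at h1
    have h3 := congrArg (Int.cast : ℤ → R) (hr i j)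
    push_cast at h3
    have e1 : ((P.pairingIn ℤ i j : ℤ) : R) = P.pairing i j := P.algebraMap_pairingIn ℤ i j
    have e2 : ((P.pairingIn ℤ j i : ℤ) : R) = P.pairing j i := P.algebraMap_pairingIn ℤ j i
    rw [e1, e2] at h3
    have hne : P.pairing i j ≠ 0 := by
      intro h0
      apply hij
      rw [cartanMatrix_apply_eq_zero_iff_symm, cartanMatrix_apply_eq_zero_iff_pairing]
      exact h0
    apply mul_left_cancel₀ hne
    rw [← h1]
    linear_combination h3

/-- There are at most two root lengths. If `r k` is a proper multiple of `r j`, these two values are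
the only ones, so `r j` divides every `r l` and coprimality makes it `1`. The rest is the rank two
classification. -/
theorem symmetrizer_pairing_cases (hgcd : Finset.univ.gcd r = 1) {j k : b.support} (hjk : j ≠ k) :
    (P.pairingIn ℤ k j = 0 ∧ P.pairingIn ℤ j k = 0) ∨
    (P.pairingIn ℤ k j = -1 ∧ P.pairingIn ℤ j k = -1 ∧ r j = r k) ∨
    (P.pairingIn ℤ k j = -2 ∧ P.pairingIn ℤ j k = -1 ∧ r j = 1 ∧ r k = 2) ∨
    (P.pairingIn ℤ k j = -1 ∧ P.pairingIn ℤ j k = -2 ∧ r j = 2 ∧ r k = 1) ∨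
    (P.pairingIn ℤ k j = -3 ∧ P.pairingIn ℤ j k = -1 ∧ r j = 1 ∧ r k = 3) ∨
    (P.pairingIn ℤ k j = -1 ∧ P.pairingIn ℤ j k = -3 ∧ r j = 3 ∧ r k = 1) := by
  obtain ⟨B, hB⟩ := b.exists_form_eq_symmetrizer r hpos hr
  have hne : (j : ι) ≠ k := fun h => hjk (Subtype.ext h)
  have hdiv : ∀ (j k : b.support) (m : ℕ), 1 < m → r k = m * r j → r j = 1 := by
    intro j k m hm hk
    have hlen : B.form (P.root j) (P.root j) ≠ B.form (P.root k) (P.root k) := by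
      rw [hB, hB, hk]
      intro h
      have h' : r j = m * r j := by exact_mod_cast h
      nlinarith [hpos j]
    have h1 : r j ∣ Finset.univ.gcd r := by
      refine Finset.dvd_gcd fun l _ => ?_
      rcases B.apply_eq_or_of_apply_ne hlen l with h | h
      · rw [hB, hB, Nat.cast_inj] at h
        rw [h]
      · rw [hB, hB, Nat.cast_inj] at h
        rw [h, hk]
        exact dvd_mul_left _ _
    rw [hgcd] at h1
    exact Nat.dvd_one.1 h1
  have hmem := P.pairingIn_pairingIn_mem_set_of_isCrystal_of_isRed' k j
    (fun h => hne (P.root.injective h).symm) (b.root_ne_neg_of_ne k.2 j.2 hne.symm)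
  have hle : P.pairingIn ℤ k j ≤ 0 := b.pairingIn_le_zero_of_ne hne.symm k.2 j.2
  have h := hr j k
  simp only [Set.mem_insert_iff, Set.mem_singleton_iff, Prod.mk.injEq] at hmem
  rcases hmem with h1 | h1 | h1 | h1 | h1 | h1 | h1 | h1 | h1 | h1 | h1 <;>
    obtain ⟨h1, h2⟩ := h1 <;> rw [h1, h2] at h <;> try omega
  · have h3 : r j = 2 * r k := by omega
    have := hdiv k j 2 one_lt_two h3
    omega
  · have h3 : r k = 2 * r j := by omega
    have := hdiv j k 2 one_lt_two h3
    omega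
  · have h3 : r j = 3 * r k := by omega
    have := hdiv k j 3 (by norm_num) h3
    omega
  · have h3 : r k = 3 * r j := by omega
    have := hdiv j k 3 (by norm_num) h3
    omega

/-- The largest symmetrizing integer is the one of the highest root. -/
theorem exists_symmetrizer_highest {θ : ι} (hθ : ∀ k, b.height k ≤ b.height θ) :
    ∃ c : ι → R, (∀ j : b.support, c j = r j) ∧ (∀ i j, c (P.reflectionPerm j i) = c i) ∧
      (∀ i j, c i * P.pairing j i = c j * P.pairing i j) ∧
      c θ = ((Finset.univ.sup r : ℕ) : R) := by
  obtain ⟨B, hB⟩ := b.exists_form_eq_symmetrizer r hpos hr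
  have hinv : ∀ i j, B.form (P.root (P.reflectionPerm j i)) (P.root (P.reflectionPerm j i)) =
      B.form (P.root i) (P.root i) := by
    intro i j
    rw [root_reflectionPerm]
    exact B.isOrthogonal_reflection j _ _
  have hsym : ∀ i j, B.form (P.root i) (P.root i) * P.pairing j i =
      B.form (P.root j) (P.root j) * P.pairing i j := by
    intro i j
    have h1 := B.two_mul_apply_root_root i j
    have h2 := B.two_mul_apply_root_root j i
    have hs : B.form (P.root i) (P.root j) = B.form (P.root j) (P.root i) := by
      simpa using (B.symm.eq (P.root i) (P.root j))
    rw [hs, h2] at h1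
    linear_combination h1
  refine ⟨fun i => B.form (P.root i) (P.root i), hB, hinv, hsym, ?_⟩
  have hθpos := b.isPos_of_forall_height_le hθ
  -- The highest root is conjugate to a simple root, so its squared length is one of the `r j`; it
  -- remains to bound all the others by it.
  obtain ⟨j, hj⟩ : ∃ j : b.support, B.form (P.root θ) (P.root θ) = B.form (P.root j) (P.root j) := by
    refine IsPos.induction_on_reflect (p := fun i => ∃ j : b.support,
      B.form (P.root i) (P.root i) = B.form (P.root j) (P.root j)) hθpos
      (fun i hi => ⟨⟨i, hi⟩, rfl⟩) ?_
    rintro i k ⟨j, hj⟩ -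
    exact ⟨j, by rw [hinv, hj]⟩
  rw [hB] at hj
  change B.form (P.root θ) (P.root θ) = _
  rw [hj]
  congr 1
  refine le_antisymm (Finset.le_sup (Finset.mem_univ j)) (Finset.sup_le fun k _ => ?_)
  -- Some root `l` as long as `α_k` is not orthogonal to `θ`, and up to sign it is positive. If `l ≠
  -- θ`, then `(l, θ^∨) = 1`, so symmetry gives `r k * (θ, l^∨) = r j`, and `r k` divides `r j`.
  obtain ⟨l, hl, hne⟩ := P.exists_form_eq_form_and_form_ne_zero B θ k
  have key : ∀ l, b.IsPos l → B.form (P.root l) (P.root l) = r k →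
      B.form (P.root θ) (P.root l) ≠ 0 → r k ≤ r j := by
    intro l hlpos hl hne
    by_cases hlθ : l = θ
    · rw [hlθ, hj, Nat.cast_inj] at hl
      exact hl.ge
    have h1 : P.pairingIn ℤ l θ = 1 := by
      refine (b.pairingIn_highest hθ hlpos hlθ).resolve_left fun h0 => hne ?_
      have h2 : P.pairing l θ = 0 := by rw [← P.algebraMap_pairingIn ℤ, h0, map_zero]
      exact (B.apply_root_root_zero_iff θ l).2 (P.pairing_eq_zero_iff.1 h2)
    have h2 := hsym l θ
    rw [hl, hj, ← P.algebraMap_pairingIn ℤ, ← P.algebraMap_pairingIn ℤ, h1, map_one, mul_one] at h2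
    have h3 : (r k : ℤ) * P.pairingIn ℤ θ l = r j := by
      have : (((r k : ℤ) * P.pairingIn ℤ θ l : ℤ) : R) = ((r j : ℤ) : R) := by
        push_cast
        exact h2
      exact_mod_cast this
    have h4 : (r k : ℤ) ∣ r j := ⟨_, h3.symm⟩
    exact Nat.le_of_dvd (hpos j) (Int.natCast_dvd_natCast.1 h4)
  rw [hB] at hl
  by_cases hlpos : b.IsPos l
  · exact key l hlpos hl hne
  · refine key _ (b.isPos_reflectionPerm_self_of_not hlpos) (by rw [hinv, hl]) ?_
    rw [root_reflectionPerm, reflection_apply_self, map_neg]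
    exact neg_ne_zero.2 hne

end Symmetrizer

end RootPairing.Base

namespace DeformedW

/-! ### Monomials -/

section Eval

variable {I A : Type*} [AddCommGroup A]

/-- The homomorphism sending `Y_j(z q^a t^b)` to `f (j, a, b)`. -/
def monHom (f : I × ℤ × ℤ → A) : YMonomial I →+ A :=
  Finsupp.liftAddHom fun s => zmultiplesHom A (f s)

theorem monHom_apply (f : I × ℤ × ℤ → A) (e : YMonomial I) :
    monHom f e = e.sum fun s n => n • f s := by
  simp only [monHom, Finsupp.liftAddHom_apply]; rfl

@[simp] theorem monHom_yMon (f : I × ℤ × ℤ → A) (j : I) (a b : ℤ) :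
    monHom f (yMon j a b) = f (j, a, b) := by
  simp [monHom, yMon]

theorem yMon_apply [DecidableEq I] (j k : I) (a b a' b' : ℤ) :
    yMon j a b (k, a', b') = if j = k ∧ a = a' ∧ b = b' then 1 else 0 := by
  simp [yMon, Finsupp.single_apply]

end Eval

variable {I : Type*} [DecidableEq I] [Fintype I] (p : Params I)

theorem monHom_aMon {A : Type*} [AddCommGroup A] (f : I × ℤ × ℤ → A) (j : I) (a b : ℤ) :
    monHom f (aMon p j a b) = f (j, a - p.r j, b + 1) + f (j, a + p.r j, b - 1) -
      ∑ k ∈ Finset.univ.erase j, ∑ s ∈ Finset.range (p.inc k j),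
        f (k, a + ((p.inc k j : ℤ) - 1 - 2 * s), b) := by
  simp [aMon, map_sub, map_add, map_sum]

theorem monHom_eq_zero {A : Type*} [AddCommGroup A] {f : I × ℤ × ℤ → A} {j : I}
    (hf : ∀ s, s.1 ≠ j → f s = 0) {N : YMonomial I} (hN : ∀ a b, N (j, a, b) = 0) :
    monHom f N = 0 := by
  rw [monHom_apply, Finsupp.sum]
  refine Finset.sum_eq_zero fun s _ => ?_
  by_cases h : s.1 = j
  · obtain ⟨k, a, b⟩ := s
    simp only at h
    subst h
    rw [hN, zero_smul]
  · rw [hf s h, smul_zero]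

/-- The sum of the exponents, weighted by powers of `τ`. -/
def levelSum (τ : ℝ) : YMonomial I →+ ℝ := monHom fun s => τ ^ s.2.2

/-- A real number so large that `levelSum` is positive on all `A_j`. -/
def bigLevel : ℝ := 1 + ∑ j, ∑ k, (p.inc k j : ℝ)

theorem one_le_bigLevel : 1 ≤ bigLevel p :=
  le_add_of_nonneg_right (Finset.sum_nonneg fun _ _ => Finset.sum_nonneg fun _ _ => by positivity)

theorem levelSum_aMon {τ : ℝ} (hτ : 0 < τ) (j : I) (a b : ℤ) :
    levelSum τ (aMon p j a b) =
      τ ^ b * (τ + τ⁻¹ - ∑ k ∈ Finset.univ.erase j, (p.inc k j : ℝ)) := by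
  rw [levelSum, monHom_aMon]
  simp only [Finset.sum_const, Finset.card_range, nsmul_eq_mul]
  rw [zpow_add₀ hτ.ne', zpow_sub₀ hτ.ne', ← Finset.sum_mul]
  simp only [zpow_one]
  field_simp

theorem sum_inc_lt_bigLevel (j : I) :
    ∑ k ∈ Finset.univ.erase j, (p.inc k j : ℝ) + 1 ≤ bigLevel p := by
  have h1 : ∑ k ∈ Finset.univ.erase j, (p.inc k j : ℝ) ≤ ∑ k, (p.inc k j : ℝ) :=
    Finset.sum_le_sum_of_subset_of_nonneg (Finset.erase_subset _ _) fun _ _ _ => by positivity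
  have h2 : ∑ k, (p.inc k j : ℝ) ≤ ∑ j, ∑ k, (p.inc k j : ℝ) :=
    Finset.single_le_sum (f := fun j => ∑ k, (p.inc k j : ℝ))
      (fun _ _ => Finset.sum_nonneg fun _ _ => by positivity) (Finset.mem_univ j)
  rw [bigLevel]
  linarith

theorem levelSum_aMon_pos (j : I) (a b : ℤ) : 0 < levelSum (bigLevel p) (aMon p j a b) := by
  have h1 := one_le_bigLevel p
  have h0 : 0 < bigLevel p := by linarith
  have h2 := sum_inc_lt_bigLevel p j
  rw [levelSum_aMon p h0]
  have h3 : 0 < (bigLevel p)⁻¹ := inv_pos.2 h0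
  exact mul_pos (zpow_pos h0 _) (by linarith)

/-- The bound to beat is the level `1` of `Y_i(z)`: the first replacement in `Y_i(z)` divides by an
`A_i` with `t`-exponent `1` and so already makes the level negative. -/
theorem one_lt_levelSum_aMon (j : I) (a : ℤ) : 1 < levelSum (bigLevel p) (aMon p j a 1) := by
  have h1 := one_le_bigLevel p
  have h0 : 0 < bigLevel p := by linarith
  have h2 := sum_inc_lt_bigLevel p j
  rw [levelSum_aMon p h0, zpow_one, mul_sub, mul_add, mul_inv_cancel₀ h0.ne']
  nlinarith

/-- A monomial is dominant when no exponent is negative. -/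
def IsDominantMon (e : YMonomial I) : Prop := ∀ s, 0 ≤ e s

theorem IsDominantMon.levelSum_nonneg {e : YMonomial I} (he : IsDominantMon e) {τ : ℝ}
    (hτ : 0 < τ) : 0 ≤ levelSum τ e := by
  rw [levelSum, monHom_apply]
  refine Finset.sum_nonneg fun s _ => ?_
  exact zsmul_nonneg (zpow_pos hτ _).le (he s)

theorem aMon_apply_self (j : I) (a b a' b' : ℤ) :
    aMon p j a b (j, a', b') = yMon j (a - p.r j) (b + 1) (j, a', b') +
      yMon j (a + p.r j) (b - 1) (j, a', b') := by
  rw [aMon, Finsupp.sub_apply, Finsupp.add_apply, sub_eq_self, Finsupp.finsetSum_apply]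
  refine Finset.sum_eq_zero fun k hk => ?_
  rw [Finsupp.finsetSum_apply]
  refine Finset.sum_eq_zero fun s _ => ?_
  rw [yMon_apply, if_neg]
  exact fun h => (Finset.mem_erase.1 hk).1 h.1

/-! ### Pasted combinations have a unique dominant monomial -/

/-- The only replacement possible in `Y_i(z)` leads to a negative level, and every later one lowers
the level further. The induction runs down from high levels inside the finite support. -/
theorem IsPasted.levelSum_neg {p : Params I} {i : I} {c : YMonomial I →₀ ℂ} (hc : IsPasted p i c)
    {e : YMonomial I} (he : e ∈ c.support) (hne : e ≠ yMon i 0 0) :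
    levelSum (bigLevel p) e < 0 := by
  have hfin : (c.support : Set (YMonomial I)).WellFoundedOn
      fun x y => levelSum (bigLevel p) y < levelSum (bigLevel p) x := by
    have := c.support.finite_toSet
    refine Set.Finite.wellFoundedOn (r := fun x y : YMonomial I =>
      levelSum (bigLevel p) y < levelSum (bigLevel p) x) this
  revert hne
  refine hfin.induction (P := fun e => e ≠ yMon i 0 0 → levelSum (bigLevel p) e < 0) he ?_
  intro e he ih hne
  obtain ⟨e', he', j, a, b, hpos, rfl⟩ := hc.2 e he hne
  have hA := levelSum_aMon_pos p j (a - p.r j) (b + 1)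
  by_cases h : e' = yMon i 0 0
  · subst h
    rw [yMon_apply] at hpos
    split_ifs at hpos with h
    · obtain ⟨rfl, rfl, rfl⟩ := h
      have h1 := one_lt_levelSum_aMon p i (0 - p.r i)
      rw [map_sub, zero_add, levelSum, monHom_yMon]
      simp only [zpow_zero]
      exact sub_neg.2 h1
    · exact absurd hpos (lt_irrefl _)
  · have h1 := ih e' he' (by rw [map_sub]; linarith) h
    rw [map_sub]
    linarith

theorem IsPasted.eq_of_isDominantMon {p : Params I} {i : I} {c : YMonomial I →₀ ℂ}
    (hc : IsPasted p i c) {e : YMonomial I} (he : e ∈ c.support) (hdom : IsDominantMon e) :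
    e = yMon i 0 0 := by
  by_contra h
  have h1 := hc.levelSum_neg he h
  have h2 := hdom.levelSum_nonneg (τ := bigLevel p) (lt_of_lt_of_le one_pos (one_le_bigLevel p))
  linarith

/-! ### The structure of combinations of blocks -/

/-- The monomial of a block with minus signs exactly at `M`. -/
def blockMon (j : I) (N : YMonomial I) (S M : Finset (ℤ × ℤ)) : YMonomial I :=
  N + ∑ u ∈ S, yMon j u.1 u.2 - ∑ u ∈ M, aMon p j (u.1 - p.r j) (u.2 + 1)

theorem blockMon_apply (j : I) (N : YMonomial I) (hN : ∀ a b, N (j, a, b) = 0)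
    {S M : Finset (ℤ × ℤ)} (hM : M ⊆ S) (u : ℤ × ℤ) :
    blockMon p j N S M (j, u) = (if u ∈ S \ M then 1 else 0) -
      (if (u.1 + 2 * (p.r j : ℤ), u.2 - 2) ∈ M then 1 else 0) := by
  obtain ⟨a, b⟩ := u
  have h1 : ∀ T : Finset (ℤ × ℤ), ∑ u ∈ T, yMon j u.1 u.2 (j, a, b) =
      if (a, b) ∈ T then 1 else 0 := by
    intro T
    rw [← Finset.sum_ite_eq' T (a, b) (fun _ => (1 : ℤ))]
    refine Finset.sum_congr rfl fun u _ => ?_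
    rw [yMon_apply]
    simp [Prod.ext_iff]
  have h2 : ∑ u ∈ M, yMon j (u.1 - p.r j - p.r j) (u.2 + 1 + 1) (j, a, b) =
      if (a + 2 * (p.r j : ℤ), b - 2) ∈ M then 1 else 0 := by
    rw [← Finset.sum_ite_eq' M (a + 2 * (p.r j : ℤ), b - 2) (fun _ => (1 : ℤ))]
    refine Finset.sum_congr rfl fun u _ => ?_
    rw [yMon_apply]
    congr 1
    rw [Prod.ext_iff]
    simp only [true_and, eq_iff_iff]
    constructor <;> rintro ⟨h, h'⟩ <;> constructor <;> omega
  rw [blockMon, Finsupp.sub_apply, Finsupp.add_apply, hN, Finsupp.finsetSum_apply,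
    Finsupp.finsetSum_apply, h1]
  simp only [aMon_apply_self, Finset.sum_add_distrib, h2, sub_add_cancel, add_sub_cancel_right, h1,
    Finset.mem_sdiff]
  by_cases hu : (a, b) ∈ M
  · simp [hu, hM hu]
  · simp [hu]

/-- The factor `Y_j^{(-)}(u)` contains `Y_j` only as `Y_j(u q^{-2 r_j} t^2)^{-1}`. Regularity of `S`
is exactly what keeps it from cancelling a factor `Y_j(v)` with `v ∈ S \ M`. -/
theorem blockMon_apply_eq_one_iff {j : I} {N : YMonomial I} (hN : ∀ a b, N (j, a, b) = 0)
    {S M : Finset (ℤ × ℤ)} (hS : RegularParams p j S) (hM : M ⊆ S) (u : ℤ × ℤ) :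
    blockMon p j N S M (j, u) = 1 ↔ u ∈ S \ M := by
  rw [blockMon_apply p j N hN hM]
  by_cases h1 : u ∈ S \ M
  · have h2 : (u.1 + 2 * (p.r j : ℤ), u.2 - 2) ∉ M := fun h =>
      hS _ (hM h) u (Finset.mem_sdiff.1 h1).1 (by simp)
    simp only [h1, h2, if_true, if_false, sub_zero]
  · simp only [h1, if_false, iff_false]
    split_ifs <;> norm_num

theorem blockMon_apply_eq_neg_one_iff {j : I} {N : YMonomial I} (hN : ∀ a b, N (j, a, b) = 0)
    {S M : Finset (ℤ × ℤ)} (hS : RegularParams p j S) (hM : M ⊆ S) (u : ℤ × ℤ) :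
    blockMon p j N S M (j, u.1 - 2 * (p.r j : ℤ), u.2 + 2) = -1 ↔ u ∈ M := by
  have h := blockMon_apply p j N hN hM (u.1 - 2 * (p.r j : ℤ), u.2 + 2)
  rw [h]
  simp only [sub_add_cancel, add_sub_cancel_right, Prod.mk.eta]
  by_cases h1 : u ∈ M
  · have h2 : (u.1 - 2 * (p.r j : ℤ), u.2 + 2) ∉ S \ M := fun h =>
      hS u (hM h1) _ (Finset.mem_sdiff.1 h).1 (by simp)
    rw [if_neg h2, if_pos h1]
    simp [h1]
  · rw [if_neg h1]
    simp only [h1, iff_false]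
    split_ifs <;> norm_num

/-- The exponents `-1` of `Y_j` recover `M`, the exponents `1` recover `S \ M`. Hence a monomial
lies in at most one block of a given direction. -/
theorem blockMon_injective {j : I} {N N' : YMonomial I} (hN : ∀ a b, N (j, a, b) = 0)
    (hN' : ∀ a b, N' (j, a, b) = 0) {S M S' M' : Finset (ℤ × ℤ)} (hS : RegularParams p j S)
    (hS' : RegularParams p j S') (hM : M ⊆ S) (hM' : M' ⊆ S')
    (h : blockMon p j N S M = blockMon p j N' S' M') : N = N' ∧ S = S' ∧ M = M' := by
  have h1 : M = M' := by
    ext u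
    rw [← blockMon_apply_eq_neg_one_iff p hN hS hM, h,
      blockMon_apply_eq_neg_one_iff p hN' hS' hM']
  have h2 : S \ M = S' \ M' := by
    ext u
    rw [← blockMon_apply_eq_one_iff p hN hS hM, h, blockMon_apply_eq_one_iff p hN' hS' hM']
  have h3 : S = S' := by
    rw [← Finset.sdiff_union_of_subset hM, h2, h1, Finset.sdiff_union_of_subset hM']
  subst h1 h3
  refine ⟨?_, rfl, rfl⟩
  simpa [blockMon] using h

theorem sl2Block_apply (j : I) (N : YMonomial I) (S : Finset (ℤ × ℤ)) (e : YMonomial I) :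
    sl2Block p j N S e =
      ∑ M ∈ S.powerset, if blockMon p j N S M = e then gammaCoef p j S M else 0 := by
  classical
  rw [sl2Block, Finsupp.finsetSum_apply]
  exact Finset.sum_congr rfl fun M _ => Finsupp.single_apply

theorem sl2Block_blockMon {j : I} {N N' : YMonomial I} (hN : ∀ a b, N (j, a, b) = 0)
    (hN' : ∀ a b, N' (j, a, b) = 0) {S M S' : Finset (ℤ × ℤ)} (hS : RegularParams p j S)
    (hS' : RegularParams p j S') (hM : M ⊆ S) [Decidable (N = N' ∧ S = S')] :
    sl2Block p j N' S' (blockMon p j N S M) =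
      if N = N' ∧ S = S' then gammaCoef p j S M else 0 := by
  rw [sl2Block_apply]
  split_ifs with h
  · obtain ⟨rfl, rfl⟩ := h
    rw [Finset.sum_eq_single M]
    · rw [if_pos rfl]
    · intro M' hM' hne
      rw [if_neg]
      intro h
      exact hne (blockMon_injective p hN hN hS hS (Finset.mem_powerset.1 hM') hM h).2.2
    · intro h
      exact absurd (Finset.mem_powerset.2 hM) h
  · refine Finset.sum_eq_zero fun M' hM' => if_neg fun h' => h ?_
    have := blockMon_injective p hN' hN hS' hS (Finset.mem_powerset.1 hM') hM h'
    exact ⟨this.1.symm, this.2.1.symm⟩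

@[simp] theorem gammaCoef_empty (j : I) (S : Finset (ℤ × ℤ)) : gammaCoef p j S ∅ = 1 := by
  simp [gammaCoef]

@[simp] theorem gammaCoef_self (j : I) (S : Finset (ℤ × ℤ)) : gammaCoef p j S S = 1 := by
  simp [gammaCoef]

/-- Distinct blocks share no monomial, so inside one block a combination is a multiple of the block
itself; the factor is read off at the top, where `γ = 1`. -/
theorem apply_blockMon_of_mem_span {j : I} {d : YMonomial I →₀ ℂ}
    (hd : d ∈ Submodule.span ℂ (sl2Blocks p j)) {N : YMonomial I} (hN : ∀ a b, N (j, a, b) = 0)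
    {S M : Finset (ℤ × ℤ)} (hS : RegularParams p j S) (hM : M ⊆ S) :
    d (blockMon p j N S M) = gammaCoef p j S M * d (blockMon p j N S ∅) := by
  classical
  induction hd using Submodule.span_induction with
  | mem x hx =>
    obtain ⟨N', S', hN', hS', rfl⟩ := hx
    rw [sl2Block_blockMon p hN hN' hS hS' hM,
      sl2Block_blockMon p hN hN' hS hS' (Finset.empty_subset _), gammaCoef_empty]
    split_ifs <;> simp
  | zero => simp
  | add x y _ _ hx hy => rw [Finsupp.add_apply, Finsupp.add_apply, hx, hy, mul_add]
  | smul a x _ hx =>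
    rw [Finsupp.smul_apply, Finsupp.smul_apply, hx, smul_eq_mul, smul_eq_mul]
    ring

theorem exists_blockMon_of_mem_span {j : I} {d : YMonomial I →₀ ℂ}
    (hd : d ∈ Submodule.span ℂ (sl2Blocks p j)) {e : YMonomial I} (he : d e ≠ 0) :
    ∃ (N : YMonomial I) (S M : Finset (ℤ × ℤ)), (∀ a b, N (j, a, b) = 0) ∧ RegularParams p j S ∧
      M ⊆ S ∧ e = blockMon p j N S M ∧ d (blockMon p j N S ∅) ≠ 0 := by
  have key : ∃ (N : YMonomial I) (S M : Finset (ℤ × ℤ)), (∀ a b, N (j, a, b) = 0) ∧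
      RegularParams p j S ∧ M ⊆ S ∧ e = blockMon p j N S M := by
    by_contra hcon
    apply he
    induction hd using Submodule.span_induction with
    | mem x hx =>
      obtain ⟨N, S, hN, hS, rfl⟩ := hx
      rw [sl2Block_apply]
      refine Finset.sum_eq_zero fun M hM => if_neg fun h => hcon ?_
      exact ⟨N, S, M, hN, hS, Finset.mem_powerset.1 hM, h.symm⟩
    | zero => rfl
    | add x y _ _ hx hy =>
      have h1 : x e = 0 := by
        by_contra h
        exact h (hx h)
      have h2 : y e = 0 := by
        by_contra h
        exact h (hy h)
      rw [Finsupp.add_apply, h1, h2, add_zero]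
    | smul a x _ hx =>
      have h1 : x e = 0 := by
        by_contra h
        exact h (hx h)
      rw [Finsupp.smul_apply, h1, smul_zero]
  obtain ⟨N, S, M, hN, hS, hM, rfl⟩ := key
  refine ⟨N, S, M, hN, hS, hM, rfl, fun h => he ?_⟩
  rw [apply_blockMon_of_mem_span p hd hN hS hM, h, mul_zero]

theorem levelSum_blockMon (j : I) (N : YMonomial I) (S M : Finset (ℤ × ℤ)) (τ : ℝ) :
    levelSum τ (blockMon p j N S M) = levelSum τ (blockMon p j N S ∅) -
      ∑ u ∈ M, levelSum τ (aMon p j (u.1 - p.r j) (u.2 + 1)) := by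
  simp [blockMon, map_sub, map_add, map_sum]

/-- A monomial of maximal level is dominant in direction `j`. -/
theorem nonneg_of_forall_levelSum_le {j : I} {d : YMonomial I →₀ ℂ}
    (hd : d ∈ Submodule.span ℂ (sl2Blocks p j)) {e : YMonomial I} (he : d e ≠ 0)
    (hmax : ∀ e', d e' ≠ 0 → levelSum (bigLevel p) e' ≤ levelSum (bigLevel p) e) (u : ℤ × ℤ) :
    0 ≤ e (j, u) := by
  obtain ⟨N, S, M, hN, hS, hM, rfl, hne⟩ := exists_blockMon_of_mem_span p hd he
  have h1 := hmax _ hne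
  rw [levelSum_blockMon p j N S M] at h1
  have h2 : M = ∅ := by
    by_contra h
    have := Finset.sum_pos (s := M) (f := fun u => levelSum (bigLevel p)
      (aMon p j (u.1 - p.r j) (u.2 + 1))) (fun u _ => levelSum_aMon_pos p j _ _)
      (Finset.nonempty_iff_ne_empty.2 h)
    linarith
  subst h2
  rw [blockMon_apply p j N hN hM]
  simp only [Finset.notMem_empty, if_false, sub_zero]
  split_ifs <;> norm_num

/-- A monomial of minimal level is antidominant in direction `j`. -/
theorem nonpos_of_forall_le_levelSum {j : I} {d : YMonomial I →₀ ℂ}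
    (hd : d ∈ Submodule.span ℂ (sl2Blocks p j)) {e : YMonomial I} (he : d e ≠ 0)
    (hmin : ∀ e', d e' ≠ 0 → levelSum (bigLevel p) e ≤ levelSum (bigLevel p) e') (u : ℤ × ℤ) :
    e (j, u) ≤ 0 := by
  obtain ⟨N, S, M, hN, hS, hM, rfl, hne⟩ := exists_blockMon_of_mem_span p hd he
  have h0 : d (blockMon p j N S S) ≠ 0 := by
    rw [apply_blockMon_of_mem_span p hd hN hS subset_rfl, gammaCoef_self, one_mul]
    exact hne
  have h1 := hmin _ h0
  rw [levelSum_blockMon p j N S M, levelSum_blockMon p j N S S, ← Finset.sum_sdiff hM] at h1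
  have h2 : S \ M = ∅ := by
    by_contra h
    have := Finset.sum_pos (s := S \ M) (f := fun u => levelSum (bigLevel p)
      (aMon p j (u.1 - p.r j) (u.2 + 1))) (fun u _ => levelSum_aMon_pos p j _ _)
      (Finset.nonempty_iff_ne_empty.2 h)
    linarith
  rw [blockMon_apply p j N hN hM, h2]
  simp only [Finset.notMem_empty, if_false, zero_sub]
  split_ifs <;> norm_num

/-- A combination of blocks in all directions without dominant monomials vanishes. -/
theorem eq_zero_of_forall_not_isDominantMon {d : YMonomial I →₀ ℂ}
    (hd : ∀ j, d ∈ Submodule.span ℂ (sl2Blocks p j))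
    (h : ∀ e, IsDominantMon e → d e = 0) : d = 0 := by
  by_contra hne
  obtain ⟨e, he, hmax⟩ := d.support.exists_max_image (levelSum (bigLevel p))
    (Finsupp.support_nonempty_iff.2 hne)
  refine Finsupp.mem_support_iff.1 he (h e fun s => ?_)
  exact nonneg_of_forall_levelSum_le p (hd s.1) (Finsupp.mem_support_iff.1 he)
    (fun e' he' => hmax e' (Finsupp.mem_support_iff.2 he')) s.2

/-! ### Raising an antidominant monomial through its block -/

/-- Replaces every factor `Y_j(z q^a t^b)^{-1}` by
`:Y_j(z q^a t^b)^{-1} A_j(z q^{a + r_j} t^{b - 1}):`. -/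
def raise (j : I) : YMonomial I →+ YMonomial I :=
  AddMonoidHom.id _ - monHom fun s =>
    if s.1 = j then aMon p j (s.2.1 + p.r j) (s.2.2 - 1) else 0

/-- In the bottom monomial the parameter `u` contributes `Y_j(u q^{-2 r_j} t^2)^{-1}`, and raising
this factor multiplies by `A_j(u q^{-r_j} t)`, which undoes the passage to `Y_j^{(-)}(u)`. Since
`raise` is additive, nothing else has to be tracked. -/
theorem raise_blockMon {j : I} {N : YMonomial I} (hN : ∀ a b, N (j, a, b) = 0)
    (S : Finset (ℤ × ℤ)) : raise p j (blockMon p j N S S) = blockMon p j N S ∅ := by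
  have hz : monHom (fun s : I × ℤ × ℤ =>
      if s.1 = j then aMon p j (s.2.1 + p.r j) (s.2.2 - 1) else 0) N = 0 :=
    monHom_eq_zero (j := j) (fun s hs => if_neg hs) hN
  rw [raise, AddMonoidHom.sub_apply, AddMonoidHom.id_apply, sub_eq_iff_eq_add]
  simp only [blockMon, map_sub, map_add, map_sum, hz, monHom_yMon, monHom_aMon, if_true,
    Finset.sum_empty, sub_zero, zero_add]
  rw [← Finset.sum_sub_distrib, sub_eq_add_neg, ← Finset.sum_neg_distrib]
  congr 1
  refine Finset.sum_congr rfl fun u _ => ?_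
  have h0 : ∑ k ∈ Finset.univ.erase j, ∑ s ∈ Finset.range (p.inc k j),
      (if k = j then aMon p j (u.1 - p.r j + ((p.inc k j : ℤ) - 1 - 2 * s) + p.r j)
        (u.2 + 1 - 1) else 0) = 0 := by
    refine Finset.sum_eq_zero fun k hk => Finset.sum_eq_zero fun s _ => if_neg ?_
    exact (Finset.mem_erase.1 hk).1
  rw [h0]
  simp

/-- Without positive exponents of `Y_j` the set `S \ M` is empty, so `e` is the bottom of its block;
`γ = 1` at both ends. -/
theorem raise_of_mem_span {j : I} {d : YMonomial I →₀ ℂ}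
    (hd : d ∈ Submodule.span ℂ (sl2Blocks p j)) {e : YMonomial I} (he : d e ≠ 0)
    (hneg : ∀ u, e (j, u) ≤ 0) : d (raise p j e) = d e := by
  obtain ⟨N, S, M, hN, hS, hM, rfl, hne⟩ := exists_blockMon_of_mem_span p hd he
  have h1 : M = S := by
    refine Finset.Subset.antisymm hM fun u hu => ?_
    by_contra h
    have h2 := (blockMon_apply_eq_one_iff p hN hS hM u).2 (Finset.mem_sdiff.2 ⟨hu, h⟩)
    have h3 := hneg u
    omega
  subst h1
  rw [raise_blockMon p hN, apply_blockMon_of_mem_span p hd hN hS subset_rfl, gammaCoef_self,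
    one_mul]

end DeformedW

namespace DeformedW

/-! ### Laurent polynomial coordinates -/

/-- The Laurent monomial with exponents `u`. -/
def lmono (u : ℤ × ℤ) : AddMonoidAlgebra ℤ (ℤ × ℤ) := AddMonoidAlgebra.single u 1

theorem lmono_mul (u v : ℤ × ℤ) : lmono u * lmono v = lmono (u + v) := by
  simp [lmono, AddMonoidAlgebra.single_mul_single]

theorem lmono_coeff (u v : ℤ × ℤ) : (lmono u).coeff v = if u = v then 1 else 0 := by
  simp [lmono, Finsupp.single_apply]

/-- Laurent polynomials with nonnegative coefficients. -/
def nonnegLaurent : Subsemiring (AddMonoidAlgebra ℤ (ℤ × ℤ)) where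
  carrier := {x | ∀ u, 0 ≤ x.coeff u}
  mul_mem' {x y} hx hy u := by
    rw [AddMonoidAlgebra.coeff_mul]
    refine Finset.sum_nonneg fun v _ => Finset.sum_nonneg fun w _ => ?_
    dsimp only
    split_ifs
    · exact mul_nonneg (hx v) (hy w)
    · exact le_rfl
  one_mem' u := by
    change 0 ≤ (AddMonoidAlgebra.single (0 : ℤ × ℤ) (1 : ℤ)).coeff u
    rw [AddMonoidAlgebra.coeff_single, Finsupp.single_apply]
    split_ifs <;> norm_num
  add_mem' {x y} hx hy u := by
    rw [AddMonoidAlgebra.coeff_add]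
    exact add_nonneg (hx u) (hy u)
  zero_mem' u := by simp

theorem nonnegLaurent_add {x y : AddMonoidAlgebra ℤ (ℤ × ℤ)} (hx : x ∈ nonnegLaurent)
    (hy : y ∈ nonnegLaurent) : x + y ∈ nonnegLaurent := add_mem hx hy

theorem nonnegLaurent_mul {x y : AddMonoidAlgebra ℤ (ℤ × ℤ)} (hx : x ∈ nonnegLaurent)
    (hy : y ∈ nonnegLaurent) : x * y ∈ nonnegLaurent := mul_mem hx hy

theorem nonnegLaurent_pow {x : AddMonoidAlgebra ℤ (ℤ × ℤ)} (hx : x ∈ nonnegLaurent) (n : ℕ) :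
    x ^ n ∈ nonnegLaurent := pow_mem hx n

theorem lmono_mem (u : ℤ × ℤ) : lmono u ∈ nonnegLaurent := fun v => by
  rw [lmono_coeff]
  split_ifs <;> norm_num

/-- `[n]_q` as a Laurent polynomial. -/
def lqInt (n : ℕ) : AddMonoidAlgebra ℤ (ℤ × ℤ) :=
  ∑ s ∈ Finset.range n, lmono ((n : ℤ) - 1 - 2 * s, 0)

theorem lqInt_zero : lqInt 0 = 0 := by simp [lqInt]

theorem lmono_zero : lmono 0 = 1 := rfl

theorem lqInt_one : lqInt 1 = 1 := by
  simp only [lqInt, Finset.sum_range_one]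
  exact lmono_zero

theorem lmono_mul_lqInt_two : lmono (1, 0) * lqInt 2 = lmono (1, 0) ^ 2 + 1 := by
  simp only [lqInt, Finset.sum_range_succ, Finset.sum_range_zero, mul_add, lmono_mul, pow_two,
    ← lmono_zero]
  norm_num
  rfl

theorem lmono_mul_lqInt_three :
    lmono (1, 0) ^ 2 * lqInt 3 = lmono (1, 0) ^ 4 + lmono (1, 0) ^ 2 + 1 := by
  simp only [lqInt, Finset.sum_range_succ, Finset.sum_range_zero, mul_add, lmono_mul, pow_succ,
    pow_zero, ← lmono_zero]
  norm_num
  rfl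

section

variable {I A : Type*} [AddCommGroup A]

theorem yMonomial_hom_ext {f g : YMonomial I →+ A} (h : ∀ j a b, f (yMon j a b) = g (yMon j a b)) :
    f = g := by
  refine Finsupp.addHom_ext' fun s => AddMonoidHom.ext_int ?_
  exact h s.1 s.2.1 s.2.2

end

variable {I : Type*} [DecidableEq I]

/-- The exponents of the factors `Y_k` as a Laurent polynomial. -/
def coord (k : I) : YMonomial I →+ AddMonoidAlgebra ℤ (ℤ × ℤ) :=
  monHom fun s => if s.1 = k then lmono s.2 else 0

@[simp] theorem coord_yMon (k j : I) (a b : ℤ) :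
    coord k (yMon j a b) = if j = k then lmono (a, b) else 0 := by
  simp [coord]

theorem coord_coeff (k : I) (e : YMonomial I) (u : ℤ × ℤ) : (coord k e).coeff u = e (k, u) := by
  have h : ((Finsupp.applyAddHom u).comp
      (AddMonoidAlgebra.coeffAddEquiv (R := ℤ) (M := ℤ × ℤ)).toAddMonoidHom).comp (coord k) =
      Finsupp.applyAddHom (k, u) := by
    refine yMonomial_hom_ext fun j a b => ?_
    simp only [AddMonoidHom.comp_apply, coord_yMon, Finsupp.applyAddHom_apply]
    change (if j = k then lmono (a, b) else 0 : AddMonoidAlgebra ℤ (ℤ × ℤ)).coeff u = _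
    by_cases hj : j = k
    · rw [if_pos hj, lmono_coeff, yMon, Finsupp.single_apply]
      simp [Prod.ext_iff, hj]
    · rw [if_neg hj, yMon, Finsupp.single_apply]
      simp [hj]
  exact DFunLike.congr_fun h e

theorem eq_of_coord_eq {e e' : YMonomial I} (h : ∀ k, coord k e = coord k e') : e = e' := by
  ext ⟨k, u⟩
  rw [← coord_coeff, h, coord_coeff]

/-- All exponents of factors `Y_j` are nonpositive. -/
def IsAntidom (j : I) (e : YMonomial I) : Prop := ∀ u, e (j, u) ≤ 0

/-- All exponents of factors `Y_j` are nonnegative. -/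
def IsDom (j : I) (e : YMonomial I) : Prop := ∀ u, 0 ≤ e (j, u)

theorem isAntidom_iff (j : I) (e : YMonomial I) : IsAntidom j e ↔ -coord j e ∈ nonnegLaurent := by
  refine forall_congr' fun u => ?_
  rw [AddMonoidAlgebra.coeff_neg, Finsupp.neg_apply, coord_coeff, neg_nonneg]

theorem isDom_iff (j : I) (e : YMonomial I) : IsDom j e ↔ coord j e ∈ nonnegLaurent := by
  refine forall_congr' fun u => ?_
  rw [coord_coeff]

variable [Fintype I] (p : Params I)

/-- The Laurent monomial `q^{r_j} t^{-1}`. -/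
def lG (j : I) : AddMonoidAlgebra ℤ (ℤ × ℤ) := lmono (p.r j, -1)

theorem lG_mem (j : I) : lG p j ∈ nonnegLaurent := lmono_mem _

theorem coord_aMon_self (j : I) (a b : ℤ) :
    coord j (aMon p j (a + p.r j) (b - 1)) = lmono (a, b) + lG p j ^ 2 * lmono (a, b) := by
  rw [coord, monHom_aMon, pow_two, lG, lmono_mul, lmono_mul]
  rw [Finset.sum_eq_zero fun k hk =>
    Finset.sum_eq_zero fun s _ => if_neg (Finset.mem_erase.1 hk).1]
  simp only [if_true, sub_zero]
  congr 2
  · simp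
  · simp only [Prod.mk_add_mk, Prod.mk.injEq]
    constructor <;> ring

theorem coord_aMon_ne {j k : I} (h : k ≠ j) (a b : ℤ) :
    coord k (aMon p j (a + p.r j) (b - 1)) = -(lG p j * lqInt (p.inc k j) * lmono (a, b)) := by
  rw [coord, monHom_aMon, Finset.sum_eq_single k]
  · simp only [if_true, if_neg h.symm, add_zero, zero_sub, lG, lqInt, Finset.mul_sum,
      Finset.sum_mul, lmono_mul]
    congr 1
    refine Finset.sum_congr rfl fun s _ => ?_
    congr 1
    simp only [Prod.mk_add_mk, Prod.mk.injEq]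
    constructor <;> ring
  · intro l _ hl
    exact Finset.sum_eq_zero fun s _ => if_neg hl
  · intro hk
    exact absurd (Finset.mem_erase.2 ⟨h, Finset.mem_univ k⟩) hk

theorem raise_yMon (j k : I) (a b : ℤ) : raise p j (yMon k a b) =
    yMon k a b - if k = j then aMon p j (a + p.r j) (b - 1) else 0 := by
  simp [raise]

/-- Together with `coord_raise_ne` this exhibits `raise` as a deformed simple reflection: with `G =
q^{r_j} t^{-1}` the coordinates change by `x_j ↦ -G^2 x_j` and `x_k ↦ x_k + G [I_kj]_q x_j`. At `q =
t = 1` this is `s_j` in the basis of fundamental weights. -/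
theorem coord_raise_self (j : I) (e : YMonomial I) :
    coord j (raise p j e) = -(lG p j ^ 2 * coord j e) := by
  have h : (coord j).comp (raise p j) = -(AddMonoidHom.mulLeft (lG p j ^ 2)).comp (coord j) := by
    refine yMonomial_hom_ext fun k a b => ?_
    simp only [AddMonoidHom.comp_apply, AddMonoidHom.neg_apply, AddMonoidHom.coe_mulLeft,
      raise_yMon, map_sub, coord_yMon]
    split_ifs
    · rw [coord_aMon_self]
      ring
    · simp
  exact DFunLike.congr_fun h e

theorem coord_raise_ne {j k : I} (hk : k ≠ j) (e : YMonomial I) :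
    coord k (raise p j e) = coord k e + lG p j * lqInt (p.inc k j) * coord j e := by
  have h : (coord k).comp (raise p j) = coord k +
      (AddMonoidHom.mulLeft (lG p j * lqInt (p.inc k j))).comp (coord j) := by
    refine yMonomial_hom_ext fun l a b => ?_
    simp only [AddMonoidHom.comp_apply, AddMonoidHom.add_apply, AddMonoidHom.coe_mulLeft,
      raise_yMon, map_sub, coord_yMon]
    by_cases hl : l = j
    · subst hl
      rw [if_pos rfl, if_neg hk.symm, if_pos rfl, coord_aMon_ne p hk]
      ring
    · simp [hl]
  exact DFunLike.congr_fun h e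

theorem IsAntidom.isDom_raise {j : I} {e : YMonomial I} (h : IsAntidom j e) :
    IsDom j (raise p j e) := by
  rw [isDom_iff, coord_raise_self, ← mul_neg]
  exact mul_mem (pow_mem (lG_mem p j) 2) ((isAntidom_iff j e).1 h)

theorem raise_eq_self {j : I} {e : YMonomial I} (h : IsAntidom j e) (h' : IsDom j e) :
    raise p j e = e := by
  have h0 : coord j e = 0 := by
    ext u
    rw [coord_coeff]
    exact le_antisymm (h u) (h' u)
  refine eq_of_coord_eq fun k => ?_
  by_cases hk : k = j
  · subst hk
    rw [coord_raise_self, h0, mul_zero, neg_zero]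
  · rw [coord_raise_ne p hk, h0, mul_zero, add_zero]

theorem levelSum_raise (j : I) (e : YMonomial I) (τ : ℝ) :
    levelSum τ (raise p j e) = levelSum τ e - ∑ s ∈ e.support,
      if s.1 = j then e s * levelSum τ (aMon p j (s.2.1 + p.r j) (s.2.2 - 1)) else 0 := by
  rw [raise, AddMonoidHom.sub_apply, AddMonoidHom.id_apply, map_sub, monHom_apply, Finsupp.sum,
    map_sum]
  congr 1
  refine Finset.sum_congr rfl fun s _ => ?_
  rw [map_zsmul]
  split_ifs
  · rw [zsmul_eq_mul]
  · simp

theorem levelSum_lt_raise {j : I} {e : YMonomial I} (h : IsAntidom j e) (h' : ¬ IsDom j e) :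
    levelSum (bigLevel p) e < levelSum (bigLevel p) (raise p j e) := by
  rw [levelSum_raise]
  have hle : ∀ s ∈ e.support, (if s.1 = j then e s * levelSum (bigLevel p)
      (aMon p j (s.2.1 + p.r j) (s.2.2 - 1)) else 0 : ℝ) ≤ 0 := by
    intro s _
    split_ifs with hs
    · subst hs
      exact mul_nonpos_of_nonpos_of_nonneg (by exact_mod_cast h s.2)
        (levelSum_aMon_pos p _ _ _).le
    · exact le_rfl
  rw [IsDom] at h'
  push Not at h'
  obtain ⟨u, hu⟩ := h'
  refine lt_sub_comm.1 (lt_of_lt_of_eq ?_ (sub_self _).symm)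
  refine Finset.sum_neg' hle ⟨(j, u), Finsupp.mem_support_iff.2 hu.ne, ?_⟩
  rw [if_pos rfl]
  exact mul_neg_of_neg_of_pos (by exact_mod_cast hu) (levelSum_aMon_pos p _ _ _)

/-! ### Polygons in rank two -/

/-- The direction of the `n`-th step of an alternating chain. -/
def altDir (j k : I) (n : ℕ) : I := if Even n then j else k

@[simp] theorem altDir_zero (j k : I) : altDir j k 0 = j := by simp [altDir]

@[simp] theorem altDir_succ (j k : I) (n : ℕ) : altDir j k (n + 1) = altDir k j n := by
  by_cases h : Even n <;> simp [altDir, Nat.even_add_one, h]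

/-- Alternately raising in the directions `j` and `k`. -/
def altRaise (j k : I) (z : YMonomial I) : ℕ → YMonomial I
  | 0 => z
  | n + 1 => raise p (altDir j k n) (altRaise j k z n)

/-- Both alternating chains of length `m` from a `j`, `k`-antidominant monomial are raised at
antidominant monomials only, and they have the same end. -/
def IsPolygon (j k : I) (m : ℕ) : Prop :=
  0 < m ∧ ∀ z, IsAntidom j z → IsAntidom k z →
    (∀ n < m, IsAntidom (altDir j k n) (altRaise p j k z n)) ∧
    (∀ n < m, IsAntidom (altDir k j n) (altRaise p k j z n)) ∧
    altRaise p j k z m = altRaise p k j z m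

theorem IsPolygon.symm {j k : I} {m : ℕ} (h : IsPolygon p j k m) : IsPolygon p k j m :=
  ⟨h.1, fun z hk hj => ⟨(h.2 z hj hk).2.1, (h.2 z hj hk).1, (h.2 z hj hk).2.2.symm⟩⟩

theorem isAntidom_of_coord_eq {j : I} {e : YMonomial I} {x : AddMonoidAlgebra ℤ (ℤ × ℤ)}
    (h : coord j e = -x) (hx : x ∈ nonnegLaurent) : IsAntidom j e := by
  rw [isAntidom_iff, h, neg_neg]
  exact hx

/-- Each polygon lemma is a braid relation, of length the order of `s_j s_k`, checked in
coordinates. The start is `(-X, -Y)` with `X`, `Y` nonnegative; `ax`, `ay` are the `j` and `k`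
coordinates along the chain starting with `j`, and `bx`, `by` those along the chain starting with
`k`. Antidominance before each step is visible: the coordinate about to be reflected is minus a
polynomial with nonnegative coefficients. -/
theorem isPolygon_of_inc_eq_zero {j k : I} (hjk : j ≠ k) {G q : AddMonoidAlgebra ℤ (ℤ × ℤ)}
    (hj : lG p j = G) (hk : lG p k = q) (h1 : lG p j * lqInt (p.inc k j) = 0)
    (h2 : lG p k * lqInt (p.inc j k) = 0) : IsPolygon p j k 2 := by
  refine ⟨by norm_num, fun z hzj hzk => ?_⟩
  have hkj := hjk.symm
  rw [isAntidom_iff] at hzj hzk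
  obtain ⟨X, hX⟩ : ∃ X, coord j z = -X := ⟨_, (neg_neg _).symm⟩
  obtain ⟨Y, hY⟩ : ∃ Y, coord k z = -Y := ⟨_, (neg_neg _).symm⟩
  rw [hX, neg_neg] at hzj
  rw [hY, neg_neg] at hzk
  have ax1 : coord j (raise p j z) = G ^ 2 * X := by
    rw [coord_raise_self, hX, hj]; ring
  have ay1 : coord k (raise p j z) = -Y := by
    rw [coord_raise_ne p hkj, h1, hX, hY]; ring
  have ax2 : coord j (raise p k (raise p j z)) = G ^ 2 * X := by
    rw [coord_raise_ne p hjk, h2, ax1, ay1]; ring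
  have ay2 : coord k (raise p k (raise p j z)) = q ^ 2 * Y := by
    rw [coord_raise_self, ay1, hk]; ring
  have bx1 : coord j (raise p k z) = -X := by
    rw [coord_raise_ne p hjk, h2, hX, hY]; ring
  have by1 : coord k (raise p k z) = q ^ 2 * Y := by
    rw [coord_raise_self, hY, hk]; ring
  have bx2 : coord j (raise p j (raise p k z)) = G ^ 2 * X := by
    rw [coord_raise_self, bx1, hj]; ring
  have by2 : coord k (raise p j (raise p k z)) = q ^ 2 * Y := by
    rw [coord_raise_ne p hkj, h1, bx1, by1]; ring
  refine ⟨?_, ?_, ?_⟩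
  · intro n hn
    interval_cases n <;> simp only [altRaise, altDir_zero, altDir_succ]
    all_goals first
      | with_reducible refine isAntidom_of_coord_eq hX ?_
      | with_reducible refine isAntidom_of_coord_eq ay1 ?_
    all_goals repeat first
      | assumption
      | with_reducible apply nonnegLaurent_add
      | with_reducible apply nonnegLaurent_mul
      | with_reducible apply nonnegLaurent_pow
      | exact one_mem _
  · intro n hn
    interval_cases n <;> simp only [altRaise, altDir_zero, altDir_succ]
    all_goals first
      | with_reducible refine isAntidom_of_coord_eq hY ?_
      | with_reducible refine isAntidom_of_coord_eq bx1 ?_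
    all_goals repeat first
      | assumption
      | with_reducible apply nonnegLaurent_add
      | with_reducible apply nonnegLaurent_mul
      | with_reducible apply nonnegLaurent_pow
      | exact one_mem _
  · simp only [altRaise, altDir_zero, altDir_succ]
    refine eq_of_coord_eq fun l => ?_
    by_cases hlj : l = j
    · rw [hlj, ax2, bx2]
    by_cases hlk : l = k
    · rw [hlk, ay2, by2]
    -- A third coordinate only collects multiples of the coordinates being reflected; the two chains
    -- collect the same total.
    simp only [coord_raise_ne p hlj, coord_raise_ne p hlk, hX, ay1, hY, bx1, hj, hk]
    ring

theorem isPolygon_of_simply_laced {j k : I} (hjk : j ≠ k) {G : AddMonoidAlgebra ℤ (ℤ × ℤ)}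
    (hG : G ∈ nonnegLaurent)
    (hj : lG p j = G) (hk : lG p k = G)
    (h1 : lG p j * lqInt (p.inc k j) = G) (h2 : lG p k * lqInt (p.inc j k) = G) : IsPolygon p j k 3 := by
  refine ⟨by norm_num, fun z hzj hzk => ?_⟩
  have hkj := hjk.symm
  rw [isAntidom_iff] at hzj hzk
  obtain ⟨X, hX⟩ : ∃ X, coord j z = -X := ⟨_, (neg_neg _).symm⟩
  obtain ⟨Y, hY⟩ : ∃ Y, coord k z = -Y := ⟨_, (neg_neg _).symm⟩
  rw [hX, neg_neg] at hzj
  rw [hY, neg_neg] at hzk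
  have ax1 : coord j (raise p j z) = G ^ 2 * X := by
    rw [coord_raise_self, hX, hj]; ring
  have ay1 : coord k (raise p j z) = -(Y + G * X) := by
    rw [coord_raise_ne p hkj, h1, hX, hY]; ring
  have ax2 : coord j (raise p k (raise p j z)) = -(G * Y) := by
    rw [coord_raise_ne p hjk, h2, ax1, ay1]; ring
  have ay2 : coord k (raise p k (raise p j z)) = G ^ 2 * (Y + G * X) := by
    rw [coord_raise_self, ay1, hk]; ring
  have ax3 : coord j (raise p j (raise p k (raise p j z))) = G ^ 3 * Y := by
    rw [coord_raise_self, ax2, hj]; ring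
  have ay3 : coord k (raise p j (raise p k (raise p j z))) = G ^ 3 * X := by
    rw [coord_raise_ne p hkj, h1, ax2, ay2]; ring
  have bx1 : coord j (raise p k z) = -(X + G * Y) := by
    rw [coord_raise_ne p hjk, h2, hX, hY]; ring
  have by1 : coord k (raise p k z) = G ^ 2 * Y := by
    rw [coord_raise_self, hY, hk]; ring
  have bx2 : coord j (raise p j (raise p k z)) = G ^ 2 * (X + G * Y) := by
    rw [coord_raise_self, bx1, hj]; ring
  have by2 : coord k (raise p j (raise p k z)) = -(G * X) := by
    rw [coord_raise_ne p hkj, h1, bx1, by1]; ring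
  have bx3 : coord j (raise p k (raise p j (raise p k z))) = G ^ 3 * Y := by
    rw [coord_raise_ne p hjk, h2, bx2, by2]; ring
  have by3 : coord k (raise p k (raise p j (raise p k z))) = G ^ 3 * X := by
    rw [coord_raise_self, by2, hk]; ring
  refine ⟨?_, ?_, ?_⟩
  · intro n hn
    interval_cases n <;> simp only [altRaise, altDir_zero, altDir_succ]
    all_goals first
      | with_reducible refine isAntidom_of_coord_eq hX ?_
      | with_reducible refine isAntidom_of_coord_eq ay1 ?_
      | with_reducible refine isAntidom_of_coord_eq ax2 ?_
    all_goals repeat first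
      | assumption
      | with_reducible apply nonnegLaurent_add
      | with_reducible apply nonnegLaurent_mul
      | with_reducible apply nonnegLaurent_pow
      | exact one_mem _
  · intro n hn
    interval_cases n <;> simp only [altRaise, altDir_zero, altDir_succ]
    all_goals first
      | with_reducible refine isAntidom_of_coord_eq hY ?_
      | with_reducible refine isAntidom_of_coord_eq bx1 ?_
      | with_reducible refine isAntidom_of_coord_eq by2 ?_
    all_goals repeat first
      | assumption
      | with_reducible apply nonnegLaurent_add
      | with_reducible apply nonnegLaurent_mul
      | with_reducible apply nonnegLaurent_pow
      | exact one_mem _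
  · simp only [altRaise, altDir_zero, altDir_succ]
    refine eq_of_coord_eq fun l => ?_
    by_cases hlj : l = j
    · rw [hlj, ax3, bx3]
    by_cases hlk : l = k
    · rw [hlk, ay3, by3]
    simp only [coord_raise_ne p hlj, coord_raise_ne p hlk, hX, ay1, ax2, hY, bx1, by2, hj, hk]
    ring

/-- To be applied with `q` the Laurent monomial `q`, `r_j = 1` and `r_k = 2`; the factor `q ^ 2 + 1`
is `q [2]_q`. -/
theorem isPolygon_of_double {j k : I} (hjk : j ≠ k) {G q : AddMonoidAlgebra ℤ (ℤ × ℤ)}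
    (hG : G ∈ nonnegLaurent) (hq : q ∈ nonnegLaurent)
    (hj : lG p j = G) (hk : lG p k = q * G)
    (h1 : lG p j * lqInt (p.inc k j) = G) (h2 : lG p k * lqInt (p.inc j k) = (q ^ 2 + 1) * G) : IsPolygon p j k 4 := by
  refine ⟨by norm_num, fun z hzj hzk => ?_⟩
  have hkj := hjk.symm
  rw [isAntidom_iff] at hzj hzk
  obtain ⟨X, hX⟩ : ∃ X, coord j z = -X := ⟨_, (neg_neg _).symm⟩
  obtain ⟨Y, hY⟩ : ∃ Y, coord k z = -Y := ⟨_, (neg_neg _).symm⟩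
  rw [hX, neg_neg] at hzj
  rw [hY, neg_neg] at hzk
  have ax1 : coord j (raise p j z) = G ^ 2 * X := by
    rw [coord_raise_self, hX, hj]; ring
  have ay1 : coord k (raise p j z) = -(Y + G * X) := by
    rw [coord_raise_ne p hkj, h1, hX, hY]; ring
  have ax2 : coord j (raise p k (raise p j z)) = -(q ^ 2 * G ^ 2 * X + (q ^ 2 + 1) * G * Y) := by
    rw [coord_raise_ne p hjk, h2, ax1, ay1]; ring
  have ay2 : coord k (raise p k (raise p j z)) = q ^ 2 * G ^ 2 * (Y + G * X) := by
    rw [coord_raise_self, ay1, hk]; ring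
  have ax3 : coord j (raise p j (raise p k (raise p j z))) = G ^ 2 * (q ^ 2 * G ^ 2 * X + (q ^ 2 + 1) * G * Y) := by
    rw [coord_raise_self, ax2, hj]; ring
  have ay3 : coord k (raise p j (raise p k (raise p j z))) = -(G ^ 2 * Y) := by
    rw [coord_raise_ne p hkj, h1, ax2, ay2]; ring
  have ax4 : coord j (raise p k (raise p j (raise p k (raise p j z)))) = q ^ 2 * G ^ 4 * X := by
    rw [coord_raise_ne p hjk, h2, ax3, ay3]; ring
  have ay4 : coord k (raise p k (raise p j (raise p k (raise p j z)))) = q ^ 2 * G ^ 4 * Y := by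
    rw [coord_raise_self, ay3, hk]; ring
  have bx1 : coord j (raise p k z) = -(X + (q ^ 2 + 1) * G * Y) := by
    rw [coord_raise_ne p hjk, h2, hX, hY]; ring
  have by1 : coord k (raise p k z) = q ^ 2 * G ^ 2 * Y := by
    rw [coord_raise_self, hY, hk]; ring
  have bx2 : coord j (raise p j (raise p k z)) = G ^ 2 * (X + (q ^ 2 + 1) * G * Y) := by
    rw [coord_raise_self, bx1, hj]; ring
  have by2 : coord k (raise p j (raise p k z)) = -(G * X + G ^ 2 * Y) := by
    rw [coord_raise_ne p hkj, h1, bx1, by1]; ring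
  have bx3 : coord j (raise p k (raise p j (raise p k z))) = -(q ^ 2 * G ^ 2 * X) := by
    rw [coord_raise_ne p hjk, h2, bx2, by2]; ring
  have by3 : coord k (raise p k (raise p j (raise p k z))) = q ^ 2 * G ^ 2 * (G * X + G ^ 2 * Y) := by
    rw [coord_raise_self, by2, hk]; ring
  have bx4 : coord j (raise p j (raise p k (raise p j (raise p k z)))) = q ^ 2 * G ^ 4 * X := by
    rw [coord_raise_self, bx3, hj]; ring
  have by4 : coord k (raise p j (raise p k (raise p j (raise p k z)))) = q ^ 2 * G ^ 4 * Y := by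
    rw [coord_raise_ne p hkj, h1, bx3, by3]; ring
  refine ⟨?_, ?_, ?_⟩
  · intro n hn
    interval_cases n <;> simp only [altRaise, altDir_zero, altDir_succ]
    all_goals first
      | with_reducible refine isAntidom_of_coord_eq hX ?_
      | with_reducible refine isAntidom_of_coord_eq ay1 ?_
      | with_reducible refine isAntidom_of_coord_eq ax2 ?_
      | with_reducible refine isAntidom_of_coord_eq ay3 ?_
    all_goals repeat first
      | assumption
      | with_reducible apply nonnegLaurent_add
      | with_reducible apply nonnegLaurent_mul
      | with_reducible apply nonnegLaurent_pow
      | exact one_mem _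
  · intro n hn
    interval_cases n <;> simp only [altRaise, altDir_zero, altDir_succ]
    all_goals first
      | with_reducible refine isAntidom_of_coord_eq hY ?_
      | with_reducible refine isAntidom_of_coord_eq bx1 ?_
      | with_reducible refine isAntidom_of_coord_eq by2 ?_
      | with_reducible refine isAntidom_of_coord_eq bx3 ?_
    all_goals repeat first
      | assumption
      | with_reducible apply nonnegLaurent_add
      | with_reducible apply nonnegLaurent_mul
      | with_reducible apply nonnegLaurent_pow
      | exact one_mem _
  · simp only [altRaise, altDir_zero, altDir_succ]
    refine eq_of_coord_eq fun l => ?_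
    by_cases hlj : l = j
    · rw [hlj, ax4, bx4]
    by_cases hlk : l = k
    · rw [hlk, ay4, by4]
    simp only [coord_raise_ne p hlj, coord_raise_ne p hlk, hX, ay1, ax2, ay3, hY, bx1, by2, bx3, hj, hk]
    ring

-- To be applied with `r_j = 1` and `r_k = 3`; the factor `q ^ 4 + q ^ 2 + 1` is `q^2 [3]_q`.
set_option maxHeartbeats 1000000 in
theorem isPolygon_of_triple {j k : I} (hjk : j ≠ k) {G q : AddMonoidAlgebra ℤ (ℤ × ℤ)}
    (hG : G ∈ nonnegLaurent) (hq : q ∈ nonnegLaurent)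
    (hj : lG p j = G) (hk : lG p k = q ^ 2 * G)
    (h1 : lG p j * lqInt (p.inc k j) = G)
    (h2 : lG p k * lqInt (p.inc j k) = (q ^ 4 + q ^ 2 + 1) * G) : IsPolygon p j k 6 := by
  refine ⟨by norm_num, fun z hzj hzk => ?_⟩
  have hkj := hjk.symm
  rw [isAntidom_iff] at hzj hzk
  obtain ⟨X, hX⟩ : ∃ X, coord j z = -X := ⟨_, (neg_neg _).symm⟩
  obtain ⟨Y, hY⟩ : ∃ Y, coord k z = -Y := ⟨_, (neg_neg _).symm⟩
  rw [hX, neg_neg] at hzj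
  rw [hY, neg_neg] at hzk
  have ax1 : coord j (raise p j z) = G ^ 2 * X := by
    rw [coord_raise_self, hX, hj]; ring
  have ay1 : coord k (raise p j z) = -(Y + G * X) := by
    rw [coord_raise_ne p hkj, h1, hX, hY]; ring
  have ax2 : coord j (raise p k (raise p j z)) = -((q ^ 4 + q ^ 2) * G ^ 2 * X + (q ^ 4 + q ^ 2 + 1) * G * Y) := by
    rw [coord_raise_ne p hjk, h2, ax1, ay1]; ring
  have ay2 : coord k (raise p k (raise p j z)) = q ^ 4 * G ^ 2 * (Y + G * X) := by
    rw [coord_raise_self, ay1, hk]; ring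
  have ax3 : coord j (raise p j (raise p k (raise p j z))) = G ^ 2 * ((q ^ 4 + q ^ 2) * G ^ 2 * X + (q ^ 4 + q ^ 2 + 1) * G * Y) := by
    rw [coord_raise_self, ax2, hj]; ring
  have ay3 : coord k (raise p j (raise p k (raise p j z))) = -(q ^ 2 * G ^ 3 * X + (q ^ 2 + 1) * G ^ 2 * Y) := by
    rw [coord_raise_ne p hkj, h1, ax2, ay2]; ring
  have ax4 : coord j (raise p k (raise p j (raise p k (raise p j z)))) = -(q ^ 6 * G ^ 4 * X + (q ^ 6 + q ^ 4 + q ^ 2) * G ^ 3 * Y) := by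
    rw [coord_raise_ne p hjk, h2, ax3, ay3]; ring
  have ay4 : coord k (raise p k (raise p j (raise p k (raise p j z)))) = q ^ 4 * G ^ 2 * (q ^ 2 * G ^ 3 * X + (q ^ 2 + 1) * G ^ 2 * Y) := by
    rw [coord_raise_self, ay3, hk]; ring
  have ax5 : coord j (raise p j (raise p k (raise p j (raise p k (raise p j z))))) = G ^ 2 * (q ^ 6 * G ^ 4 * X + (q ^ 6 + q ^ 4 + q ^ 2) * G ^ 3 * Y) := by
    rw [coord_raise_self, ax4, hj]; ring
  have ay5 : coord k (raise p j (raise p k (raise p j (raise p k (raise p j z))))) = -(q ^ 2 * G ^ 4 * Y) := by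
    rw [coord_raise_ne p hkj, h1, ax4, ay4]; ring
  have ax6 : coord j (raise p k (raise p j (raise p k (raise p j (raise p k (raise p j z)))))) = q ^ 6 * G ^ 6 * X := by
    rw [coord_raise_ne p hjk, h2, ax5, ay5]; ring
  have ay6 : coord k (raise p k (raise p j (raise p k (raise p j (raise p k (raise p j z)))))) = q ^ 6 * G ^ 6 * Y := by
    rw [coord_raise_self, ay5, hk]; ring
  have bx1 : coord j (raise p k z) = -(X + (q ^ 4 + q ^ 2 + 1) * G * Y) := by
    rw [coord_raise_ne p hjk, h2, hX, hY]; ring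
  have by1 : coord k (raise p k z) = q ^ 4 * G ^ 2 * Y := by
    rw [coord_raise_self, hY, hk]; ring
  have bx2 : coord j (raise p j (raise p k z)) = G ^ 2 * (X + (q ^ 4 + q ^ 2 + 1) * G * Y) := by
    rw [coord_raise_self, bx1, hj]; ring
  have by2 : coord k (raise p j (raise p k z)) = -(G * X + (q ^ 2 + 1) * G ^ 2 * Y) := by
    rw [coord_raise_ne p hkj, h1, bx1, by1]; ring
  have bx3 : coord j (raise p k (raise p j (raise p k z))) = -((q ^ 4 + q ^ 2) * G ^ 2 * X + (q ^ 6 + q ^ 4 + q ^ 2) * G ^ 3 * Y) := by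
    rw [coord_raise_ne p hjk, h2, bx2, by2]; ring
  have by3 : coord k (raise p k (raise p j (raise p k z))) = q ^ 4 * G ^ 2 * (G * X + (q ^ 2 + 1) * G ^ 2 * Y) := by
    rw [coord_raise_self, by2, hk]; ring
  have bx4 : coord j (raise p j (raise p k (raise p j (raise p k z)))) = G ^ 2 * ((q ^ 4 + q ^ 2) * G ^ 2 * X + (q ^ 6 + q ^ 4 + q ^ 2) * G ^ 3 * Y) := by
    rw [coord_raise_self, bx3, hj]; ring
  have by4 : coord k (raise p j (raise p k (raise p j (raise p k z)))) = -(q ^ 2 * G ^ 3 * X + q ^ 2 * G ^ 4 * Y) := by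
    rw [coord_raise_ne p hkj, h1, bx3, by3]; ring
  have bx5 : coord j (raise p k (raise p j (raise p k (raise p j (raise p k z))))) = -(q ^ 6 * G ^ 4 * X) := by
    rw [coord_raise_ne p hjk, h2, bx4, by4]; ring
  have by5 : coord k (raise p k (raise p j (raise p k (raise p j (raise p k z))))) = q ^ 4 * G ^ 2 * (q ^ 2 * G ^ 3 * X + q ^ 2 * G ^ 4 * Y) := by
    rw [coord_raise_self, by4, hk]; ring
  have bx6 : coord j (raise p j (raise p k (raise p j (raise p k (raise p j (raise p k z)))))) = q ^ 6 * G ^ 6 * X := by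
    rw [coord_raise_self, bx5, hj]; ring
  have by6 : coord k (raise p j (raise p k (raise p j (raise p k (raise p j (raise p k z)))))) = q ^ 6 * G ^ 6 * Y := by
    rw [coord_raise_ne p hkj, h1, bx5, by5]; ring
  refine ⟨?_, ?_, ?_⟩
  · intro n hn
    interval_cases n <;> simp only [altRaise, altDir_zero, altDir_succ]
    all_goals first
      | with_reducible refine isAntidom_of_coord_eq hX ?_
      | with_reducible refine isAntidom_of_coord_eq ay1 ?_
      | with_reducible refine isAntidom_of_coord_eq ax2 ?_
      | with_reducible refine isAntidom_of_coord_eq ay3 ?_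
      | with_reducible refine isAntidom_of_coord_eq ax4 ?_
      | with_reducible refine isAntidom_of_coord_eq ay5 ?_
    all_goals repeat first
      | assumption
      | with_reducible apply nonnegLaurent_add
      | with_reducible apply nonnegLaurent_mul
      | with_reducible apply nonnegLaurent_pow
      | exact one_mem _
  · intro n hn
    interval_cases n <;> simp only [altRaise, altDir_zero, altDir_succ]
    all_goals first
      | with_reducible refine isAntidom_of_coord_eq hY ?_
      | with_reducible refine isAntidom_of_coord_eq bx1 ?_
      | with_reducible refine isAntidom_of_coord_eq by2 ?_
      | with_reducible refine isAntidom_of_coord_eq bx3 ?_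
      | with_reducible refine isAntidom_of_coord_eq by4 ?_
      | with_reducible refine isAntidom_of_coord_eq bx5 ?_
    all_goals repeat first
      | assumption
      | with_reducible apply nonnegLaurent_add
      | with_reducible apply nonnegLaurent_mul
      | with_reducible apply nonnegLaurent_pow
      | exact one_mem _
  · simp only [altRaise, altDir_zero, altDir_succ]
    refine eq_of_coord_eq fun l => ?_
    by_cases hlj : l = j
    · rw [hlj, ax6, bx6]
    by_cases hlk : l = k
    · rw [hlk, ay6, by6]
    simp only [coord_raise_ne p hlj, coord_raise_ne p hlk, hX, ay1, ax2, ay3, ax4, ay5, hY, bx1, by2, bx3, by4, bx5, hj, hk]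
    ring

end DeformedW

namespace DeformedW

variable {I : Type*} [DecidableEq I] [Fintype I] (p : Params I)

/-! ### Monomials reached by raising -/

/-- The monomials obtained from `e` by successively raising antidominant monomials. -/
inductive Reach (e : YMonomial I) : YMonomial I → Prop
  | refl : Reach e e
  | step (j : I) (x : YMonomial I) : Reach e x → IsAntidom j x → Reach e (raise p j x)

/-- The vertices of the polygon of `z`. -/
def InPolygon (j k : I) (m : ℕ) (z x : YMonomial I) : Prop :=
  ∃ n ≤ m, x = altRaise p j k z n ∨ x = altRaise p k j z n

variable {p}

theorem InPolygon.symm {j k : I} {m : ℕ} {z x : YMonomial I} (h : InPolygon p j k m z x) :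
    InPolygon p k j m z x := by
  obtain ⟨n, hn, h⟩ := h
  exact ⟨n, hn, h.symm⟩

theorem IsPolygon.altRaise_cases {j k : I} {m : ℕ} (h : IsPolygon p j k m) {z : YMonomial I}
    (hj : IsAntidom j z) (hk : IsAntidom k z) {n : ℕ} (hn : n ≤ m) :
    n = 0 ∨ ∃ n', n = n' + 1 ∧ IsAntidom (altDir j k n') (altRaise p j k z n') ∧
      IsDom (altDir j k n') (altRaise p j k z n) := by
  cases n with
  | zero => exact Or.inl rfl
  | succ n =>
    have h1 := (h.2 z hj hk).1 n hn
    exact Or.inr ⟨n, rfl, h1, h1.isDom_raise p⟩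

theorem altDir_eq_or (j k : I) (n : ℕ) :
    (altDir j k n = j ∧ altDir k j n = k) ∨ (altDir j k n = k ∧ altDir k j n = j) := by
  by_cases h : Even n <;> simp [altDir, h]

/-- A vertex above `z` is dominant in the direction just raised, where raising again does nothing;
the other direction is the next step of the chain. -/
theorem IsPolygon.raise_altRaise {j k : I} {m : ℕ} (h : IsPolygon p j k m) {z : YMonomial I}
    (hj : IsAntidom j z) (hk : IsAntidom k z) {n : ℕ} (hn : n ≤ m) {l : I} (hl : l = j ∨ l = k)
    (hx : IsAntidom l (altRaise p j k z n)) :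
    InPolygon p j k m z (raise p l (altRaise p j k z n)) := by
  have hself : IsDom l (altRaise p j k z n) →
      InPolygon p j k m z (raise p l (altRaise p j k z n)) := by
    intro hd
    rw [raise_eq_self p hx hd]
    exact ⟨n, hn, Or.inl rfl⟩
  have hm : 0 < m := h.1
  obtain rfl | ⟨n', rfl, ha, hd⟩ := h.altRaise_cases hj hk hn
  · rcases hl with rfl | rfl
    · exact ⟨1, hm, Or.inl (by simp [altRaise])⟩
    · exact ⟨1, hm, Or.inr (by simp [altRaise])⟩
  · have hl' : l = altDir j k n' ∨ l = altDir k j n' := by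
      rcases altDir_eq_or j k n' with ⟨h1, h2⟩ | ⟨h1, h2⟩
      · rwa [h1, h2]
      · rw [h1, h2]
        exact hl.symm
    rcases hl' with hl' | hl'
    · subst hl'
      exact hself hd
    · rcases hn.lt_or_eq with hlt | heq
      · refine ⟨n' + 2, hlt, Or.inl ?_⟩
        rw [hl', ← altDir_succ j k n']
        rfl
      -- At the last vertex there is no next step, but the other chain also ends here, and its last
      -- direction is the remaining one; so the vertex is dominant in both.
      · apply hself
        have h1 := (h.2 z hj hk).2.1 n' (by omega)
        have h2 := h1.isDom_raise p
        rw [heq, (h.2 z hj hk).2.2, ← heq, hl']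
        exact h2

theorem IsPolygon.raise_inPolygon {j k : I} {m : ℕ} (h : IsPolygon p j k m) {z x : YMonomial I}
    (hj : IsAntidom j z) (hk : IsAntidom k z) (hx : InPolygon p j k m z x) {l : I}
    (hl : l = j ∨ l = k) (hxl : IsAntidom l x) : InPolygon p j k m z (raise p l x) := by
  obtain ⟨n, hn, rfl | rfl⟩ := hx
  · exact h.raise_altRaise hj hk hn hl hxl
  · exact (h.symm.raise_altRaise hk hj hn hl.symm hxl).symm

theorem IsPolygon.altRaise_eq_raise {j k : I} {m : ℕ} (h : IsPolygon p j k m) {z : YMonomial I}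
    (hj : IsAntidom j z) (hk : IsAntidom k z) {n : ℕ} (hn : n ≤ m) {l : I} (hl : l = j ∨ l = k) :
    IsAntidom l (altRaise p j k z n) ∨ ∃ x, InPolygon p j k m z x ∧ IsAntidom l x ∧
      altRaise p j k z n = raise p l x := by
  obtain rfl | ⟨n', rfl, ha, hd⟩ := h.altRaise_cases hj hk hn
  · rcases hl with rfl | rfl
    · exact Or.inl hj
    · exact Or.inl hk
  · have hl' : l = altDir j k n' ∨ l = altDir k j n' := by
      rcases altDir_eq_or j k n' with ⟨h1, h2⟩ | ⟨h1, h2⟩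
      · rwa [h1, h2]
      · rw [h1, h2]
        exact hl.symm
    rcases hl' with hl' | hl'
    · subst hl'
      exact Or.inr ⟨_, ⟨n', by omega, Or.inl rfl⟩, ha, rfl⟩
    · rcases hn.lt_or_eq with hlt | heq
      · have h1 := (h.2 z hj hk).1 (n' + 1) hlt
        rw [altDir_succ, ← hl'] at h1
        exact Or.inl h1
      · refine Or.inr ⟨altRaise p k j z n', ⟨n', by omega, Or.inr rfl⟩, ?_, ?_⟩
        · rw [hl']
          exact (h.2 z hj hk).2.1 n' (by omega)
        · rw [heq, (h.2 z hj hk).2.2, ← heq, hl', altRaise]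

theorem IsPolygon.inPolygon_eq_raise {j k : I} {m : ℕ} (h : IsPolygon p j k m) {z x : YMonomial I}
    (hj : IsAntidom j z) (hk : IsAntidom k z) (hx : InPolygon p j k m z x) {l : I}
    (hl : l = j ∨ l = k) :
    IsAntidom l x ∨ ∃ x', InPolygon p j k m z x' ∧ IsAntidom l x' ∧ x = raise p l x' := by
  obtain ⟨n, hn, rfl | rfl⟩ := hx
  · exact h.altRaise_eq_raise hj hk hn hl
  · rcases h.symm.altRaise_eq_raise hk hj hn hl.symm with h1 | ⟨x, hx, h1⟩
    · exact Or.inl h1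
    · exact Or.inr ⟨x, hx.symm, h1⟩

theorem IsPolygon.reach_altRaise {j k : I} {m : ℕ} (h : IsPolygon p j k m) {e z : YMonomial I}
    (hj : IsAntidom j z) (hk : IsAntidom k z) (hz : Reach p e z) {n : ℕ} (hn : n ≤ m) :
    Reach p e (altRaise p j k z n) := by
  induction n with
  | zero => exact hz
  | succ n ih => exact Reach.step _ _ (ih (by omega)) ((h.2 z hj hk).1 n hn)

theorem IsPolygon.reach {j k : I} {m : ℕ} (h : IsPolygon p j k m) {e z x : YMonomial I}
    (hj : IsAntidom j z) (hk : IsAntidom k z) (hz : Reach p e z) (hx : InPolygon p j k m z x) :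
    Reach p e x := by
  obtain ⟨n, hn, rfl | rfl⟩ := hx
  · exact h.reach_altRaise hj hk hz hn
  · exact h.symm.reach_altRaise hk hj hz hn

/-- Steps taken at a monomial without factors `Y_j` change nothing; discarding them makes the last
step strictly increase the level, as induction requires. -/
theorem Reach.cases_lt {e x : YMonomial I} (hx : Reach p e x) :
    x = e ∨ ∃ l x', Reach p e x' ∧ IsAntidom l x' ∧ x = raise p l x' ∧
      levelSum (bigLevel p) x' < levelSum (bigLevel p) x := by
  induction hx with
  | refl => exact Or.inl rfl
  | step j x hx hj ih =>
    by_cases hd : IsDom j x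
    · rw [raise_eq_self p hj hd]
      exact ih
    · exact Or.inr ⟨j, x, hx, hj, rfl, levelSum_lt_raise p hj hd⟩

/-- If all reachable monomials lie in a finite set, each of them lies, for any two directions, on
a polygon of reachable monomials. -/
theorem Reach.exists_inPolygon {mm : I → I → ℕ} (hm : ∀ j k, j ≠ k → IsPolygon p j k (mm j k))
    {e : YMonomial I} (he : ∀ j, IsAntidom j e) {X : Finset (YMonomial I)}
    (hX : ∀ x, Reach p e x → x ∈ X) {x : YMonomial I} (hx : Reach p e x) {j k : I} (hjk : j ≠ k) :
    ∃ z, Reach p e z ∧ IsAntidom j z ∧ IsAntidom k z ∧ InPolygon p j k (mm j k) z x := by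
  have hfin : (X : Set (YMonomial I)).WellFoundedOn
      fun x y => levelSum (bigLevel p) x < levelSum (bigLevel p) y :=
    Set.Finite.wellFoundedOn (r := fun x y : YMonomial I =>
      levelSum (bigLevel p) x < levelSum (bigLevel p) y) X.finite_toSet
  revert hx j k
  by_cases hxX : x ∈ X
  swap
  · exact fun hx => absurd (hX x hx) hxX
  refine hfin.induction (P := fun x => Reach p e x → ∀ {j k : I}, j ≠ k →
    ∃ z, Reach p e z ∧ IsAntidom j z ∧ IsAntidom k z ∧ InPolygon p j k (mm j k) z x) hxX ?_
  intro x _ ih hx j k hjk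
  have ih' : ∀ y, Reach p e y → levelSum (bigLevel p) y < levelSum (bigLevel p) x →
      ∀ {j k : I}, j ≠ k → ∃ z, Reach p e z ∧ IsAntidom j z ∧ IsAntidom k z ∧
        InPolygon p j k (mm j k) z y := fun y hy hlt => ih y (hX y hy) hlt hy
  have hsub : ∀ l x', (l = j ∨ l = k) → Reach p e x' → IsAntidom l x' → x = raise p l x' →
      levelSum (bigLevel p) x' < levelSum (bigLevel p) x →
      ∃ z, Reach p e z ∧ IsAntidom j z ∧ IsAntidom k z ∧ InPolygon p j k (mm j k) z x := by
    intro l x' hl hx' hxl hxe hlt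
    obtain ⟨z, hz, hzj, hzk, hp⟩ := ih' x' hx' hlt hjk
    refine ⟨z, hz, hzj, hzk, ?_⟩
    rw [hxe]
    exact (hm j k hjk).raise_inPolygon hzj hzk hp hl hxl
  by_cases hanti : IsAntidom j x ∧ IsAntidom k x
  · exact ⟨x, hx, hanti.1, hanti.2, 0, Nat.zero_le _, Or.inl rfl⟩
  obtain rfl | ⟨l, x', hx', hxl, hxe, hlt⟩ := hx.cases_lt
  · exact absurd ⟨he j, he k⟩ hanti
  by_cases hl : l = j ∨ l = k
  · exact hsub l x' hl hx' hxl hxe hlt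
  -- The last step came from a third direction `l`. The polygon for `l` and `i` through `x'` also
  -- contains `x`; as `x` is not antidominant in direction `i`, that polygon exhibits `x` as raised
  -- in direction `i` from a lower reachable monomial, which is the case already treated.
  have key : ∀ i, (i = j ∨ i = k) → ¬ IsAntidom i x →
      ∃ z, Reach p e z ∧ IsAntidom j z ∧ IsAntidom k z ∧ InPolygon p j k (mm j k) z x := by
    intro i hi hxi
    have hli : l ≠ i := by
      rintro rfl
      exact hl hi
    obtain ⟨z, hz, hzl, hzi, hp⟩ := ih' x' hx' hlt hli
    have hpx : InPolygon p l i (mm l i) z x := by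
      rw [hxe]
      exact (hm l i hli).raise_inPolygon hzl hzi hp (Or.inl rfl) hxl
    obtain h1 | ⟨y, hy, hyi, hxy⟩ := (hm l i hli).inPolygon_eq_raise hzl hzi hpx (Or.inr rfl)
    · exact absurd h1 hxi
    · refine hsub i y hi ((hm l i hli).reach hzl hzi hz hy) hyi hxy ?_
      rw [hxy]
      refine levelSum_lt_raise p hyi fun hd => hxi ?_
      rw [hxy, raise_eq_self p hyi hd]
      exact hyi
  rw [not_and_or] at hanti
  rcases hanti with h | h
  · exact key j (Or.inl rfl) h
  · exact key k (Or.inr rfl) h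

/-- If `l` is the direction of the last step and `l ≠ j`, look at the polygon for `l` and `j`
through `x`: every vertex is antidominant in direction `j` or has been raised in it. -/
theorem Reach.isAntidom_or_isDom {mm : I → I → ℕ}
    (hm : ∀ j k, j ≠ k → IsPolygon p j k (mm j k))
    {e : YMonomial I} (he : ∀ j, IsAntidom j e) {X : Finset (YMonomial I)}
    (hX : ∀ x, Reach p e x → x ∈ X) {x : YMonomial I} (hx : Reach p e x) (j : I) :
    IsAntidom j x ∨ IsDom j x := by
  obtain rfl | ⟨l, x', hx', hxl, hxe, -⟩ := hx.cases_lt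
  · exact Or.inl (he j)
  by_cases hlj : l = j
  · subst hlj
    rw [hxe]
    exact Or.inr (hxl.isDom_raise p)
  · obtain ⟨z, hz, hzl, hzj, hp⟩ := hx.exists_inPolygon hm he hX hlj
    obtain h1 | ⟨y, hy, hyj, hxy⟩ :=
      (hm l j hlj).inPolygon_eq_raise hzl hzj hp (Or.inr rfl)
    · exact Or.inl h1
    · rw [hxy]
      exact Or.inr (hyj.isDom_raise p)

/-- From an antidominant monomial one reaches a dominant one. -/
theorem exists_reach_isDominantMon {mm : I → I → ℕ}
    (hm : ∀ j k, j ≠ k → IsPolygon p j k (mm j k))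
    {e : YMonomial I} (he : ∀ j, IsAntidom j e) {X : Finset (YMonomial I)}
    (hX : ∀ x, Reach p e x → x ∈ X) : ∃ x, Reach p e x ∧ IsDominantMon x := by
  classical
  obtain ⟨x, hxX, hmax⟩ := (X.filter (Reach p e)).exists_max_image (levelSum (bigLevel p))
    ⟨e, Finset.mem_filter.2 ⟨hX e .refl, .refl⟩⟩
  have hx := (Finset.mem_filter.1 hxX).2
  refine ⟨x, hx, fun s => ?_⟩
  rcases hx.isAntidom_or_isDom hm he hX s.1 with h | h
  · by_contra hneg
    have hnd : ¬ IsDom s.1 x := fun h => hneg (h s.2)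
    have h1 := hmax _ (Finset.mem_filter.2 ⟨hX _ (.step _ _ hx h), .step _ _ hx h⟩)
    exact absurd (levelSum_lt_raise p h hnd) (not_lt.2 h1)
  · exact h s.2

theorem Reach.apply_eq {d : YMonomial I →₀ ℂ}
    (hd : ∀ j, d ∈ Submodule.span ℂ (sl2Blocks p j)) {e x : YMonomial I} (he : d e ≠ 0)
    (hx : Reach p e x) : d x = d e := by
  induction hx with
  | refl => rfl
  | step j x _ hj ih =>
    rw [raise_of_mem_span p (hd j) (by rwa [ih]) hj, ih]

/-- In a pasted combination every antidominant monomial has coefficient one, and the top monomial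
is reached from it. -/
theorem IsPasted.reach_top {i : I} {c : YMonomial I →₀ ℂ} (hc : IsPasted p i c)
    {mm : I → I → ℕ} (hm : ∀ j k, j ≠ k → IsPolygon p j k (mm j k))
    {e : YMonomial I} (hce : c e ≠ 0) (he : ∀ j, IsAntidom j e) :
    Reach p e (yMon i 0 0) ∧ c (yMon i 0 0) = c e := by
  have hX : ∀ x, Reach p e x → x ∈ c.support := fun x hx => by
    rw [Finsupp.mem_support_iff, hx.apply_eq hc.1 hce]
    exact hce
  obtain ⟨x, hx, hdom⟩ := exists_reach_isDominantMon hm he hX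
  have h := hc.eq_of_isDominantMon (hX x hx) hdom
  subst h
  exact ⟨hx, hx.apply_eq hc.1 hce⟩

end DeformedW

/-! ### Fundamental weights -/

namespace RootPairing.Base

variable {ι R M N : Type*} [Field R] [AddCommGroup M] [Module R M] [AddCommGroup N] [Module R N]
  {P : RootPairing ι R M N} (b : P.Base) [P.IsRootSystem]

/-- The fundamental weights. -/
def fundWeight (k : b.support) : M := P.toPerfPair.symm (b.toCoweightBasis.coord k)

theorem coroot'_fundWeight [DecidableEq b.support] (j k : b.support) :
    P.coroot' j (b.fundWeight k) = if j = k then 1 else 0 := by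
  have h : P.coroot' j (b.fundWeight k) = P.toPerfPair (b.fundWeight k) (P.coroot j) := rfl
  have hj : P.coroot j = b.toCoweightBasis j := by simp
  rw [h, fundWeight, LinearEquiv.apply_symm_apply, hj, Module.Basis.coord_apply,
    Module.Basis.repr_self, Finsupp.single_apply]

theorem eq_of_coroot'_eq {x y : M} (h : ∀ j : b.support, P.coroot' j x = P.coroot' j y) : x = y := by
  apply P.toPerfPair.injective
  refine b.toCoweightBasis.ext fun j => ?_
  have hj : b.toCoweightBasis j = P.coroot j := by simp
  rw [hj]
  exact h j

theorem fundWeight_injective [CharZero R] : Function.Injective b.fundWeight := by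
  classical
  intro j k h
  have h1 := b.coroot'_fundWeight j k
  rw [← h, coroot'_fundWeight, if_pos rfl] at h1
  by_contra hne
  rw [if_neg hne] at h1
  exact one_ne_zero h1

theorem fundWeight_ne_zero [CharZero R] (j : b.support) : b.fundWeight j ≠ 0 := by
  classical
  intro h
  have h1 := b.coroot'_fundWeight j j
  rw [h, map_zero, if_pos rfl] at h1
  exact zero_ne_one h1

theorem isDominant_fundWeight (k : b.support) : b.IsDominant (b.fundWeight k) := by
  classical
  intro j hj
  refine ⟨if (⟨j, hj⟩ : b.support) = k then 1 else 0, ?_⟩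
  have h := b.coroot'_fundWeight ⟨j, hj⟩ k
  simp only at h
  rw [h]
  split_ifs <;> simp

/-- The longest element maps fundamental weights to negatives of fundamental weights. -/
theorem smul_fundWeight [Finite ι] [CharZero R] [P.IsCrystallographic] [P.IsReduced]
    {star : b.support → b.support} {L : List b.support}
    (h : ∀ i : b.support, b.wordRefl L (P.root i) = -P.root (star i)) (i : b.support) :
    b.wordRefl L (b.fundWeight i) = -b.fundWeight (star i) := by
  classical
  have hinj : Function.Injective star := by
    intro j k hjk
    have h1 := h j
    rw [hjk, ← h k] at h1
    exact Subtype.ext (P.root.injective ((b.wordRefl L).injective h1))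
  have hsurj : Function.Surjective star := Finite.surjective_of_injective hinj
  refine b.eq_of_coroot'_eq fun j => ?_
  obtain ⟨k, rfl⟩ := hsurj j
  have h1 : b.wordPerm L k = P.reflectionPerm (star k) (star k) := by
    apply P.root.injective
    rw [root_wordPerm, h]
    simp [root_reflectionPerm]
  have h2 := b.coroot'_wordPerm_wordRefl L k (b.fundWeight i)
  rw [h1, coroot'_reflectionPerm_self, coroot'_fundWeight] at h2
  rw [map_neg, coroot'_fundWeight, ← neg_eq_iff_eq_neg, h2]
  simp only [hinj.eq_iff]

end RootPairing.Base

/-! ### Weights of monomials -/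

namespace DeformedW

section

variable {ι R M N : Type*} [Finite ι] [DecidableEq ι] [Field R] [CharZero R]
  [AddCommGroup M] [Module R M] [AddCommGroup N] [Module R N]
  {P : RootPairing ι R M N} [P.IsRootSystem] [P.IsCrystallographic] [P.IsReduced]
  (b : P.Base) (p : Params b.support)

/-- The weight of a monomial, the factor `Y_j(z q^a t^c)` being counted with multiplicity
`f (a, c)`. -/
def weightSum (f : ℤ × ℤ → ℤ) : YMonomial b.support →+ M :=
  monHom fun s => f s.2 • b.fundWeight s.1

/-- The integral affine function `α a + β c + γ` of `(a, c)`. -/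
def affineFun (α β γ : ℤ) : ℤ × ℤ → ℤ := fun u => α * u.1 + β * u.2 + γ

theorem inc_eq (hC : p.C = b.cartanMatrix.transpose) {j k : b.support} (h : j ≠ k) :
    (p.inc k j : ℤ) = -P.pairingIn ℤ j k := by
  have h0 : P.pairingIn ℤ (j : ι) k ≤ 0 := b.cartanMatrix_le_zero_of_ne j k h
  rw [Params.inc, hC, Matrix.transpose_apply, Int.toNat_of_nonneg]
  · rfl
  · exact neg_nonneg.2 h0

theorem sum_range_sub (n : ℕ) : ∑ s ∈ Finset.range n, ((n : ℤ) - 1 - 2 * s) = 0 := by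
  have h := Finset.sum_range_id_mul_two n
  rw [Finset.sum_sub_distrib, ← Finset.mul_sum, Finset.sum_const, Finset.card_range, nsmul_eq_mul]
  cases n with
  | zero => simp
  | succ n =>
    have h' := congrArg (Nat.cast : ℕ → ℤ) h
    rw [Nat.add_sub_cancel] at h'
    push_cast at h' ⊢
    linarith

/-- The parameters of the `Y_k` in `A_j`, for each `k` separately, are centred at that of `A_j`. An
affine weight function therefore sees them all at the centre, where the exponents add up to `α_j`.
-/
theorem weightSum_aMon (hC : p.C = b.cartanMatrix.transpose) (α β γ : ℤ) (j : b.support)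
    (x y : ℤ) : weightSum b (affineFun α β γ) (aMon p j x y) =
      affineFun α β γ (x, y) • P.root j := by
  have hin : ∀ k : b.support, ∑ s ∈ Finset.range (p.inc k j),
      affineFun α β γ (x + ((p.inc k j : ℤ) - 1 - 2 * s), y) =
      p.inc k j * affineFun α β γ (x, y) := by
    intro k
    have h : ∀ s : ℕ, affineFun α β γ (x + ((p.inc k j : ℤ) - 1 - 2 * s), y) =
        affineFun α β γ (x, y) + α * ((p.inc k j : ℤ) - 1 - 2 * s) := by
      intro s
      simp only [affineFun]
      ring
    simp only [h, Finset.sum_add_distrib, ← Finset.mul_sum, sum_range_sub, Finset.sum_const,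
      Finset.card_range, nsmul_eq_mul, mul_zero, add_zero]
  rw [weightSum, monHom_aMon]
  simp only [← Finset.sum_smul, hin, ← add_smul]
  have h2 : affineFun α β γ (x - p.r j, y + 1) + affineFun α β γ (x + p.r j, y - 1) =
      2 * affineFun α β γ (x, y) := by
    simp only [affineFun]
    ring
  rw [h2]
  refine b.eq_of_coroot'_eq fun k => ?_
  have hroot : P.coroot' k (P.root j) = ((P.pairingIn ℤ j k : ℤ) : R) := by
    rw [P.root_coroot'_eq_pairing, ← P.algebraMap_pairingIn ℤ]
    simp
  simp only [map_sub, map_sum, map_zsmul, b.coroot'_fundWeight, hroot, zsmul_eq_mul,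
    mul_ite, mul_one, mul_zero]
  by_cases hjk : k = j
  · subst hjk
    rw [if_pos rfl, Finset.sum_eq_zero, P.pairingIn_same]
    · push_cast
      ring
    · intro l hl
      rw [if_neg (Finset.mem_erase.1 hl).1.symm]
  · rw [if_neg hjk, Finset.sum_eq_single k]
    · have h3 := inc_eq b p hC (Ne.symm hjk)
      rw [if_pos rfl, h3]
      push_cast
      ring
    · intro l _ hl
      rw [if_neg (Ne.symm hl)]
    · intro hk
      exact absurd (Finset.mem_erase.2 ⟨hjk, Finset.mem_univ k⟩) hk

/-- The `A_j` used to raise a factor sits at a parameter shifted by `(r_j, -1)` from it. Without the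
shift the effect would be exactly the reflection; the shift changes the affine function by `α r_j -
β`, whence the correction term. -/
theorem weightSum_raise (hC : p.C = b.cartanMatrix.transpose) (α β γ : ℤ) (j : b.support)
    (e : YMonomial b.support) : weightSum b (affineFun α β γ) (raise p j e) =
      P.reflection j (weightSum b (affineFun α β γ) e) +
        (((β - α * p.r j : ℤ) : R) * P.coroot' j (weightSum b (affineFun 0 0 1) e)) •
          P.root j := by
  have h : (weightSum b (affineFun α β γ)).comp (raise p j) =
      (P.reflection j).toLinearMap.toAddMonoidHom.comp (weightSum b (affineFun α β γ)) +
      (((β - α * p.r j : ℤ) : R) • (P.coroot' j).smulRight (P.root j)).toAddMonoidHom.comp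
        (weightSum b (affineFun 0 0 1)) := by
    refine yMonomial_hom_ext fun k x y => ?_
    simp only [AddMonoidHom.comp_apply, AddMonoidHom.add_apply, raise_yMon, map_sub,
      LinearMap.toAddMonoidHom_coe, LinearEquiv.coe_coe, LinearMap.smul_apply,
      LinearMap.smulRight_apply, RootPairing.reflection_apply]
    by_cases hk : k = j
    · subst hk
      rw [if_pos rfl, weightSum_aMon b p hC]
      simp only [weightSum, monHom_yMon, map_zsmul, b.coroot'_fundWeight, if_true, affineFun]
      simp only [← Int.cast_smul_eq_zsmul R, smul_eq_mul]
      push_cast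
      module
    · have hk' : ¬ j = k := fun h => hk h.symm
      simp only [hk, hk', if_false, map_zero, sub_zero, weightSum, monHom_yMon, map_zsmul,
        b.coroot'_fundWeight, smul_zero, zero_smul, add_zero]
  have h1 := DFunLike.congr_fun h e
  simp only [AddMonoidHom.comp_apply, AddMonoidHom.add_apply,
      LinearMap.toAddMonoidHom_coe, LinearEquiv.coe_coe, LinearMap.smul_apply,
      LinearMap.smulRight_apply, smul_smul] at h1
  exact h1

/-- The number of factors `Y_j`. -/
def degree (j : b.support) : YMonomial b.support →+ ℤ := monHom fun s => if s.1 = j then 1 else 0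

theorem coroot'_weightSum (j : b.support) (e : YMonomial b.support) :
    P.coroot' j (weightSum b (affineFun 0 0 1) e) = degree b j e := by
  have h : (P.coroot' j).toAddMonoidHom.comp (weightSum b (affineFun 0 0 1)) =
      (Int.castAddHom R).comp (degree b j) := by
    refine yMonomial_hom_ext fun k x y => ?_
    simp [weightSum, degree, affineFun, b.coroot'_fundWeight, eq_comm]
  exact DFunLike.congr_fun h e

variable {b}

theorem IsAntidom.degree_nonpos {j : b.support} {e : YMonomial b.support} (h : IsAntidom j e) :
    degree b j e ≤ 0 := by
  rw [degree, monHom_apply]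
  refine Finset.sum_nonpos fun s _ => ?_
  dsimp only
  split_ifs with hs
  · subst hs
    simpa using h s.2
  · simp

theorem IsAntidom.degree_neg {j : b.support} {e : YMonomial b.support} (h : IsAntidom j e)
    (h' : ¬ IsDom j e) : degree b j e < 0 := by
  rw [IsDom] at h'
  push Not at h'
  obtain ⟨u, hu⟩ := h'
  rw [degree, monHom_apply]
  refine Finset.sum_neg' (fun s _ => ?_) ⟨(j, u), Finsupp.mem_support_iff.2 hu.ne, by simpa using hu⟩
  dsimp only
  split_ifs with hs
  · subst hs
    simpa using h s.2
  · simp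

theorem isDominant_neg_weightSum {e : YMonomial b.support} (h : ∀ j, IsAntidom j e) :
    b.IsDominant (-weightSum b (affineFun 0 0 1) e) := by
  intro j hj
  refine ⟨(-degree b ⟨j, hj⟩ e).toNat, ?_⟩
  have h1 := coroot'_weightSum b ⟨j, hj⟩ e
  have h2 := (h ⟨j, hj⟩).degree_nonpos
  simp only at h1
  rw [map_neg, h1, ← Int.cast_neg, ← Int.cast_natCast, Int.toNat_of_nonneg (by omega)]

/-- Raising an antidominant monomial tracks a word in the Weyl group. -/
theorem Reach.exists_word {p : Params b.support} (hC : p.C = b.cartanMatrix.transpose)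
    [DecidablePred b.IsPos] {e x : YMonomial b.support} (he : ∀ j, IsAntidom j e)
    (hx : Reach p e x) :
    ∃ L : List b.support,
      weightSum b (affineFun 0 0 1) x = b.wordRefl L (weightSum b (affineFun 0 0 1) e) ∧
      ∀ (α β : ℤ) (c : ι → R), (∀ i j, c (P.reflectionPerm j i) = c i) →
        (∀ j : b.support, c j = ((β - α * p.r j : ℤ) : R)) →
        weightSum b (affineFun α β 0) x = b.wordRefl L (weightSum b (affineFun α β 0) e -
          ∑ i ∈ b.posRoots with ¬ b.IsPos (b.wordPerm L i),
            (c i * P.coroot' i (weightSum b (affineFun 0 0 1) e)) • P.root i) := by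
  induction hx with
  | refl =>
    refine ⟨[], rfl, fun α β c _ _ => ?_⟩
    rw [RootPairing.Base.wordRefl_nil, Finset.sum_eq_zero, sub_zero]
    intro i hi
    rw [Finset.mem_filter, b.mem_posRoots] at hi
    simp [hi.1] at hi
  | step j x hx hj ih =>
    by_cases hd : IsDom j x
    · rw [raise_eq_self p hj hd]
      exact ih
    obtain ⟨L, hL, hL'⟩ := ih
    refine ⟨j :: L, ?_, fun α β c hc hcj => ?_⟩
    · rw [weightSum_raise b p hC, RootPairing.Base.wordRefl_cons, hL]
      simp
    · have hneg := hj.degree_neg hd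
      -- The step is a genuine one, so `(w λ, α_j^∨) < 0`. With `-λ` dominant this makes `w⁻¹ α_j`
      -- positive, so the new letter adds one inversion, whose term is the correction in
      -- `weightSum_raise`.
      have hpos : b.IsPos ((b.wordPerm L).symm j) := by
        refine b.isPos_wordPerm_symm L (isDominant_neg_weightSum he) j
          (n := (-degree b j x).toNat) (by omega) ?_
        rw [← hL, coroot'_weightSum, ← Int.cast_natCast, Int.toNat_of_nonneg (by omega)]
        simp
      rw [weightSum_raise b p hC, hL' α β c hc hcj, map_sub (b.wordRefl (j :: L)),
        b.sum_inversions_cons hc L _ j hpos, RootPairing.Base.wordRefl_cons, ← hL,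
        map_sub (b.wordRefl L), map_sub (P.reflection j), hcj]
      abel

/-- The weight fixes the total exponent as `-1`, while each factor that occurs contributes at most
`-1`: there is just one factor. -/
theorem isAntidom_eq_neg_yMon {e : YMonomial b.support} (he : ∀ j, IsAntidom j e)
    {k : b.support} (h : weightSum b (affineFun 0 0 1) e = -b.fundWeight k) :
    ∃ x y, e = -yMon k x y := by
  have hdeg : ∀ j, degree b j e = if j = k then -1 else 0 := by
    intro j
    have h1 := coroot'_weightSum b j e
    rw [h, map_neg, b.coroot'_fundWeight] at h1
    split_ifs at h1 ⊢ <;> exact_mod_cast h1.symm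
  have htot : ∑ s ∈ e.support, e s = -1 := by
    have h1 : ∑ j, degree b j e = ∑ s ∈ e.support, e s := by
      simp only [degree, monHom_apply, Finsupp.sum]
      rw [Finset.sum_comm]
      refine Finset.sum_congr rfl fun s _ => ?_
      simp
    rw [← h1]
    simp [hdeg]
  have hle : ∀ s ∈ e.support, e s ≤ -1 := by
    intro s hs
    have h1 := he s.1 s.2
    have h2 := Finsupp.mem_support_iff.1 hs
    have h3 : e s ≤ 0 := h1
    omega
  have hcard : e.support.card = 1 := by
    have h1 := Finset.sum_le_card_nsmul _ _ _ hle
    rw [htot] at h1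
    have h2 : e.support.card ≠ 0 := by
      intro h0
      rw [Finset.card_eq_zero.1 h0] at htot
      simp at htot
    simp only [nsmul_eq_mul] at h1
    omega
  obtain ⟨s, hs⟩ := Finset.card_eq_one.1 hcard
  rw [hs, Finset.sum_singleton] at htot
  have h3 : e = -yMon s.1 s.2.1 s.2.2 := by
    rw [yMon, ← Finsupp.single_neg, ← htot]
    exact Finsupp.eq_single_iff.2 ⟨hs.le, rfl⟩
  refine ⟨s.2.1, s.2.2, ?_⟩
  rw [h3, map_neg, weightSum, monHom_yMon, neg_inj] at h
  have h4 : s.1 = k := b.fundWeight_injective (by simpa [affineFun] using h)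
  rw [h3, h4]

end

end DeformedW

/-! ### The flip of monomials and of blocks -/

namespace DeformedW

section Flip

variable {I : Type*} [DecidableEq I]

/-- The involution `Y_j(z q^a t^b) ↦ Y_j(z q^{-a-H} t^{-b+h})^{-1}` of monomials. -/
def flipMon (H h : ℤ) : YMonomial I →+ YMonomial I :=
  monHom fun s => -yMon s.1 (-s.2.1 - H) (-s.2.2 + h)

@[simp] theorem flipMon_yMon (H h : ℤ) (j : I) (a b : ℤ) :
    flipMon H h (yMon j a b) = -yMon j (-a - H) (-b + h) := by
  simp [flipMon]

theorem flipMon_flipMon (H h : ℤ) (e : YMonomial I) : flipMon H h (flipMon H h e) = e := by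
  have h1 : (flipMon H h).comp (flipMon H h) = AddMonoidHom.id (YMonomial I) := by
    refine yMonomial_hom_ext fun j a b => ?_
    simp only [AddMonoidHom.comp_apply, flipMon_yMon, map_neg, neg_neg, AddMonoidHom.id_apply]
    congr 1 <;> ring
  exact DFunLike.congr_fun h1 e

theorem flipMon_injective (H h : ℤ) : Function.Injective (flipMon H h : YMonomial I → YMonomial I) :=
  Function.LeftInverse.injective (flipMon_flipMon H h)

theorem mapDomain_flipMon_apply (H h : ℤ) (c : YMonomial I →₀ ℂ) (e : YMonomial I) :
    c.mapDomain (flipMon H h) e = c (flipMon H h e) := by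
  conv_lhs => rw [← flipMon_flipMon H h e]
  exact Finsupp.mapDomain_apply (flipMon_injective H h) c _

theorem flipMon_apply (H h : ℤ) (e : YMonomial I) (j : I) (a b : ℤ) :
    flipMon H h e (j, a, b) = -e (j, -a - H, -b + h) := by
  have h1 : (Finsupp.applyAddHom (j, a, b)).comp (flipMon H h) =
      -(Finsupp.applyAddHom (j, -a - H, -b + h) : YMonomial I →+ ℤ) := by
    refine yMonomial_hom_ext fun k a' b' => ?_
    rw [AddMonoidHom.comp_apply, flipMon_yMon]
    change (-yMon k (-a' - H) (-b' + h)) (j, a, b) = -yMon k a' b' (j, -a - H, -b + h)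
    rw [Finsupp.neg_apply, yMon_apply, yMon_apply]
    congr 2
    rw [eq_iff_iff]
    constructor <;> rintro ⟨h, h', h''⟩ <;> refine ⟨h, ?_, ?_⟩ <;> omega
  exact DFunLike.congr_fun h1 e

variable [Fintype I] (p : Params I)

theorem flipMon_aMon (H h : ℤ) (j : I) (a b : ℤ) :
    flipMon H h (aMon p j a b) = -aMon p j (-a - H) (-b + h) := by
  have hs : ∀ k, ∑ s ∈ Finset.range (p.inc k j),
      yMon k (-(a + ((p.inc k j : ℤ) - 1 - 2 * s)) - H) (-b + h) =
      ∑ s ∈ Finset.range (p.inc k j), yMon k (-a - H + ((p.inc k j : ℤ) - 1 - 2 * s)) (-b + h) := by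
    intro k
    rw [← Finset.sum_range_reflect]
    refine Finset.sum_congr rfl fun s hs => ?_
    have hs' : s < p.inc k j := Finset.mem_range.1 hs
    congr 1
    rw [Nat.sub_sub, Nat.cast_sub (by omega)]
    push_cast
    ring
  simp only [aMon, map_sub, map_add, map_sum, flipMon_yMon, Finset.sum_neg_distrib, hs]
  have h1 : -(a - p.r j) - H = -a - H + p.r j := by ring
  have h2 : -(a + p.r j) - H = -a - H - p.r j := by ring
  have h3 : -(b + 1) + h = -b + h - 1 := by ring
  have h4 : -(b - 1) + h = -b + h + 1 := by ring
  rw [h1, h2, h3, h4]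
  abel

/-- The involution of the parameters of a block which accompanies `flipMon`. -/
def flipParam (H h : ℤ) (j : I) (u : ℤ × ℤ) : ℤ × ℤ :=
  (-u.1 + 2 * p.r j - H, -u.2 - 2 + h)

theorem flipParam_flipParam (H h : ℤ) (j : I) (u : ℤ × ℤ) :
    flipParam p H h j (flipParam p H h j u) = u := by
  simp only [flipParam]
  ext <;> dsimp only <;> ring

theorem flipParam_injective (H h : ℤ) (j : I) : Function.Injective (flipParam p H h j) :=
  Function.LeftInverse.injective (flipParam_flipParam p H h j)

theorem RegularParams.image_flipParam {j : I} {S : Finset (ℤ × ℤ)} (hS : RegularParams p j S)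
    (H h : ℤ) : RegularParams p j (S.image (flipParam p H h j)) := by
  intro u hu v hv
  obtain ⟨u, hu', rfl⟩ := Finset.mem_image.1 hu
  obtain ⟨v, hv', rfl⟩ := Finset.mem_image.1 hv
  have h1 := hS v hv' u hu'
  intro h2
  apply h1
  simp only [flipParam, Prod.mk.injEq] at h2 ⊢
  constructor <;> linarith

/-- Two reversals cancel: the flip inverts the ratio of two parameters, and complementing `M`
exchanges numerator and denominator. -/
theorem gammaCoef_image_flipParam (H h : ℤ) (j : I) {S M : Finset (ℤ × ℤ)} (hM : M ⊆ S) :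
    gammaCoef p j (S.image (flipParam p H h j)) ((S \ M).image (flipParam p H h j)) =
      gammaCoef p j S M := by
  have hinj := flipParam_injective p H h j
  rw [gammaCoef, gammaCoef, ← Finset.image_sdiff _ _ hinj, Finset.sdiff_sdiff_eq_self hM]
  simp only [Finset.prod_image hinj.injOn]
  rw [Finset.prod_comm]
  refine Finset.prod_congr rfl fun u _ => Finset.prod_congr rfl fun v _ => ?_
  simp only [flipParam]
  congr 2 <;> push_cast <;> ring

/-- The part of `Y_j(z q^a t^b) A_j(z q^{a-r_j} t^{b+1})^{-1}` not involving `Y_j`. -/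
def restMon (j : I) (u : ℤ × ℤ) : YMonomial I :=
  yMon j u.1 u.2 - aMon p j (u.1 - p.r j) (u.2 + 1) + yMon j (u.1 - 2 * p.r j) (u.2 + 2)

theorem restMon_apply_self (j : I) (u : ℤ × ℤ) (a b : ℤ) : restMon p j u (j, a, b) = 0 := by
  rw [restMon, Finsupp.add_apply, Finsupp.sub_apply, aMon_apply_self]
  have h1 : u.1 - p.r j - p.r j = u.1 - 2 * (p.r j : ℤ) := by ring
  have h2 : u.2 + 1 + 1 = u.2 + 2 := by ring
  rw [h1, h2, sub_add_cancel, add_sub_cancel_right]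
  ring

/-- The flip turns the `Y_j` part of `Y_j^{(-)}(u)`, namely `Y_j(u q^{-2 r_j} t^2)^{-1}`, into `Y_j`
at the flipped parameter, so plus and minus signs are exchanged. The factors `Y_k` with `k ≠ j` of
all the `Y_j^{(-)}(u)` are moved into the new `N`. -/
theorem flipMon_blockMon (H h : ℤ) (j : I) (N : YMonomial I) {S M : Finset (ℤ × ℤ)} (hM : M ⊆ S) :
    flipMon H h (blockMon p j N S M) =
      blockMon p j (flipMon H h (N + ∑ u ∈ S, restMon p j u)) (S.image (flipParam p H h j))
        ((S \ M).image (flipParam p H h j)) := by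
  have hinj := flipParam_injective p H h j
  have h1 : ∀ u : ℤ × ℤ, yMon j (flipParam p H h j u).1 (flipParam p H h j u).2 =
      -flipMon H h (yMon j (u.1 - 2 * p.r j) (u.2 + 2)) := by
    intro u
    rw [flipMon_yMon, neg_neg]
    simp only [flipParam]
    congr 1 <;> ring
  have h2 : ∀ u : ℤ × ℤ, aMon p j ((flipParam p H h j u).1 - p.r j) ((flipParam p H h j u).2 + 1) =
      -flipMon H h (aMon p j (u.1 - p.r j) (u.2 + 1)) := by
    intro u
    rw [flipMon_aMon, neg_neg]
    simp only [flipParam]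
    congr 1 <;> ring
  rw [blockMon, blockMon, Finset.sum_image hinj.injOn, Finset.sum_image hinj.injOn]
  simp only [h1, h2, ← map_sum, ← map_neg, Finset.sum_neg_distrib, ← map_add, ← map_sub]
  congr 1
  simp only [restMon, Finset.sum_add_distrib, Finset.sum_sub_distrib]
  rw [← Finset.sum_sdiff hM (f := fun u => aMon p j (u.1 - p.r j) (u.2 + 1))]
  abel

theorem mapDomain_sl2Block (H h : ℤ) (j : I) (N : YMonomial I) (S : Finset (ℤ × ℤ)) :
    (sl2Block p j N S).mapDomain (flipMon H h) =
      sl2Block p j (flipMon H h (N + ∑ u ∈ S, restMon p j u)) (S.image (flipParam p H h j)) := by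
  have hinj := flipParam_injective p H h j
  rw [sl2Block, sl2Block, Finsupp.mapDomain_finsetSum]
  refine Finset.sum_bij (fun M _ => (S \ M).image (flipParam p H h j)) ?_ ?_ ?_ ?_
  · intro M _
    exact Finset.mem_powerset.2 (Finset.image_subset_image Finset.sdiff_subset)
  · intro M hM M' hM' heq
    have h1 := Finset.image_injective hinj heq
    rw [← Finset.sdiff_sdiff_eq_self (Finset.mem_powerset.1 hM), h1,
      Finset.sdiff_sdiff_eq_self (Finset.mem_powerset.1 hM')]
  · intro M' hM'
    obtain ⟨M, hM, rfl⟩ := Finset.subset_image_iff.1 (Finset.mem_powerset.1 hM')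
    exact ⟨S \ M, Finset.mem_powerset.2 Finset.sdiff_subset, by
      rw [Finset.sdiff_sdiff_eq_self (by exact_mod_cast hM)]⟩
  · intro M hM
    have hM' := Finset.mem_powerset.1 hM
    rw [Finsupp.mapDomain_single, gammaCoef_image_flipParam p H h j hM']
    congr 1
    exact flipMon_blockMon p H h j N hM'

theorem mapDomain_mem_span (H h : ℤ) {j : I} {d : YMonomial I →₀ ℂ}
    (hd : d ∈ Submodule.span ℂ (sl2Blocks p j)) :
    d.mapDomain (flipMon H h) ∈ Submodule.span ℂ (sl2Blocks p j) := by
  have h1 : Submodule.span ℂ (sl2Blocks p j) ≤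
      (Submodule.span ℂ (sl2Blocks p j)).comap (Finsupp.lmapDomain ℂ ℂ (flipMon H h)) := by
    rw [Submodule.span_le]
    rintro _ ⟨N, S, hN, hS, rfl⟩
    refine Submodule.subset_span ⟨_, _, ?_, hS.image_flipParam p H h, mapDomain_sl2Block p H h j N S⟩
    intro a b
    rw [flipMon_apply, Finsupp.add_apply, hN, Finsupp.finsetSum_apply]
    simp [restMon_apply_self]
  exact h1 hd

end Flip

/-! ### The antidominant monomial, and comparison of pasted combinations -/

section Polygons

variable {ι R M N : Type*} [Finite ι] [DecidableEq ι] [Field R] [CharZero R]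
  [AddCommGroup M] [Module R M] [AddCommGroup N] [Module R N]
  {P : RootPairing ι R M N} [P.IsRootSystem] [P.IsCrystallographic] [P.IsReduced]
  [P.IsIrreducible] {b : P.Base} {p : Params b.support}

theorem isPolygon_of_pairing_eq_two (hC : p.C = b.cartanMatrix.transpose) {j k : b.support}
    (hjk : j ≠ k) (h1 : P.pairingIn ℤ k j = -2) (h2 : P.pairingIn ℤ j k = -1) (h3 : p.r j = 1)
    (h4 : p.r k = 2) : IsPolygon p j k 4 := by
  have hin := inc_eq b p hC hjk
  have hin' := inc_eq b p hC hjk.symm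
  have e1 : p.inc k j = 1 := by omega
  have e2 : p.inc j k = 2 := by omega
  have hk : lG p k = lmono (1, 0) * lG p j := by
    rw [lG, lG, h3, h4, lmono_mul]
    rfl
  refine isPolygon_of_double p hjk (lG_mem p j) (lmono_mem (1, 0)) rfl hk ?_ ?_
  · rw [e1, lqInt_one, mul_one]
  · rw [e2, hk]
    linear_combination lG p j * lmono_mul_lqInt_two

theorem isPolygon_of_pairing_eq_three (hC : p.C = b.cartanMatrix.transpose) {j k : b.support}
    (hjk : j ≠ k) (h1 : P.pairingIn ℤ k j = -3) (h2 : P.pairingIn ℤ j k = -1) (h3 : p.r j = 1)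
    (h4 : p.r k = 3) : IsPolygon p j k 6 := by
  have hin := inc_eq b p hC hjk
  have hin' := inc_eq b p hC hjk.symm
  have e1 : p.inc k j = 1 := by omega
  have e2 : p.inc j k = 3 := by omega
  have hk : lG p k = lmono (1, 0) ^ 2 * lG p j := by
    rw [lG, lG, h3, h4, pow_two, lmono_mul, lmono_mul]
    rfl
  refine isPolygon_of_triple p hjk (lG_mem p j) (lmono_mem (1, 0)) rfl hk ?_ ?_
  · rw [e1, lqInt_one, mul_one]
  · rw [e2, hk]
    linear_combination lG p j * lmono_mul_lqInt_three

theorem exists_isPolygon (hC : p.C = b.cartanMatrix.transpose) (hr : p.IsSymmetrizer)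
    {j k : b.support} (hjk : j ≠ k) : ∃ m, IsPolygon p j k m := by
  have hsym : ∀ j k : b.support,
      (p.r j : ℤ) * P.pairingIn ℤ k j = (p.r k : ℤ) * P.pairingIn ℤ j k := by
    intro j k
    have h := hr.2.1 j k
    rw [hC] at h
    exact h
  have hin := inc_eq b p hC hjk
  have hin' := inc_eq b p hC hjk.symm
  rcases b.symmetrizer_pairing_cases p.r hr.1 hsym hr.2.2 hjk with h | h | h | h | h | h
  · refine ⟨2, isPolygon_of_inc_eq_zero p hjk rfl rfl ?_ ?_⟩
    · have e1 : p.inc k j = 0 := by omega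
      rw [e1, lqInt_zero, mul_zero]
    · have e2 : p.inc j k = 0 := by omega
      rw [e2, lqInt_zero, mul_zero]
  · have hk : lG p k = lG p j := by rw [lG, lG, h.2.2]
    refine ⟨3, isPolygon_of_simply_laced p hjk (lG_mem p j) rfl hk ?_ ?_⟩
    · have e1 : p.inc k j = 1 := by omega
      rw [e1, lqInt_one, mul_one]
    · have e2 : p.inc j k = 1 := by omega
      rw [e2, lqInt_one, mul_one, hk]
  · exact ⟨4, isPolygon_of_pairing_eq_two hC hjk h.1 h.2.1 h.2.2.1 h.2.2.2⟩
  · exact ⟨4, (isPolygon_of_pairing_eq_two hC hjk.symm h.2.1 h.1 h.2.2.2 h.2.2.1).symm⟩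
  · exact ⟨6, isPolygon_of_pairing_eq_three hC hjk h.1 h.2.1 h.2.2.1 h.2.2.2⟩
  · exact ⟨6, (isPolygon_of_pairing_eq_three hC hjk.symm h.2.1 h.1 h.2.2.2 h.2.2.1).symm⟩

/-- In a pasted combination with top monomial `Y_i(z)` the only antidominant monomial is
`Y_{star i}(z q^{-H} t^h)^{-1}`. -/
theorem IsPasted.eq_of_isAntidom (hC : p.C = b.cartanMatrix.transpose) (hr : p.IsSymmetrizer)
    {θ : ι} (hθ : ∀ k, b.height k ≤ b.height θ) {star : b.support → b.support}
    (hstar : ∃ w : P.weylGroup, ∀ i : b.support, w • P.root i = -P.root (star i))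
    {i : b.support} {c : YMonomial b.support →₀ ℂ} (hc : IsPasted p i c)
    {e : YMonomial b.support} (hce : c e ≠ 0) (he : ∀ j, IsAntidom j e) :
    e = -yMon (star i) (-((p.rcheck : ℤ) * (1 + b.flip.height θ))) (1 + b.height θ) ∧
      c (yMon i 0 0) = c e := by
  classical
  have hsym : ∀ j k : b.support,
      (p.r j : ℤ) * P.pairingIn ℤ k j = (p.r k : ℤ) * P.pairingIn ℤ j k := by
    intro j k
    have h := hr.2.1 j k
    rw [hC] at h
    exact h
  have hpoly : ∀ j k : b.support, j ≠ k → ∃ m, IsPolygon p j k m :=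
    fun j k hjk => exists_isPolygon hC hr hjk
  choose! mm hm using hpoly
  obtain ⟨hreach, htop⟩ := hc.reach_top hm hce he
  refine ⟨?_, htop⟩
  obtain ⟨L, hL, hL'⟩ := hreach.exists_word hC he
  have hdom := isDominant_neg_weightSum he
  have hY : ∀ α β γ, weightSum b (affineFun α β γ) (yMon i 0 0) = γ • b.fundWeight i := by
    intro α β γ
    simp [weightSum, affineFun]
  rw [hY, one_smul] at hL
  -- The end of the process, `Y_i(z)`, has both exponents zero, so its weighted sum vanishes for `γ
  -- = 0`. The weighted sum of `e` thus equals the sum over inversions, which is the full `posSum`.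
  have hsum : ∀ (α β : ℤ) (c : ι → R), (∀ i j, c (P.reflectionPerm j i) = c i) →
      (∀ j : b.support, c j = ((β - α * p.r j : ℤ) : R)) →
      weightSum b (affineFun α β 0) e = b.posSum c (weightSum b (affineFun 0 0 1) e) := by
    intro α β c h1 h2
    have h3 := hL' α β c h1 h2
    rw [hY, zero_smul, b.sum_inversions_eq_posSum c L hdom (by
      rw [← hL]
      exact b.isDominant_fundWeight i), eq_comm, LinearEquiv.map_eq_zero_iff, sub_eq_zero] at h3
    exact h3
  obtain ⟨w, hw⟩ := hstar
  obtain ⟨W, hW⟩ := b.exists_word w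
  have hstar' := b.smul_fundWeight (L := W) (fun i => by rw [← hW, hw]) i
  -- The weights `-λ` and `ω_{i*}` are dominant and lie in one orbit, through the word `W ++ L`.
  have hlam : weightSum b (affineFun 0 0 1) e = -b.fundWeight (star i) := by
    have h1 : b.wordRefl (W ++ L) (-weightSum b (affineFun 0 0 1) e) = b.fundWeight (star i) := by
      rw [map_neg, RootPairing.Base.wordRefl_append, ← hL, hstar', neg_neg]
    have h2 := hdom.wordRefl_eq (W ++ L) (by
      rw [h1]
      exact b.isDominant_fundWeight _)
    rw [← neg_eq_iff_eq_neg, ← h2, h1]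
  obtain ⟨x, y, rfl⟩ := isAntidom_eq_neg_yMon he hlam
  have hw0 := b.fundWeight_ne_zero (star i)
  obtain ⟨c0, hc0, hc1, hc2, hc3⟩ := b.exists_symmetrizer_highest p.r hr.1 hsym hθ
  -- The choice `(α, β) = (0, 1)` reads off the exponent of `t`, with `c = 1`; the choice `(1, 0)`
  -- reads off that of `q`, with `c_j = -r_j`.
  have ht := hsum 0 1 (fun _ => 1) (fun _ _ => rfl) (fun j => by simp)
  have hq := hsum 1 0 (fun i => -c0 i) (fun i j => by rw [hc1]) (fun j => by simp [hc0])
  have hneg : b.posSum (fun i => -c0 i) (-b.fundWeight (star i)) =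
      b.posSum c0 (b.fundWeight (star i)) := by
    simp [RootPairing.Base.posSum_apply]
  rw [hlam, b.posSum_one hθ] at ht
  rw [hlam, hneg, b.posSum_of_symm hθ hc1 hc2, hc3] at hq
  have hy : y = 1 + b.height θ := by
    simp only [weightSum, affineFun, map_neg, monHom_yMon, zero_mul, one_mul, add_zero, zero_add,
      smul_neg, neg_inj, ← Int.cast_smul_eq_zsmul R] at ht
    exact_mod_cast smul_left_injective R hw0 ht
  have hx : x = -((p.rcheck : ℤ) * (1 + b.flip.height θ)) := by
    simp only [weightSum, affineFun, map_neg, monHom_yMon, zero_mul, one_mul, add_zero,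
      ← Int.cast_smul_eq_zsmul R, ← neg_smul] at hq
    have h1 := smul_left_injective R hw0 hq
    rw [← Int.cast_natCast (R := R), ← Int.cast_mul, ← Int.cast_neg, Int.cast_inj] at h1
    rw [Params.rcheck, ← h1, neg_neg]
  rw [hx, hy]

/-- A monomial of minimal level lies at the bottom of its block in every direction. -/
theorem IsPasted.exists_isAntidom {I : Type*} [DecidableEq I] [Fintype I] {p : Params I} {i : I}
    {c : YMonomial I →₀ ℂ} (hc : IsPasted p i c)
    (hne : c ≠ 0) : ∃ e, c e ≠ 0 ∧ ∀ j, IsAntidom j e := by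
  obtain ⟨e, he, hmin⟩ := c.support.exists_min_image (levelSum (bigLevel p))
    (Finsupp.support_nonempty_iff.2 hne)
  refine ⟨e, Finsupp.mem_support_iff.1 he, fun j => ?_⟩
  exact nonpos_of_forall_le_levelSum p (hc.1 j) (Finsupp.mem_support_iff.1 he)
    (fun e' he' => hmin e' (Finsupp.mem_support_iff.2 he'))

/-- The pasted combinations of the nodes `i` and `star i` are exchanged by `flipMon`. -/
theorem IsPasted.mapDomain_flipMon (hC : p.C = b.cartanMatrix.transpose) (hr : p.IsSymmetrizer)
    {θ : ι} (hθ : ∀ k, b.height k ≤ b.height θ) {star : b.support → b.support}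
    (hstar : ∃ w : P.weylGroup, ∀ i : b.support, w • P.root i = -P.root (star i))
    {i : b.support} {c c' : YMonomial b.support →₀ ℂ} (hc : IsPasted p i c)
    (hc1 : c (yMon i 0 0) = 1) (hc' : IsPasted p (star i) c') (hc1' : c' (yMon (star i) 0 0) = 1) :
    c.mapDomain (flipMon ((p.rcheck : ℤ) * (1 + b.flip.height θ)) (1 + b.height θ)) = c' := by
  set H : ℤ := (p.rcheck : ℤ) * (1 + b.flip.height θ)
  set h : ℤ := 1 + b.height θ
  have hflip : flipMon H h (yMon (star i) 0 0) = -yMon (star i) (-H) h := by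
    rw [flipMon_yMon]
    congr 2 <;> ring
  have hbot : c (-yMon (star i) (-H) h) = 1 := by
    obtain ⟨e, he, hanti⟩ := hc.exists_isAntidom (by
      rintro rfl
      simp at hc1)
    obtain ⟨rfl, h2⟩ := hc.eq_of_isAntidom hC hr hθ hstar he hanti
    rw [← h2, hc1]
  -- The difference is a combination of blocks in every direction, so only its dominant monomials
  -- matter. At `Y_{i*}(z)` both coefficients are one; at any other dominant monomial both vanish,
  -- the flipped one because it would be a second antidominant monomial of `c`.
  rw [← sub_eq_zero]
  refine eq_zero_of_forall_not_isDominantMon p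
    (fun j => sub_mem (mapDomain_mem_span p H h (hc.1 j)) (hc'.1 j)) fun e he => ?_
  rw [Finsupp.sub_apply, mapDomain_flipMon_apply]
  by_cases hes : e = yMon (star i) 0 0
  · rw [hes, hflip, hbot, hc1', sub_self]
  · have h1 : c' e = 0 := by
      by_contra hne
      exact hes (hc'.eq_of_isDominantMon (Finsupp.mem_support_iff.2 hne) he)
    have h2 : c (flipMon H h e) = 0 := by
      by_contra hne
      have h3 := (hc.eq_of_isAntidom hC hr hθ hstar hne (fun j u => by
        rw [flipMon_apply]
        exact neg_nonpos.2 (he _))).1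
      rw [← hflip] at h3
      exact hes (flipMon_injective H h h3)
    rw [h1, h2, sub_self]

end Polygons

end DeformedW

namespace DeformedW

/-! ### The anti-involution on fields -/

/-- Reversing the order of multiplication is harmless for powers of a single series, even with
noncommuting coefficients: `F ^ n * F` is matched with `G * G ^ n`. -/
theorem coeff_pow_antihom {A : Type*} [Ring A] [Algebra ℂ A] (φ : A →ₗ[ℂ] A) (h1 : φ 1 = 1)
    (hmul : ∀ u v, φ (u * v) = φ v * φ u) {C : ℂ} {F G : PowerSeries A}
    (hFG : ∀ k, φ (PowerSeries.coeff k F) = C ^ k • PowerSeries.coeff k G) (n k : ℕ) :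
    φ (PowerSeries.coeff k (F ^ n)) = C ^ k • PowerSeries.coeff k (G ^ n) := by
  induction n generalizing k with
  | zero =>
    rw [pow_zero, pow_zero, PowerSeries.coeff_one]
    split_ifs with hk
    · rw [hk, h1, pow_zero, one_smul]
    · rw [map_zero, smul_zero]
  | succ n ih =>
    rw [pow_succ, pow_succ', PowerSeries.coeff_mul, PowerSeries.coeff_mul, map_sum,
      Finset.smul_sum, ← Finset.Nat.sum_antidiagonal_swap]
    refine Finset.sum_congr rfl fun x hx => ?_
    have hk : x.2 + x.1 = k := (add_comm _ _).trans (Finset.HasAntidiagonal.mem_antidiagonal.1 hx)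
    simp only [Prod.fst_swap, Prod.snd_swap]
    rw [hmul, ih, hFG, smul_mul_smul_comm, ← pow_add, add_comm, hk]

theorem expPart_antihom {A : Type*} [Ring A] [Algebra ℂ A] (φ : A →ₗ[ℂ] A) (h1 : φ 1 = 1)
    (hmul : ∀ u v, φ (u * v) = φ v * φ u) {C : ℂ} {f g : ℕ → A}
    (hfg : ∀ n, n ≠ 0 → φ (f n) = C ^ n • g n) (k : ℕ) :
    φ (expPart f k) = C ^ k • expPart g k := by
  rw [expPart, expPart, map_sum, Finset.smul_sum]
  refine Finset.sum_congr rfl fun n _ => ?_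
  rw [map_smul, smul_comm (C ^ k)]
  congr 1
  refine coeff_pow_antihom φ h1 hmul (fun m => ?_) n k
  rw [PowerSeries.coeff_mk, PowerSeries.coeff_mk]
  split_ifs with hm
  · rw [map_zero, smul_zero]
  · exact hfg m hm

namespace Params

variable {I : Type*} (p : Params I)

theorem qt_ne_zero (x y : ℂ) : p.qt x y ≠ 0 := Complex.exp_ne_zero _

theorem qt_add (x y x' y' : ℂ) : p.qt (x + x') (y + y') = p.qt x y * p.qt x' y' := by
  rw [qt, qt, qt, ← Complex.exp_add]
  congr 1
  ring

end Params

variable {I : Type*} [DecidableEq I] [Fintype I] (p : Params I)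

namespace Heis

/-- The anti-involution as a linear map. -/
def omegaLin (x y : ℂ) : Heis p →ₗ[ℂ] Heis p :=
  (MulOpposite.opLinearEquiv ℂ).symm.toLinearMap ∘ₗ (omegaOp p x y).toLinearMap

theorem omega_eq_omegaLin (x y : ℂ) (u : Heis p) : omega p x y u = omegaLin p x y u := rfl

theorem omegaLin_one (x y : ℂ) : omegaLin p x y 1 = 1 := by
  simp [omegaLin]

theorem omegaLin_mul (x y : ℂ) (u v : Heis p) :
    omegaLin p x y (u * v) = omegaLin p x y v * omegaLin p x y u := omega_mul p x y u v

theorem omegaLin_a (x y : ℂ) (i : I) {m : ℤ} (hm : m ≠ 0) :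
    omegaLin p x y (a p i m) = -(p.qt x y ^ m) • a p i (-m) := by
  have h : omegaOp p x y (a p i m) = omegaGen p x y (Gen.a i m) := omegaOp_gen p x y _
  rw [← omega_eq_omegaLin, omega, h, omegaGen, if_neg hm, MulOpposite.unop_op, neg_smul]

theorem omegaLin_K (x y : ℂ) (u : I → ℤ) : omegaLin p x y (K p u) =
    p.qt (4 * ∑ i, (u i : ℂ) * p.rhoOmega i) (-4 * ∑ i, (u i : ℂ) * p.rhoCheckOmega i) •
      K p (-u) := by
  have h : omegaOp p x y (K p u) = omegaGen p x y (Gen.K u) := omegaOp_gen p x y _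
  rw [← omega_eq_omegaLin, omega, h, omegaGen, MulOpposite.unop_op]

/-- The `y` modes transform like the `a` modes because the deformed Cartan matrix is unchanged when
both parameters are inverted. -/
theorem omegaLin_y (x y : ℂ) (i : I) {m : ℤ} (hm : m ≠ 0) :
    omegaLin p x y (Heis.y p i m) = -(p.qt x y ^ m) • Heis.y p i (-m) := by
  have h1 : p.qt ((-m : ℤ) : ℂ) 0 = (p.qt m 0)⁻¹ := by
    rw [← p.qt_neg, neg_zero, Int.cast_neg]
  have h2 : p.qt 0 ((-m : ℤ) : ℂ) = (p.qt 0 m)⁻¹ := by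
    rw [← p.qt_neg, neg_zero, Int.cast_neg]
  rw [Heis.y, Heis.y, map_sum, Finset.smul_sum, h1, h2, p.Cdef_inv]
  refine Finset.sum_congr rfl fun j _ => ?_
  rw [map_smul, omegaLin_a p x y j hm, smul_comm]

end Heis

/-- The modes of the exponent of a monomial. -/
def modeOf (m : ℤ) : YMonomial I →+ Heis p :=
  monHom fun s => p.qt s.2.1 s.2.2 ^ (-m) • Heis.y p s.1 m

/-- The exponents of the zero mode factor of a monomial. -/
def zeroModeOf : YMonomial I →+ (I → ℤ) := monHom fun s => Pi.single s.1 1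

/-- With the data of a monomial written through additive homomorphisms, the effect of the flip need
only be checked on single factors. -/
theorem vertex_eq (e : YMonomial I) : vertex p e = normalExp p
    (p.qt (-2 * ∑ i, (zeroModeOf e i : ℂ) * p.rhoOmega i)
        (2 * ∑ i, (zeroModeOf e i : ℂ) * p.rhoCheckOmega i) • Heis.K p (zeroModeOf e))
    (fun m => modeOf p m e) := by
  have h1 : ∀ (c : ℂ) (f : I → ℂ), e.sum (fun s n => (n : ℂ) * (c * f s.1)) =
      c * ∑ i, (zeroModeOf e i : ℂ) * f i := by
    intro c f
    have h : monHom (fun s : I × ℤ × ℤ => c * f s.1) =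
        (AddMonoidHom.mulLeft c).comp (∑ i, ((AddMonoidHom.mulRight (f i)).comp
          (Int.castAddHom ℂ)).comp ((Pi.evalAddMonoidHom (fun _ : I => ℤ) i).comp zeroModeOf)) := by
      refine yMonomial_hom_ext fun j a b => ?_
      simp [zeroModeOf, Pi.single_apply]
    have h2 := DFunLike.congr_fun h e
    rw [monHom_apply] at h2
    simpa [AddMonoidHom.finsetSum_apply] using h2
  have h2 : e.sum (fun s n => Pi.single s.1 n) = (zeroModeOf e : I → ℤ) := by
    rw [zeroModeOf, monHom_apply]
    refine Finsupp.sum_congr fun s _ => ?_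
    ext j
    simp [Pi.single_apply]
  have h3 : ∀ m : ℤ, (e.sum fun s n => ((n : ℂ) * p.qt s.2.1 s.2.2 ^ (-m)) • Heis.y p s.1 m) =
      modeOf p m e := by
    intro m
    rw [modeOf, monHom_apply]
    refine Finsupp.sum_congr fun s _ => ?_
    rw [mul_smul, Int.cast_smul_eq_zsmul]
  rw [vertex, h1, h1, h2]
  simp only [h3]

theorem zeroModeOf_flipMon (H h : ℤ) (e : YMonomial I) :
    zeroModeOf (flipMon H h e) = -zeroModeOf e := by
  have h1 : (zeroModeOf (I := I)).comp (flipMon H h) = -zeroModeOf := by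
    refine yMonomial_hom_ext fun j a b => ?_
    simp [zeroModeOf]
  exact DFunLike.congr_fun h1 e

/-- The sign in `ω` is the inversion of the factor, and `m ↦ -m` inverts its parameter. The shift by
`H` and `h` is free: it is compensated by the constant `q^{x+H} t^{y-h}`. -/
theorem omegaLin_modeOf (x y : ℂ) (H h : ℤ) {m : ℤ} (hm : m ≠ 0) (e : YMonomial I) :
    Heis.omegaLin p x y (modeOf p m e) =
      p.qt (x + H) (y - h) ^ m • modeOf p (-m) (flipMon H h e) := by
  have h1 : (Heis.omegaLin p x y).toAddMonoidHom.comp (modeOf p m) =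
      (p.qt (x + H) (y - h) ^ m • LinearMap.id (R := ℂ) (M := Heis p)).toAddMonoidHom.comp
        ((modeOf p (-m)).comp (flipMon H h)) := by
    refine yMonomial_hom_ext fun j a b => ?_
    have h3 : p.qt ((-a - H : ℤ) : ℂ) ((-b + h : ℤ) : ℂ) = (p.qt a b)⁻¹ * (p.qt H (-h))⁻¹ := by
      rw [← p.qt_neg, ← p.qt_neg, ← p.qt_add]
      push_cast
      congr 1
      ring
    simp only [AddMonoidHom.comp_apply, LinearMap.toAddMonoidHom_coe, modeOf, monHom_yMon, map_smul,
      flipMon_yMon, map_neg, LinearMap.smul_apply, LinearMap.id_apply, Heis.omegaLin_y p x y j hm,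
      smul_smul, smul_neg, neg_neg, neg_smul, h3]
    congr 2
    rw [sub_eq_add_neg, p.qt_add]
    simp only [mul_zpow, inv_zpow', zpow_neg]
    have h4 := zpow_ne_zero m (p.qt_ne_zero H (-h))
    field_simp
  exact DFunLike.congr_fun h1 e

theorem omegaField_vertex (x y : ℂ) (H h : ℤ) (e : YMonomial I) :
    omegaField p x y (vertex p e) =
      invert p (p.qt (x + H) (y - h)) (vertex p (flipMon H h e)) := by
  have hC := p.qt_ne_zero (x + H) (y - h)
  set C := p.qt (x + H) (y - h) with hCdef
  rw [vertex_eq, vertex_eq]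
  ext m kl
  change Heis.omegaLin p x y (normalExp p _ _ m (kl.2, kl.1)) =
    C ^ m • normalExp p _ _ (-m) kl
  simp only [normalExp]
  -- Reversal of products turns the annihilation part into the creation part and conversely, so
  -- normal ordering is preserved and the two degrees are exchanged.
  have h1 : Heis.omegaLin p x y (expPart (fun n => modeOf p n e) kl.1) =
      C ^ kl.1 • expPart (fun n => modeOf p (-(n : ℤ)) (flipMon H h e)) kl.1 := by
    refine expPart_antihom _ (Heis.omegaLin_one p x y) (Heis.omegaLin_mul p x y) (fun n hn => ?_) _
    rw [omegaLin_modeOf p x y H h (by exact_mod_cast hn), zpow_natCast]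
  have h2 : Heis.omegaLin p x y (expPart (fun n => modeOf p (-(n : ℤ)) e) kl.2) =
      C⁻¹ ^ kl.2 • expPart (fun n => modeOf p n (flipMon H h e)) kl.2 := by
    refine expPart_antihom _ (Heis.omegaLin_one p x y) (Heis.omegaLin_mul p x y) (fun n hn => ?_) _
    rw [omegaLin_modeOf p x y H h (by simpa using hn), neg_neg, zpow_neg, zpow_natCast, inv_pow]
  -- The constants in `ω` on zero modes are made for this: `-2 + 4 = 2` for `ρ` and `2 - 4 = -2` for
  -- `ρ^∨`, so the prefactor of the monomial becomes that of its inverse.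
  have h3 : Heis.omegaLin p x y (p.qt (-2 * ∑ i, (zeroModeOf e i : ℂ) * p.rhoOmega i)
        (2 * ∑ i, (zeroModeOf e i : ℂ) * p.rhoCheckOmega i) • Heis.K p (zeroModeOf e)) =
      p.qt (-2 * ∑ i, (zeroModeOf (flipMon H h e) i : ℂ) * p.rhoOmega i)
        (2 * ∑ i, (zeroModeOf (flipMon H h e) i : ℂ) * p.rhoCheckOmega i) •
          Heis.K p (zeroModeOf (flipMon H h e)) := by
    rw [zeroModeOf_flipMon, map_smul, Heis.omegaLin_K, smul_smul, ← p.qt_add]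
    simp only [Pi.neg_apply, Int.cast_neg, neg_mul, Finset.sum_neg_distrib]
    congr 2 <;> ring
  by_cases hm : (kl.1 : ℤ) - kl.2 = m
  · have hm' : (kl.2 : ℤ) - kl.1 = -m := by omega
    rw [if_pos hm, if_pos hm', Heis.omegaLin_mul, Heis.omegaLin_mul, h1, h2, h3, ← hm,
      zpow_sub₀ hC, zpow_natCast, zpow_natCast]
    simp only [smul_mul_assoc, mul_smul_comm, smul_smul, ← mul_assoc]
    rw [inv_pow, div_eq_mul_inv]
    congr 1
    ring
  · have hm' : ¬ (kl.2 : ℤ) - kl.1 = -m := by omega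
    rw [if_neg hm, if_neg hm', map_zero, smul_zero]

theorem omegaField_fieldOf (x y : ℂ) (H h : ℤ) (c : YMonomial I →₀ ℂ) :
    omegaField p x y (fieldOf p c) =
      invert p (p.qt (x + H) (y - h)) (fieldOf p (c.mapDomain (flipMon H h))) := by
  rw [fieldOf, fieldOf, Finsupp.sum_mapDomain_index_inj (flipMon_injective H h)]
  have h1 : ∀ (e : YMonomial I) (m : ℤ) (kl : ℕ × ℕ),
      Heis.omegaLin p x y (vertex p e m (kl.2, kl.1)) =
        p.qt (x + H) (y - h) ^ m • vertex p (flipMon H h e) (-m) kl := fun e m kl =>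
    congrFun (congrFun (omegaField_vertex p x y H h e) m) kl
  ext m kl
  change Heis.omegaLin p x y ((∑ e ∈ c.support, c e • vertex p e) m (kl.2, kl.1)) =
    p.qt (x + H) (y - h) ^ m • (∑ e ∈ c.support, c e • vertex p (flipMon H h e)) (-m) kl
  simp only [Finset.sum_apply, Pi.smul_apply, map_sum, map_smul, h1, Finset.smul_sum]
  exact Finset.sum_congr rfl fun e _ => smul_comm _ _ _

end DeformedW

end

/-- The simple Lie algebra enters through its irreducible reduced crystallographic root system
`P` with base `b`. `θ` is the highest root, so `h = 1 + height θ` is the Coxeter number and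
`h^∨ = 1 + height θ^∨` the dual Coxeter number. The involution `star` of the Dynkin diagram is the
one for which some (the longest) Weyl group element maps each `α_i` to `-α_{star i}`. -/
theorem lemma4p1 {ι R M N : Type*} [Finite ι] [DecidableEq ι] [Field R] [CharZero R]
    [AddCommGroup M] [Module R M] [AddCommGroup N] [Module R N]
    (P : RootPairing ι R M N) [P.IsRootSystem] [P.IsCrystallographic] [P.IsReduced]
    [P.IsIrreducible] (b : P.Base)
    (p : DeformedW.Params b.support) (hC : p.C = b.cartanMatrix.transpose)
    (hr : p.IsSymmetrizer) (hgen : p.Generic)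
    (θ : ι) (hθ : ∀ k, b.height k ≤ b.height θ)
    (star : b.support → b.support)
    (hstar : ∃ w : P.weylGroup, ∀ i : b.support, w • P.root i = -P.root (star i))
    (T : b.support → DeformedW.QField p) (i : b.support)
    (hT : DeformedW.IsGenerator p i (T i))
    (hT_star : DeformedW.IsGenerator p (star i) (T (star i))) :
    (∀ x y : ℂ, DeformedW.omegaField p x y (T i) =
      DeformedW.invert p
        (p.qt (x + (p.rcheck : ℂ) * ((1 + b.flip.height θ : ℤ) : ℂ))
          (y - ((1 + b.height θ : ℤ) : ℂ)))
        (T (star i))) ∧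
    DeformedW.omegaField p (-((p.rcheck : ℂ) * ((1 + b.flip.height θ : ℤ) : ℂ)))
        ((1 + b.height θ : ℤ) : ℂ) (T i) =
      DeformedW.invert p 1 (T (star i)) := by
  have key : ∀ x y : ℂ, DeformedW.omegaField p x y (T i) =
      DeformedW.invert p
        (p.qt (x + (p.rcheck : ℂ) * ((1 + b.flip.height θ : ℤ) : ℂ))
          (y - ((1 + b.height θ : ℤ) : ℂ)))
        (T (star i)) := by
    intro x y
    obtain ⟨-, c, hc, hc1, -, hpaste⟩ := hT
    obtain ⟨-, c', hc', hc1', -, hpaste'⟩ := hT_star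
    rw [hc, hc', DeformedW.omegaField_fieldOf p x y
      ((p.rcheck : ℤ) * (1 + b.flip.height θ)) (1 + b.height θ),
      hpaste.mapDomain_flipMon hC hr hθ hstar hc1 hpaste' hc1']
    push_cast
    rfl
  refine ⟨key, ?_⟩
  rw [key, neg_add_cancel, sub_self]
  congr 1
  simp [DeformedW.Params.qt]
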